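/- **Setting.** A join $Q$ consists of $k$ relations $R_1,\dots,R_k$ over a total of $m$ attributes; $R_j$ is a finite set of tuples $\mathrm{schema}(R_j)\to\mathbb R$ (a domain value is one machine word), every attribute occurs in some schema, and $N=\sum_j|R_j|$. $\mathrm{Join}(Q)$ is the set of tuples $u$ over all attributes with $u[\mathrm{schema}(R_j)]\in R_j$ for every $j$. $Q$ is acyclic if there is a tree on $\{1,\dots,k\}$ such that, for each attribute $A$, the nodes $j$ with $A\in\mathrm{schema}(R_j)$ form a connected subtree. Each $R_j$ carries a weight function $\mathrm p_j:R_j\to[0,1]$. Put $\mathrm p(u)=\prod_{j=1}^k\mathrm p_j(u[\mathrm{schema}(R_j)])$ and $\mu_\Psi=\sum_{u\in\mathrm{Join}(Q)}\mathrm p(u)$. A subset sample of $\mathrm{Join}(Q)$ is a random set $X$ with $$\Pr[X=Y]=\prod_{u\in Y}\mathrm p(u)\prod_{u\in\mathrm{Join}(Q)\setminus Y}(1-\mathrm p(u))\qquad\text{for all }Y\subseteq\mathrm{Join}(Q).$$ The machine is the real RAM: memory cells hold real numbers, and accessing a cell, $+,-,\times,/$, comparison, truncation, $\log$, $\exp$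 and drawing a fresh uniform random number from $[0,1]$ cost one time unit each. Logarithms below are to base $2$. **Theorem.** For all $m,k$ there is a constant $C$ (depending on $m$ and $k$ only) such that for every acyclic schema with $m$ attributes and $k$ relations there are two real RAM programs, a deterministic one, BUILD, and a randomized one, QUERY, with the following properties for every join instance $Q$ with that schema, every choice of weight functions, and every order in which the tuples are listed in the input. 1. BUILD, started on the input, halts. If $N\ge 3$, it does so within $C\,N\log N\,\log\log N$ time units, and the index that it leaves in memory is contained in the memory cells with addresses less than $C\,N\log N$ (all other cells are $0$). 2. Let QUERY then be executed infinitely often, one execution after the other on the same memory, with fresh random numbers. Almost surely every execution halts and outputs, without repetitions, a finite list of tuples; let $X_i$ be the set listed by the $i$-th execution. Every $X_i$ is a subset sample of $\mathrm{Join}(Q)$, and $X_0,X_1,X_2,\dots$ are mutually independent. 3. If $N\ge3$, the expected running time of each execution of QUERY is at most $C\,(1+\mu_\Psi\log N)$. -/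

import Mathlib

open MeasureTheory ProbabilityTheory

/-! ## Joins -/

/-- The schema graph of a join with `k` relations: a hypergraph with vertex set `Fin m` (the
attributes) and a family of `k` hyperedges (the schemas of the relations, possibly with
repetitions).  The vertices are exactly the attributes that occur in some relation. -/
structure JoinSchema (m k : ℕ) where
  attrs : Fin k → Finset (Fin m)
  covers : ∀ a, ∃ j, a ∈ attrs j

/-- A join tree: a tree on the relations such that, for every attribute, the relations containing
that attribute form a connected subtree. -/
def JoinSchema.IsJoinTree {m k : ℕ} (Q : JoinSchema m k) (G : SimpleGraph (Fin k)) : Prop :=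
  G.IsTree ∧ ∀ a : Fin m, (G.induce {j | a ∈ Q.attrs j}).Connected

/-- The join is acyclic if its schema graph has a join tree. -/
def JoinSchema.IsAcyclic {m k : ℕ} (Q : JoinSchema m k) : Prop :=
  ∃ G : SimpleGraph (Fin k), Q.IsJoinTree G

/-- A tuple over the set `U` of attributes.  A value of the domain occupies one machine word, and a
word of a real RAM is a real number. -/
abbrev TupleOver {m : ℕ} (U : Finset (Fin m)) : Type := U → ℝ

/-- The projection `u[U]` of a tuple `u` over all attributes. -/
def projTuple {m : ℕ} (u : Fin m → ℝ) (U : Finset (Fin m)) : TupleOver U := fun a => u a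

/-- A join instance with schema `Q`: finite relations, and a weight in `[0,1]` for each tuple of
each relation. -/
structure JoinInstance {m k : ℕ} (Q : JoinSchema m k) where
  rel : (j : Fin k) → Finset (TupleOver (Q.attrs j))
  wt : (j : Fin k) → TupleOver (Q.attrs j) → ℝ
  wt_mem : ∀ j, ∀ t ∈ rel j, wt j t ∈ Set.Icc (0 : ℝ) 1

namespace JoinInstance

variable {m k : ℕ} {Q : JoinSchema m k}

/-- The input size `N`: the total number of tuples. -/
def size (I : JoinInstance Q) : ℕ := ∑ j, (I.rel j).card

/-- The set of join results. -/
def joinSet (I : JoinInstance Q) : Set (Fin m → ℝ) :=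
  {u | ∀ j, projTuple u (Q.attrs j) ∈ I.rel j}

theorem joinSet_finite (I : JoinInstance Q) : I.joinSet.Finite := by
  have hfin : {f : (j : Fin k) → TupleOver (Q.attrs j) | ∀ j, f j ∈ I.rel j}.Finite :=
    Set.Finite.pi' fun j => (I.rel j).finite_toSet
  refine Set.Finite.of_finite_image (f := fun u j => projTuple u (Q.attrs j))
    (hfin.subset ?_) ?_
  · rintro _ ⟨u, hu, rfl⟩ j
    exact hu j
  · intro u _ v _ h
    funext a
    obtain ⟨j, hj⟩ := Q.covers a
    exact congrFun (congrFun h j) ⟨a, hj⟩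

/-- The join result `Join(Q)`, as a finite set. -/
noncomputable def join (I : JoinInstance Q) : Finset (Fin m → ℝ) := I.joinSet_finite.toFinset

theorem mem_join (I : JoinInstance Q) (u : Fin m → ℝ) :
    u ∈ I.join ↔ ∀ j, projTuple u (Q.attrs j) ∈ I.rel j := by
  simp [join, joinSet]

/-- The probability of a join result: the product of the weights of its constituent tuples. -/
def prob (I : JoinInstance Q) (u : Fin m → ℝ) : ℝ := ∏ j, I.wt j (projTuple u (Q.attrs j))

/-- The expected size `μ` of a subset sample of `Join(Q)`. -/
noncomputable def mu (I : JoinInstance Q) : ℝ := ∑ u ∈ I.join, I.prob u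

end JoinInstance

/-! ## Subset sampling -/

open Classical in
/-- The random set `X` is a subset sample of `S` with probabilities `p`: each `e ∈ S` belongs to
`X` independently with probability `p e`. -/
def IsSubsetSample {Ω α : Type*} [MeasurableSpace Ω] (P : Measure Ω)
    (S : Finset α) (p : α → ℝ) (X : Ω → Finset α) : Prop :=
  ∀ Y, Y ⊆ S → NullMeasurableSet (X ⁻¹' {Y}) P ∧
    P.real (X ⁻¹' {Y}) = (∏ e ∈ Y, p e) * ∏ e ∈ S \ Y, (1 - p e)

/-! ## The real RAM -/

/-- A state of the real RAM: registers, memory (an infinite array of cells, each holding a real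
number), and the not yet consumed part of the stream of random numbers. -/
structure RamState where
  reg : ℕ → ℝ
  mem : ℕ → ℝ
  rnd : ℕ → ℝ

/-- Expressions: rational constants, registers, the memory cell at a computed address (truncated to
a natural number), arithmetic, truncation, logarithm and exponential. -/
inductive RamExpr : Type
  | lit (q : ℚ)
  | reg (x : ℕ)
  | load (e : RamExpr)
  | add (e f : RamExpr)
  | sub (e f : RamExpr)
  | mul (e f : RamExpr)
  | div (e f : RamExpr)
  | floor (e : RamExpr)
  | log (e : RamExpr)
  | exp (e : RamExpr)

namespace RamExpr

noncomputable def eval (s : RamState) : RamExpr → ℝ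
  | lit q => (q : ℝ)
  | reg x => s.reg x
  | load e => s.mem ⌊e.eval s⌋₊
  | add e f => e.eval s + f.eval s
  | sub e f => e.eval s - f.eval s
  | mul e f => e.eval s * f.eval s
  | div e f => e.eval s / f.eval s
  | floor e => (⌊e.eval s⌋ : ℝ)
  | log e => Real.log (e.eval s)
  | exp e => Real.exp (e.eval s)

/-- Every operation costs one time unit. -/
def cost : RamExpr → ℕ
  | lit _ => 1
  | reg _ => 1
  | load e => e.cost + 1
  | add e f => e.cost + f.cost + 1
  | sub e f => e.cost + f.cost + 1
  | mul e f => e.cost + f.cost + 1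
  | div e f => e.cost + f.cost + 1
  | floor e => e.cost + 1
  | log e => e.cost + 1
  | exp e => e.cost + 1

end RamExpr

/-- Tests: comparisons of real numbers and their Boolean combinations. -/
inductive RamTest : Type
  | le (e f : RamExpr)
  | lt (e f : RamExpr)
  | eq (e f : RamExpr)
  | not (b : RamTest)
  | and (b c : RamTest)
  | or (b c : RamTest)

namespace RamTest

def holds (s : RamState) : RamTest → Prop
  | le e f => e.eval s ≤ f.eval s
  | lt e f => e.eval s < f.eval s
  | eq e f => e.eval s = f.eval s
  | not b => ¬ b.holds s
  | and b c => b.holds s ∧ c.holds s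
  | or b c => b.holds s ∨ c.holds s

def cost : RamTest → ℕ
  | le e f => e.cost + f.cost + 1
  | lt e f => e.cost + f.cost + 1
  | eq e f => e.cost + f.cost + 1
  | not b => b.cost + 1
  | and b c => b.cost + c.cost + 1
  | or b c => b.cost + c.cost + 1

end RamTest

/-- Programs of the real RAM.  `store e f` writes the value of `f` to the memory cell with address
`e`, `rand x` puts a fresh random number into register `x`, and `loop b c` repeats `c` while the test
`b` holds. -/
inductive RamProg : Type
  | skip
  | assign (x : ℕ) (e : RamExpr)
  | store (e f : RamExpr)
  | rand (x : ℕ)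
  | seq (c d : RamProg)
  | ite (b : RamTest) (c d : RamProg)
  | loop (b : RamTest) (c : RamProg)

namespace RamState

def setReg (s : RamState) (x : ℕ) (v : ℝ) : RamState := { s with reg := Function.update s.reg x v }

def setMem (s : RamState) (a : ℕ) (v : ℝ) : RamState := { s with mem := Function.update s.mem a v }

/-- Remove the first number from the random stream. -/
def dropRnd (s : RamState) : RamState := { s with rnd := fun n => s.rnd (n + 1) }

/-- Provide a new random stream. -/
def withRnd (s : RamState) (ρ : ℕ → ℝ) : RamState := { s with rnd := ρ }

end RamState

/-- `RamExec c s t s'`: started in state `s`, the program `c` halts in state `s'` after exactly `t`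
time units. -/
inductive RamExec : RamProg → RamState → ℕ → RamState → Prop
  | skip (s : RamState) : RamExec .skip s 1 s
  | assign (s : RamState) (x : ℕ) (e : RamExpr) :
      RamExec (.assign x e) s (e.cost + 1) (s.setReg x (e.eval s))
  | store (s : RamState) (e f : RamExpr) :
      RamExec (.store e f) s (e.cost + f.cost + 1) (s.setMem ⌊e.eval s⌋₊ (f.eval s))
  | rand (s : RamState) (x : ℕ) :
      RamExec (.rand x) s 1 (s.dropRnd.setReg x (s.rnd 0))
  | seq {c d : RamProg} {s₁ s₂ s₃ : RamState} {t u : ℕ} :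
      RamExec c s₁ t s₂ → RamExec d s₂ u s₃ → RamExec (.seq c d) s₁ (t + u) s₃
  | ite_true {b : RamTest} {c d : RamProg} {s₁ s₂ : RamState} {t : ℕ} :
      b.holds s₁ → RamExec c s₁ t s₂ → RamExec (.ite b c d) s₁ (b.cost + 1 + t) s₂
  | ite_false {b : RamTest} {c d : RamProg} {s₁ s₂ : RamState} {t : ℕ} :
      ¬ b.holds s₁ → RamExec d s₁ t s₂ → RamExec (.ite b c d) s₁ (b.cost + 1 + t) s₂
  | loop_false {b : RamTest} {c : RamProg} {s : RamState} :
      ¬ b.holds s → RamExec (.loop b c) s (b.cost + 1) s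
  | loop_true {b : RamTest} {c : RamProg} {s₁ s₂ s₃ : RamState} {t u : ℕ} :
      b.holds s₁ → RamExec c s₁ t s₂ → RamExec (.loop b c) s₂ u s₃ →
      RamExec (.loop b c) s₁ (b.cost + 1 + t + u) s₃

/-- The running time and the final state are determined by the program and the initial state. -/
theorem RamExec.deterministic {c : RamProg} {s s₁ s₂ : RamState} {t₁ t₂ : ℕ}
    (h₁ : RamExec c s t₁ s₁) (h₂ : RamExec c s t₂ s₂) : t₁ = t₂ ∧ s₁ = s₂ := by
  induction h₁ generalizing t₂ s₂ with
  | skip s => cases h₂; exact ⟨rfl, rfl⟩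
  | assign s x e => cases h₂; exact ⟨rfl, rfl⟩
  | store s e f => cases h₂; exact ⟨rfl, rfl⟩
  | rand s x => cases h₂; exact ⟨rfl, rfl⟩
  | seq _ _ ih₁ ih₂ =>
    cases h₂ with
    | seq h h' =>
      obtain ⟨rfl, rfl⟩ := ih₁ h
      obtain ⟨rfl, rfl⟩ := ih₂ h'
      exact ⟨rfl, rfl⟩
  | ite_true hb _ ih =>
    cases h₂ with
    | ite_true _ h => obtain ⟨rfl, rfl⟩ := ih h; exact ⟨rfl, rfl⟩
    | ite_false hb' _ => exact absurd hb hb'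
  | ite_false hb _ ih =>
    cases h₂ with
    | ite_true hb' _ => exact absurd hb' hb
    | ite_false _ h => obtain ⟨rfl, rfl⟩ := ih h; exact ⟨rfl, rfl⟩
  | loop_false hb =>
    cases h₂ with
    | loop_false _ => exact ⟨rfl, rfl⟩
    | loop_true hb' _ _ => exact absurd hb' hb
  | loop_true hb _ _ ih₁ ih₂ =>
    cases h₂ with
    | loop_false hb' => exact absurd hb hb'
    | loop_true _ h h' =>
      obtain ⟨rfl, rfl⟩ := ih₁ h
      obtain ⟨rfl, rfl⟩ := ih₂ h'
      exact ⟨rfl, rfl⟩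

/-! ## Input and output -/

namespace JoinInstance

variable {m k : ℕ} {Q : JoinSchema m k}

/-- An (arbitrary) ordering of the tuples of each relation. -/
structure Listing (I : JoinInstance Q) where
  tuples : (j : Fin k) → List (TupleOver (Q.attrs j))
  nodup : ∀ j, (tuples j).Nodup
  mem_iff : ∀ j t, t ∈ tuples j ↔ t ∈ I.rel j

/-- The record of a tuple of the `j`-th relation: `m` words with its values (`0` at the attributes
outside the schema), followed by its weight. -/
def record (I : JoinInstance Q) (j : Fin k) (t : TupleOver (Q.attrs j)) : List ℝ :=
  (List.ofFn fun a : Fin m => if h : a ∈ Q.attrs j then t ⟨a, h⟩ else 0) ++ [I.wt j t]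

/-- The input: the sizes of the `k` relations, followed by the records of the tuples of the first
relation, of the second relation, and so on. -/
def inputWords (I : JoinInstance Q) (ord : I.Listing) : List ℝ :=
  (List.ofFn fun j : Fin k => ((I.rel j).card : ℝ)) ++
    (List.ofFn fun j : Fin k => (ord.tuples j).flatMap (I.record j)).flatten

/-- The initial state of the preprocessing: the input occupies an initial segment of the memory,
everything else is `0`.  Preprocessing is deterministic: no random numbers are provided. -/
def inputState (I : JoinInstance Q) (ord : I.Listing) : RamState where
  reg := fun _ => 0
  mem := fun a => (I.inputWords ord).getD a 0
  rnd := fun _ => 0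

end JoinInstance

/-- The output convention for a list of tuples over `m` attributes: register `0` holds the address
of an array of records of `m` words each, register `1` holds the number of records. -/
noncomputable def RamState.outputList (m : ℕ) (s : RamState) : List (Fin m → ℝ) :=
  (List.range ⌊s.reg 1⌋₊).map fun i a => s.mem (⌊s.reg 0⌋₊ + i * m + a)

open Classical in
noncomputable def RamState.outputSet (m : ℕ) (s : RamState) : Finset (Fin m → ℝ) :=
  (s.outputList m).toFinset

/-! ## Randomness and sequences of queries -/

/-- The uniform distribution on `[0,1]`. -/
noncomputable def unifMeasure : Measure ℝ := volume.restrict (Set.Icc 0 1)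

instance unifMeasure.isProbabilityMeasure : IsProbabilityMeasure unifMeasure :=
  ⟨by simp [unifMeasure]⟩

/-- A family of independent uniform random numbers: `ω i n` is the number returned by the `n`-th
`rand` instruction that is executed during the `i`-th query. -/
noncomputable def randMeasure : Measure (ℕ → ℕ → ℝ) :=
  Measure.infinitePi fun _ : ℕ => Measure.infinitePi fun _ : ℕ => unifMeasure

/-- An infinite sequence of queries, executed one after the other.  The memory is in state `D`
(the index) before the first query; each query starts in the state in which its predecessor has
left the machine, and obtains fresh random numbers.  Almost surely, all queries halt.
The `i`-th query ends in state `S (i + 1)` and takes `T i` time units. -/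
def IsQuerySequence (query : RamProg) (D : RamState) (S : ℕ → (ℕ → ℕ → ℝ) → RamState)
    (T : ℕ → (ℕ → ℕ → ℝ) → ℕ) : Prop :=
  (∀ ω, S 0 ω = D) ∧
    ∀ᵐ ω ∂randMeasure, ∀ i, RamExec query ((S i ω).withRnd (ω i)) (T i ω) (S (i + 1) ω)

/-! Lay the join results out on the half-line as consecutive intervals whose lengths are their
probabilities, in a lexicographic order. Two facts are needed: the result whose interval contains a
given number can be found in logarithmic time without enumerating the join, and a subset sample can
be drawn by looking up, on average, only `O(1 + μ)` numbers.

Locating. A join tree can be dismantled leaf by leaf (`JoinSchema.IsAcyclic.exists_joinOrder`). A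
leaf `c` shares with the remaining relations only attributes of its neighbour `q`, so the extensions
of a partial result by tuples of `c` depend on its `q`-tuple alone. Multiplying the weight of each
tuple of `q` by the total weight of its partners in `c` therefore eliminates `c` and preserves total
weights (`TupleLists.sum_weight_extensions`). The index holds every relation sorted by the
attributes it shares with its neighbour, together with the prefix sums of its weights. The total
weight `μ` is then the last prefix sum of the root. A number is located by adding the relations in
the reverse order, starting from the root: the partners of a tuple form a segment of a sorted list,
and binary search in the prefix sums selects one of them (`TupleLists.located_extend`,
`Layout.runs_locate`). Sorting is done with a tournament tree, so that building takes time `O(N log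
N)`, which is within the required bound.

Sampling. From the end of the last treated interval, jump ahead by an exponential variable of rate
`2`, truncated at `1/2`. All results passed over are rejected. The result of probability `p` that is
hit is accepted with probability `p / (1 - exp (-2p))` if the cap lies at or beyond the end of its
interval, and with probability `p` otherwise, in which case the hit is certain unless an earlier
element was hit. Memorylessness makes the decisions independent with the correct probabilities
(`SkipSampling.mean_bits`), and the expected number of hits is at most `4μ`
(`SkipSampling.mean_hits`). Each hit costs `O(log N)`.

Repetition. A query writes only behind the index, so its output is a function of the index and of
its own random numbers; independence of the queries follows from independence of the streams
(`exists_querySequence`). -/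

/-! ## A program logic with running times -/

namespace RamState

@[simp] theorem reg_setReg (s : RamState) (x y : ℕ) (v : ℝ) :
    (s.setReg x v).reg y = if y = x then v else s.reg y := by
  simp [setReg, Function.update_apply]

@[simp] theorem mem_setReg (s : RamState) (x : ℕ) (v : ℝ) : (s.setReg x v).mem = s.mem := rfl

@[simp] theorem rnd_setReg (s : RamState) (x : ℕ) (v : ℝ) : (s.setReg x v).rnd = s.rnd := rfl

@[simp] theorem reg_setMem (s : RamState) (a : ℕ) (v : ℝ) : (s.setMem a v).reg = s.reg := rfl

@[simp] theorem mem_setMem (s : RamState) (a b : ℕ) (v : ℝ) :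
    (s.setMem a v).mem b = if b = a then v else s.mem b := by
  simp [setMem, Function.update_apply]

@[simp] theorem reg_dropRnd (s : RamState) : s.dropRnd.reg = s.reg := rfl

@[simp] theorem mem_dropRnd (s : RamState) : s.dropRnd.mem = s.mem := rfl

@[simp] theorem rnd_dropRnd (s : RamState) (n : ℕ) : s.dropRnd.rnd n = s.rnd (n + 1) := rfl

end RamState

attribute [simp] RamExpr.eval RamTest.holds

/-- Started in state `s`, the program `c` halts within `t` time units in a state satisfying `R`. -/
def Runs (c : RamProg) (s : RamState) (t : ℕ) (R : RamState → Prop) : Prop :=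
  ∃ t' s', RamExec c s t' s' ∧ t' ≤ t ∧ R s'

namespace RamProg

/-- Programs without loops. -/
def LoopFree : RamProg → Prop
  | skip => True
  | assign _ _ => True
  | store _ _ => True
  | rand _ => True
  | seq c d => c.LoopFree ∧ d.LoopFree
  | ite _ c d => c.LoopFree ∧ d.LoopFree
  | loop _ _ => False

open Classical in
/-- The final state of a program without loops. -/
noncomputable def den : RamProg → RamState → RamState
  | skip, s => s
  | assign x e, s => s.setReg x (e.eval s)
  | store e f, s => s.setMem ⌊e.eval s⌋₊ (f.eval s)
  | rand x, s => s.dropRnd.setReg x (s.rnd 0)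
  | seq c d, s => d.den (c.den s)
  | ite b c d, s => if b.holds s then c.den s else d.den s
  | loop _ _, s => s

/-- A bound for the running time of a program without loops. -/
def scost : RamProg → ℕ
  | skip => 1
  | assign _ e => e.cost + 1
  | store e f => e.cost + f.cost + 1
  | rand _ => 1
  | seq c d => c.scost + d.scost
  | ite b c d => b.cost + 1 + (c.scost + d.scost)
  | loop _ _ => 0

attribute [simp] LoopFree

@[simp] theorem den_assign (x : ℕ) (e : RamExpr) (s : RamState) :
    (assign x e).den s = s.setReg x (e.eval s) := rfl

@[simp] theorem den_store (e f : RamExpr) (s : RamState) :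
    (store e f).den s = s.setMem ⌊e.eval s⌋₊ (f.eval s) := rfl

@[simp] theorem den_rand (x : ℕ) (s : RamState) :
    (rand x).den s = s.dropRnd.setReg x (s.rnd 0) := rfl

@[simp] theorem den_seq (c d : RamProg) (s : RamState) : (seq c d).den s = d.den (c.den s) := rfl

theorem den_ite_pos {b : RamTest} {c d : RamProg} {s : RamState} (h : b.holds s) :
    (ite b c d).den s = c.den s := if_pos h

theorem den_ite_neg {b : RamTest} {c d : RamProg} {s : RamState} (h : ¬ b.holds s) :
    (ite b c d).den s = d.den s := if_neg h

/-- Straight-line code always halts, so its correctness reduces to evaluating `den`, and invariants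
are needed for loops only. As `scost` charges both branches of a conditional, the time bound does
not depend on the state. -/
theorem LoopFree.runs : ∀ {c : RamProg}, c.LoopFree → ∀ (s : RamState) {R : RamState → Prop},
    R (c.den s) → Runs c s c.scost R
  | skip, _, s, _, hR => ⟨_, _, .skip s, le_rfl, hR⟩
  | assign x e, _, s, _, hR => ⟨_, _, .assign s x e, le_rfl, hR⟩
  | store e f, _, s, _, hR => ⟨_, _, .store s e f, le_rfl, hR⟩
  | rand x, _, s, _, hR => ⟨_, _, .rand s x, le_rfl, hR⟩
  | seq c d, h, s, R, hR => by
    obtain ⟨t, s', h1, h2, h3⟩ := LoopFree.runs h.1 s (R := fun s' => s' = c.den s) rfl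
    subst h3
    obtain ⟨u, s'', h4, h5, h6⟩ := LoopFree.runs h.2 (c.den s) (R := R) hR
    exact ⟨_, _, .seq h1 h4, Nat.add_le_add h2 h5, h6⟩
  | ite b c d, h, s, R, hR => by
    by_cases hb : b.holds s
    · simp only [den, if_pos hb] at hR
      obtain ⟨t, s', h1, h2, h3⟩ := LoopFree.runs h.1 s hR
      exact ⟨_, _, .ite_true hb h1, by simp only [scost]; omega, h3⟩
    · simp only [den, if_neg hb] at hR
      obtain ⟨t, s', h1, h2, h3⟩ := LoopFree.runs h.2 s hR
      exact ⟨_, _, .ite_false hb h1, by simp only [scost]; omega, h3⟩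

end RamProg

namespace Runs

variable {c d : RamProg} {b : RamTest} {s : RamState} {t u : ℕ} {R R' : RamState → Prop}

theorem mono (h : Runs c s t R) (htu : t ≤ u) (hR : ∀ s', R s' → R' s') : Runs c s u R' := by
  obtain ⟨t', s', h1, h2, h3⟩ := h
  exact ⟨t', s', h1, h2.trans htu, hR _ h3⟩

theorem seq (h : Runs c s t fun s' => Runs d s' u R) : Runs (.seq c d) s (t + u) R := by
  obtain ⟨t', s', h1, h2, u', s'', h3, h4, h5⟩ := h
  exact ⟨_, _, .seq h1 h3, Nat.add_le_add h2 h4, h5⟩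

theorem seq' (h : Runs c s t R) (h' : ∀ s', R s' → Runs d s' u R') :
    Runs (.seq c d) s (t + u) R' :=
  seq (h.mono le_rfl h')

/-- The loop rule: `Inv n s` says that the loop, started in state `s`, is iterated at most `n`
times. -/
theorem loop {Inv : ℕ → RamState → Prop}
    (h : ∀ n s, Inv n s → (¬ b.holds s ∧ R s) ∨
      (b.holds s ∧ Runs c s t fun s' => ∃ n' < n, Inv n' s')) :
    ∀ n s, Inv n s → Runs (.loop b c) s (n * (b.cost + 1 + t) + (b.cost + 1)) R := by
  intro n
  induction n using Nat.strong_induction_on with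
  | _ n ih =>
    intro s hs
    rcases h n s hs with ⟨hb, hR⟩ | ⟨hb, t', s', h1, h2, n', hn', hI⟩
    · exact ⟨_, _, .loop_false hb, by omega, hR⟩
    · obtain ⟨u', s'', h3, h4, h5⟩ := ih n' hn' s' hI
      refine ⟨_, _, .loop_true hb h1 h3, ?_, h5⟩
      have : (n' + 1) * (b.cost + 1 + t) ≤ n * (b.cost + 1 + t) := Nat.mul_le_mul_right _ hn'
      rw [Nat.add_mul, one_mul] at this
      omega

end Runs

/-! ## Measurability of the semantics -/

namespace RamState

instance : MeasurableSpace RamState :=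
  MeasurableSpace.comap (fun s => (s.reg, s.mem, s.rnd)) inferInstance

theorem measurable_toProd : Measurable fun s : RamState => (s.reg, s.mem, s.rnd) :=
  comap_measurable _

theorem measurable_reg (x : ℕ) : Measurable fun s : RamState => s.reg x :=
  (measurable_pi_apply x).comp (measurable_fst.comp measurable_toProd)

theorem measurable_mem (x : ℕ) : Measurable fun s : RamState => s.mem x :=
  (measurable_pi_apply x).comp (measurable_fst.comp (measurable_snd.comp measurable_toProd))

theorem measurable_rnd (x : ℕ) : Measurable fun s : RamState => s.rnd x :=
  (measurable_pi_apply x).comp (measurable_snd.comp (measurable_snd.comp measurable_toProd))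

theorem measurable_mk {Ω : Type*} [MeasurableSpace Ω] {f : Ω → RamState}
    (h1 : ∀ x, Measurable fun ω => (f ω).reg x) (h2 : ∀ x, Measurable fun ω => (f ω).mem x)
    (h3 : ∀ x, Measurable fun ω => (f ω).rnd x) : Measurable f :=
  measurable_comap_iff.2
    ((measurable_pi_lambda _ h1).prodMk ((measurable_pi_lambda _ h2).prodMk
      (measurable_pi_lambda _ h3)))

end RamState

/-- Addresses range over a countable set, so memory access at a computed address is measurable. -/
theorem measurable_apply_nat {Ω : Type*} [MeasurableSpace Ω] {f : Ω → ℕ → ℝ} {g : Ω → ℕ}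
    (hf : ∀ n, Measurable fun ω => f ω n) (hg : Measurable g) : Measurable fun ω => f ω (g ω) := by
  have h : Measurable fun p : Ω × ℕ => f p.1 p.2 := measurable_from_prod_countable_left hf
  exact h.comp (measurable_id.prodMk hg)

theorem RamExpr.measurable_eval : ∀ e : RamExpr, Measurable fun s => e.eval s
  | lit _ => measurable_const
  | reg x => RamState.measurable_reg x
  | load e => measurable_apply_nat RamState.measurable_mem
      (Nat.measurable_floor.comp e.measurable_eval)
  | add e f => e.measurable_eval.add f.measurable_eval
  | sub e f => e.measurable_eval.sub f.measurable_eval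
  | mul e f => e.measurable_eval.mul f.measurable_eval
  | div e f => e.measurable_eval.div f.measurable_eval
  | floor e => (measurable_from_top (f := fun z : ℤ => (z : ℝ))).comp
      (Int.measurable_floor.comp e.measurable_eval)
  | log e => Real.measurable_log.comp e.measurable_eval
  | exp e => Real.measurable_exp.comp e.measurable_eval

theorem RamTest.measurableSet_holds : ∀ b : RamTest, MeasurableSet {s | b.holds s}
  | le e f => measurableSet_le e.measurable_eval f.measurable_eval
  | lt e f => measurableSet_lt e.measurable_eval f.measurable_eval
  | eq e f => measurableSet_eq_fun e.measurable_eval f.measurable_eval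
  | not b => b.measurableSet_holds.compl
  | and b c => b.measurableSet_holds.inter c.measurableSet_holds
  | or b c => b.measurableSet_holds.union c.measurableSet_holds

namespace RamProg

/-- Halting, the final state and the running time of a program are measurable. -/
structure MeasSem (c : RamProg) where
  dom : Set RamState
  fin : RamState → RamState
  time : RamState → ℕ
  measurableSet_dom : MeasurableSet dom
  measurable_fin : Measurable fin
  measurable_time : Measurable time
  exec : ∀ s ∈ dom, RamExec c s (time s) (fin s)
  mem_dom : ∀ {s t s'}, RamExec c s t s' → s ∈ dom

theorem measurable_setReg {Ω : Type*} [MeasurableSpace Ω] {f : Ω → RamState} {g : Ω → ℝ} (x : ℕ)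
    (hf : Measurable f) (hg : Measurable g) : Measurable fun ω => (f ω).setReg x (g ω) := by
  refine RamState.measurable_mk (fun y => ?_)
    (fun y => show Measurable fun ω => (f ω).mem y from (RamState.measurable_mem y).comp hf)
    (fun y => show Measurable fun ω => (f ω).rnd y from (RamState.measurable_rnd y).comp hf)
  simp only [RamState.reg_setReg]
  split_ifs
  · exact hg
  · exact (RamState.measurable_reg y).comp hf

theorem measurable_setMem {Ω : Type*} [MeasurableSpace Ω] {f : Ω → RamState} {a : Ω → ℕ}
    {g : Ω → ℝ} (hf : Measurable f) (ha : Measurable a) (hg : Measurable g) :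
    Measurable fun ω => (f ω).setMem (a ω) (g ω) := by
  refine RamState.measurable_mk
    (fun y => show Measurable fun ω => (f ω).reg y from (RamState.measurable_reg y).comp hf)
    (fun y => ?_)
    (fun y => show Measurable fun ω => (f ω).rnd y from (RamState.measurable_rnd y).comp hf)
  simp only [RamState.mem_setMem]
  exact Measurable.ite (measurableSet_eq_fun measurable_const ha) hg
    ((RamState.measurable_mem y).comp hf)

theorem measurable_dropRnd : Measurable RamState.dropRnd :=
  RamState.measurable_mk RamState.measurable_reg RamState.measurable_mem
    fun y => RamState.measurable_rnd (y + 1)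

/-- Execution is only a relation; this turns it into measurable functions, from which the sequence
of states between queries is defined and by which the running times are measurable. For a loop, `A
n` is the set of states from which exactly `n` iterations are made; these sets are disjoint and
measurable, and final state and time are glued from the countably many iterates of the body. -/
theorem nonempty_measSem (c : RamProg) : Nonempty c.MeasSem := by
  induction c with
  | skip =>
    exact ⟨⟨Set.univ, id, fun _ => 1, .univ, measurable_id, measurable_const,
      fun s _ => .skip s, fun _ => trivial⟩⟩
  | assign x e =>
    exact ⟨⟨Set.univ, fun s => s.setReg x (e.eval s), fun _ => e.cost + 1, .univ,
      measurable_setReg x measurable_id e.measurable_eval, measurable_const,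
      fun s _ => .assign s x e, fun _ => trivial⟩⟩
  | store e f =>
    exact ⟨⟨Set.univ, fun s => s.setMem ⌊e.eval s⌋₊ (f.eval s), fun _ => e.cost + f.cost + 1, .univ,
      measurable_setMem measurable_id (Nat.measurable_floor.comp e.measurable_eval)
        f.measurable_eval, measurable_const,
      fun s _ => .store s e f, fun _ => trivial⟩⟩
  | rand x =>
    exact ⟨⟨Set.univ, fun s => s.dropRnd.setReg x (s.rnd 0), fun _ => 1, .univ,
      measurable_setReg x measurable_dropRnd (RamState.measurable_rnd 0), measurable_const,
      fun s _ => .rand s x, fun _ => trivial⟩⟩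
  | seq c d hc hd =>
    obtain ⟨c'⟩ := hc
    obtain ⟨d'⟩ := hd
    refine ⟨⟨c'.dom ∩ c'.fin ⁻¹' d'.dom, fun s => d'.fin (c'.fin s),
      fun s => c'.time s + d'.time (c'.fin s),
      c'.measurableSet_dom.inter (c'.measurable_fin d'.measurableSet_dom),
      d'.measurable_fin.comp c'.measurable_fin,
      c'.measurable_time.add (d'.measurable_time.comp c'.measurable_fin),
      fun s hs => .seq (c'.exec s hs.1) (d'.exec _ hs.2), ?_⟩⟩
    intro s t s' h
    cases h with
    | seq h1 h2 =>
      have hs := c'.mem_dom h1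
      obtain ⟨-, rfl⟩ := h1.deterministic (c'.exec _ hs)
      exact ⟨hs, d'.mem_dom h2⟩
  | ite b c d hc hd =>
    obtain ⟨c'⟩ := hc
    obtain ⟨d'⟩ := hd
    classical
    have hb := b.measurableSet_holds
    refine ⟨⟨({s | b.holds s} ∩ c'.dom) ∪ ({s | b.holds s}ᶜ ∩ d'.dom),
      fun s => if b.holds s then c'.fin s else d'.fin s,
      fun s => b.cost + 1 + if b.holds s then c'.time s else d'.time s,
      (hb.inter c'.measurableSet_dom).union (hb.compl.inter d'.measurableSet_dom),
      c'.measurable_fin.ite hb d'.measurable_fin,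
      measurable_const.add (c'.measurable_time.ite hb d'.measurable_time), ?_, ?_⟩⟩
    · rintro s (⟨h, hs⟩ | ⟨h, hs⟩)
      · simp only [Set.mem_ofPred_eq] at h
        simpa only [if_pos h] using .ite_true h (c'.exec s hs)
      · simp only [Set.mem_compl_iff, Set.mem_ofPred_eq] at h
        simpa only [if_neg h] using .ite_false h (d'.exec s hs)
    · intro s t s' h
      cases h with
      | ite_true hb h1 => exact Or.inl ⟨hb, c'.mem_dom h1⟩
      | ite_false hb h1 => exact Or.inr ⟨hb, d'.mem_dom h1⟩
  | loop b c hc =>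
    obtain ⟨c'⟩ := hc
    have hb := b.measurableSet_holds
    set g := c'.fin with hg
    have hgm : ∀ n, Measurable (g^[n]) := fun n => c'.measurable_fin.iterate n
    set A : ℕ → Set RamState := fun n =>
      (⋂ i ∈ Finset.range n, g^[i] ⁻¹' ({s | b.holds s} ∩ c'.dom)) ∩ g^[n] ⁻¹' {s | b.holds s}ᶜ
      with hA
    have hAm : ∀ n, MeasurableSet (A n) := fun n =>
      (Finset.measurableSet_biInter _ fun i _ => hgm i (hb.inter c'.measurableSet_dom)).inter
        (hgm n hb.compl)
    have hAmem : ∀ n s, s ∈ A n ↔ (∀ i < n, b.holds (g^[i] s) ∧ g^[i] s ∈ c'.dom) ∧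
        ¬ b.holds (g^[n] s) := by
      intro n s; simp [hA]
    have hAd : ∀ n n' s, s ∈ A n → s ∈ A n' → n = n' := by
      intro n n' s h h'
      rw [hAmem] at h h'
      rcases lt_trichotomy n n' with hlt | heq | hlt
      · exact absurd (h'.1 n hlt).1 h.2
      · exact heq
      · exact absurd (h.1 n' hlt).1 h'.2
    set T : ℕ → RamState → ℕ := fun n s =>
      (∑ i ∈ Finset.range n, (b.cost + 1 + c'.time (g^[i] s))) + (b.cost + 1) with hT
    have hTm : ∀ n, Measurable (T n) := fun n =>
      (Finset.measurable_fun_sum _ fun i _ =>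
        measurable_const.add (c'.measurable_time.comp (hgm i))).add measurable_const
    have hexec : ∀ n s, s ∈ A n → RamExec (.loop b c) s (T n s) (g^[n] s) := by
      intro n
      induction n with
      | zero =>
        intro s hs
        have := ((hAmem 0 s).1 hs).2
        simpa [hT] using RamExec.loop_false this
      | succ n ih =>
        intro s hs
        obtain ⟨h1, h2⟩ := (hAmem _ s).1 hs
        have h0 := h1 0 (Nat.succ_pos n)
        have h3 := ih (g s) ((hAmem _ _).2 ⟨fun i hi => h1 (i + 1) (by omega), h2⟩)
        have h4 := RamExec.loop_true h0.1 (c'.exec _ h0.2) h3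
        have : b.cost + 1 + c'.time s + T n (g s) = T (n + 1) s := by
          simp only [hT, Finset.sum_range_succ', Function.iterate_succ_apply,
            Function.iterate_zero, id]
          omega
        rw [← this]
        exact h4
    classical
    set ι : RamState → ℕ := fun s => sInf {n | s ∈ A n} with hι
    have hιeq : ∀ n s, s ∈ A n → ι s = n := by
      intro n s hs
      have : {n | s ∈ A n} = {n} := by
        ext n'; exact ⟨fun h => hAd _ _ _ h hs, fun h => by rw [Set.mem_singleton_iff.1 h]; exact hs⟩
      simp [hι, this]
    have hιm : Measurable ι := by
      refine measurable_to_countable' fun n => ?_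
      -- States from which the loop does not halt have `ι = sInf ∅ = 0`, so they have to be added to
      -- the fibre of `0`.
      have : ι ⁻¹' {n} = A n ∪ (if n = 0 then (⋃ n, A n)ᶜ else ∅) := by
        ext s
        by_cases hs : s ∈ ⋃ n, A n
        · obtain ⟨n', hn'⟩ := Set.mem_iUnion.1 hs
          have h1 := hιeq _ _ hn'
          have h2 : s ∈ (if n = 0 then (⋃ n, A n)ᶜ else ∅ : Set RamState) → False := by
            split_ifs
            · exact fun h => h hs
            · exact fun h => h
          simp only [Set.mem_preimage, Set.mem_singleton_iff, Set.mem_union]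
          constructor
          · intro h; exact Or.inl (h ▸ h1 ▸ hn')
          · rintro (h | h)
            · exact hιeq _ _ h
            · exact (h2 h).elim
        · have h1 : ∀ n, s ∉ A n := fun n h => hs (Set.mem_iUnion.2 ⟨n, h⟩)
          have h2 : ι s = 0 := by simp [hι, h1]
          simp only [Set.mem_preimage, h2, Set.mem_singleton_iff, Set.mem_union, h1, false_or]
          split_ifs with h
          · simp [h, h1]
          · simp [Ne.symm h]
      rw [this]
      refine (hAm n).union ?_
      split_ifs
      · exact (MeasurableSet.iUnion hAm).compl
      · exact .empty
    refine ⟨⟨⋃ n, A n, fun s => g^[ι s] s, fun s => T (ι s) s, .iUnion hAm, ?_, ?_, ?_, ?_⟩⟩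
    · have h : Measurable fun p : RamState × ℕ => g^[p.2] p.1 :=
        measurable_from_prod_countable_left hgm
      exact h.comp (measurable_id.prodMk hιm)
    · have h : Measurable fun p : RamState × ℕ => T p.2 p.1 :=
        measurable_from_prod_countable_left hTm
      exact h.comp (measurable_id.prodMk hιm)
    · intro s hs
      obtain ⟨n, hn⟩ := Set.mem_iUnion.1 hs
      simp only [hιeq _ _ hn]
      exact hexec n s hn
    · intro s t s' h
      generalize hl : RamProg.loop b c = l at h
      induction h with
      | skip | assign | store | rand | seq | ite_true | ite_false => cases hl
      | loop_false hb' =>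
        cases hl
        exact Set.mem_iUnion.2 ⟨0, (hAmem _ _).2 ⟨by simp, hb'⟩⟩
      | loop_true hb' h1 h2 ih1 ih2 =>
        cases hl
        obtain ⟨n, hn⟩ := Set.mem_iUnion.1 (ih2 rfl)
        have hs := c'.mem_dom h1
        obtain ⟨-, rfl⟩ := h1.deterministic (c'.exec _ hs)
        obtain ⟨h3, h4⟩ := (hAmem _ _).1 hn
        refine Set.mem_iUnion.2 ⟨n + 1, (hAmem _ _).2 ⟨?_, h4⟩⟩
        rintro (_ | i) hi
        · exact ⟨hb', hs⟩
        · exact h3 i (by omega)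

end RamProg

/-! ## Subset sampling by exponential skips -/

/-- The law of a stream of uniform random numbers. -/
noncomputable def streamMeasure : Measure (ℕ → ℝ) := Measure.infinitePi fun _ : ℕ => unifMeasure

instance : IsProbabilityMeasure streamMeasure := by
  unfold streamMeasure; infer_instance

/-- Put a number in front of a stream. -/
def streamCons (x : ℝ × (ℕ → ℝ)) : ℕ → ℝ
  | 0 => x.1
  | n + 1 => x.2 n

theorem measurable_streamCons : Measurable streamCons := by
  refine measurable_pi_lambda _ fun n => ?_
  cases n with
  | zero => exact measurable_fst
  | succ n => exact (measurable_pi_apply n).comp measurable_snd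

/-- An infinite product is determined by its values on cylinders, and a cylinder of the stream
splits into a condition on the first number and a cylinder of the tail. -/
theorem map_streamCons : (unifMeasure.prod streamMeasure).map streamCons = streamMeasure := by
  refine Measure.eq_infinitePi _ fun s t ht => ?_
  rw [Measure.map_apply measurable_streamCons (MeasurableSet.pi s.countable_toSet fun i _ => ht i)]
  -- Filling up with `univ` replaces the arbitrary finite index set by an initial segment, from
  -- which index `0` can be split off.
  set t' : ℕ → Set ℝ := fun i => if i ∈ s then t i else Set.univ with ht'
  have ht'm : ∀ i, MeasurableSet (t' i) := by
    intro i; simp only [ht']; split_ifs; exacts [ht i, .univ]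
  obtain ⟨N, hN⟩ : ∃ N, ∀ i ∈ s, i < N + 1 := ⟨s.sup id, fun i hi =>
    Nat.lt_succ_of_le (Finset.le_sup (f := id) hi)⟩
  have hpre : streamCons ⁻¹' (Set.pi s t) =
      t' 0 ×ˢ Set.pi (Finset.range N : Set ℕ) (fun i => t' (i + 1)) := by
    ext x
    simp only [Set.mem_preimage, Set.mem_pi, Set.mem_prod, Finset.coe_range, Set.mem_Iio,
      Finset.mem_coe, ht']
    constructor
    · intro h
      constructor
      · split_ifs with h0
        · exact h 0 h0
        · trivial
      · intro i _
        split_ifs with h0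
        · exact h (i + 1) h0
        · trivial
    · rintro ⟨h0, h1⟩ i hi
      cases i with
      | zero => simpa [hi, streamCons] using h0
      | succ i => simpa [hi, streamCons] using h1 i (by have := hN _ hi; omega)
  rw [hpre, Measure.prod_prod, streamMeasure,
    Measure.infinitePi_pi _ (fun i _ => ht'm _)]
  have h1 : ∏ i ∈ s, unifMeasure (t i) = ∏ i ∈ Finset.range (N + 1), unifMeasure (t' i) := by
    have hs : s ⊆ Finset.range (N + 1) := fun i hi => Finset.mem_range.2 (hN i hi)
    rw [← Finset.prod_subset hs]
    · exact Finset.prod_congr rfl fun i hi => by simp [ht', hi]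
    · intro i _ hi
      simp [ht', hi]
  rw [h1, Finset.prod_range_succ']
  exact mul_comm _ _

/-- Fubini for the first number of a stream: the sampler consumes its random numbers one at a time,
and each can be integrated separately from the numbers still unused. -/
theorem lintegral_stream {f : ℝ × (ℕ → ℝ) → ENNReal} (hf : Measurable f) :
    ∫⁻ ρ, f (ρ 0, fun n => ρ (n + 1)) ∂streamMeasure =
      ∫⁻ u, ∫⁻ ρ, f (u, ρ) ∂streamMeasure ∂unifMeasure := by
  have hm : Measurable fun ρ : ℕ → ℝ => f (ρ 0, fun n => ρ (n + 1)) :=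
    hf.comp ((measurable_pi_apply 0).prodMk
      (measurable_pi_lambda _ fun n => measurable_pi_apply (n + 1)))
  conv_lhs => rw [← map_streamCons]
  rw [lintegral_map hm measurable_streamCons, lintegral_prod _ (by
    exact (hm.comp measurable_streamCons).aemeasurable)]
  rfl

/-- Discarding the null point `0` removes the argument at which `Real.log` has a junk value. -/
theorem unifMeasure_eq : unifMeasure = volume.restrict (Set.Ioc 0 1) :=
  Measure.restrict_congr_set Ioc_ae_eq_Icc.symm

/-- A coin with success probability `a`. -/
theorem lintegral_coin {a : ℝ} (h0 : 0 ≤ a) (h1 : a ≤ 1) (f : Bool → ENNReal) :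
    ∫⁻ v, f (decide (v < a)) ∂unifMeasure =
      ENNReal.ofReal a * f true + ENNReal.ofReal (1 - a) * f false := by
  have hI : Set.Icc (0 : ℝ) 1 = Set.Ico 0 a ∪ Set.Icc a 1 := (Set.Ico_union_Icc_eq_Icc h0 h1).symm
  rw [unifMeasure, hI, lintegral_union measurableSet_Icc (by
    rw [Set.disjoint_left]; intro x hx hx'; exact absurd hx.2 (not_lt.2 hx'.1))]
  congr 1
  · rw [setLIntegral_congr_fun (g := fun _ => f true) measurableSet_Ico
      (fun x hx => by simp [hx.2])]
    simp [mul_comm]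
  · rw [setLIntegral_congr_fun (g := fun _ => f false) measurableSet_Icc
      (fun x hx => by simp [not_lt.2 hx.1])]
    simp [mul_comm]

/-- The exponential distribution with rate `2` is memoryless. -/
theorem lintegral_memoryless {p : ℝ} (hp : 0 ≤ p) {f : ℝ → ENNReal} (hf : Measurable f)
    (c : ENNReal) :
    ∫⁻ u, (if p ≤ -Real.log u / 2 then f (-Real.log u / 2 - p) else c) ∂unifMeasure =
      ENNReal.ofReal (Real.exp (-2 * p)) * ∫⁻ u, f (-Real.log u / 2) ∂unifMeasure +
        ENNReal.ofReal (1 - Real.exp (-2 * p)) * c := by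
  set e := Real.exp (-2 * p) with he
  have he0 : 0 < e := Real.exp_pos _
  have he1 : e ≤ 1 := by rw [he, Real.exp_le_one_iff]; linarith
  have hiff : ∀ u, 0 < u → (p ≤ -Real.log u / 2 ↔ u ≤ e) := by
    intro u hu
    rw [he, ← Real.log_le_iff_le_exp hu]
    constructor <;> intro h <;> linarith
  have hI : Set.Ioc (0 : ℝ) 1 = Set.Ioc 0 e ∪ Set.Ioc e 1 :=
    (Set.Ioc_union_Ioc_eq_Ioc he0.le he1).symm
  have hm : Measurable fun u : ℝ => f (-Real.log u / 2) :=
    hf.comp (Real.measurable_log.neg.div_const 2)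
  rw [unifMeasure_eq]
  conv_lhs => rw [hI]
  rw [lintegral_union measurableSet_Ioc (by
    rw [Set.disjoint_left]; intro x hx hx'; exact absurd hx'.1 (not_lt.2 hx.2))]
  congr 1
  -- The skip reaches `p` exactly when `u ≤ e`. Given this, `e⁻¹ * u` is again uniform, and its skip
  -- is the old one shortened by `p`.
  · rw [setLIntegral_congr_fun (g := fun u => f (-Real.log (e⁻¹ * u) / 2)) measurableSet_Ioc
      (fun u hu => by
        simp only [if_pos ((hiff u hu.1).2 hu.2)]
        rw [Real.log_mul (inv_ne_zero he0.ne') hu.1.ne', Real.log_inv, he, Real.log_exp]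
        congr 1; ring)]
    have h1 := Real.map_volume_mul_left (a := e⁻¹) (inv_ne_zero he0.ne')
    have h2 : Set.Ioc (0 : ℝ) e = (fun u => e⁻¹ * u) ⁻¹' Set.Ioc 0 1 := by
      ext u
      simp only [Set.mem_preimage, Set.mem_Ioc]
      rw [← div_eq_inv_mul, div_le_one he0, lt_div_iff₀ he0, zero_mul]
    rw [h2, ← setLIntegral_map measurableSet_Ioc hm (measurable_const_mul _), h1, inv_inv,
      abs_of_pos he0, Measure.restrict_smul, lintegral_smul_measure, smul_eq_mul]
  · rw [setLIntegral_congr_fun (g := fun _ => c) measurableSet_Ioc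
      (fun u hu => if_neg fun h => absurd ((hiff u (he0.trans hu.1)).1 h) (not_le.2 hu.1))]
    simp [mul_comm]

namespace SkipSampling

/-- The probability with which an element of probability `p` is accepted when it is hit and the
cap for the current skip lies at distance `h`. -/
noncomputable def accept (p h : ℝ) : ℝ := if h < p then p else p / (1 - Real.exp (-2 * p))

/-- Sampling from a list of elements with given probabilities: `g` is the remaining length of the
current exponential skip and `h` is the remaining distance to the cap.  The result lists which
elements have been included, and counts the elements that have been hit. -/
noncomputable def run : List ℝ → ℝ → ℝ → (ℕ → ℝ) → List Bool × ℕ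
  | [], _, _, _ => ([], 0)
  | p :: L, g, h, ρ =>
    if p ≤ g ∧ p ≤ h then
      ((false :: (run L (g - p) (h - p) ρ).1), (run L (g - p) (h - p) ρ).2)
    else
      (decide (ρ 0 < accept p h) :: (run L (-Real.log (ρ 1) / 2) (1 / 2) fun n => ρ (n + 2)).1,
        (run L (-Real.log (ρ 1) / 2) (1 / 2) fun n => ρ (n + 2)).2 + 1)

open Classical in
theorem measurable_ite_ennreal {Ω : Type*} [MeasurableSpace Ω] {q : Ω → Prop} {f g : Ω → ENNReal}
    (hq : MeasurableSet {x | q x}) (hf : Measurable f) (hg : Measurable g) :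
    Measurable fun x => if q x then f x else g x :=
  Measurable.ite hq hf hg

/-- Quantifying over all test functions `φ` avoids a choice of σ-algebra on the outcomes and lets
the induction absorb the bit of the first element into `φ`. -/
theorem measurable_run (L : List ℝ) : ∀ (h : ℝ) (φ : List Bool × ℕ → ENNReal),
    Measurable fun x : ℝ × (ℕ → ℝ) => φ (run L x.1 h x.2) := by
  induction L with
  | nil => intro h φ; simp only [run]; exact measurable_const
  | cons p L ih =>
    intro h φ
    have h1 : Measurable fun x : ℝ × (ℕ → ℝ) =>
        φ (false :: (run L (x.1 - p) (h - p) x.2).1, (run L (x.1 - p) (h - p) x.2).2) :=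
      (ih (h - p) fun r => φ (false :: r.1, r.2)).comp
        ((measurable_fst.sub_const p).prodMk measurable_snd)
    have hT : Measurable fun x : ℝ × (ℕ → ℝ) =>
        ((-Real.log (x.2 1) / 2, fun n => x.2 (n + 2)) : ℝ × (ℕ → ℝ)) := by
      have h0 : ∀ n, Measurable fun x : ℝ × (ℕ → ℝ) => x.2 n := fun n =>
        (measurable_pi_apply n).comp measurable_snd
      exact ((Real.measurable_log.comp (h0 1)).neg.div_const 2).prodMk
        (measurable_pi_lambda _ fun n => h0 (n + 2))
    have h2 : ∀ b, Measurable fun x : ℝ × (ℕ → ℝ) =>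
        φ (b :: (run L (-Real.log (x.2 1) / 2) (1 / 2) fun n => x.2 (n + 2)).1,
          (run L (-Real.log (x.2 1) / 2) (1 / 2) fun n => x.2 (n + 2)).2 + 1) := fun b =>
      (ih (1 / 2) fun r => φ (b :: r.1, r.2 + 1)).comp hT
    have hset : MeasurableSet {x : ℝ × (ℕ → ℝ) | p ≤ x.1 ∧ p ≤ h} :=
      (measurableSet_le measurable_const measurable_fst).inter (.const _)
    have hset' : MeasurableSet {x : ℝ × (ℕ → ℝ) | x.2 0 < accept p h} :=
      measurableSet_lt ((measurable_pi_apply 0).comp measurable_snd) measurable_const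
    have key := measurable_ite_ennreal hset h1 (measurable_ite_ennreal hset' (h2 true) (h2 false))
    convert key using 2 with x
    by_cases h3 : p ≤ x.1 ∧ p ≤ h
    · simp only [run, if_pos h3]
    · by_cases h4 : x.2 0 < accept p h <;> simp only [run, if_neg h3, h4] <;> simp

/-- The mean of `φ (run L g h ρ)` if `g` is exponentially distributed with rate `2`. -/
noncomputable def mean (L : List ℝ) (h : ℝ) (φ : List Bool × ℕ → ENNReal) : ENNReal :=
  ∫⁻ u, ∫⁻ ρ, φ (run L (-Real.log u / 2) h ρ) ∂streamMeasure ∂unifMeasure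

theorem measurable_run_log (L : List ℝ) (h : ℝ) (φ : List Bool × ℕ → ENNReal) :
    Measurable fun x : ℝ × (ℕ → ℝ) => φ (run L (-Real.log x.1 / 2) h x.2) :=
  (measurable_run L h φ).comp (((Real.measurable_log.comp measurable_fst).neg.div_const 2).prodMk
    measurable_snd)

theorem lintegral_run (L : List ℝ) (h : ℝ) (φ : List Bool × ℕ → ENNReal) :
    ∫⁻ ρ, φ (run L (-Real.log (ρ 0) / 2) h fun n => ρ (n + 1)) ∂streamMeasure = mean L h φ :=
  lintegral_stream (measurable_run_log L h φ)

/-- A hit consumes two random numbers: one is the acceptance coin, the other starts a fresh skip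
with a fresh cap. -/
theorem lintegral_resolve {a : ℝ} (h0 : 0 ≤ a) (h1 : a ≤ 1) (L : List ℝ)
    (φ : List Bool × ℕ → ENNReal) :
    ∫⁻ ρ, φ (decide (ρ 0 < a) :: (run L (-Real.log (ρ 1) / 2) (1 / 2) fun n => ρ (n + 2)).1,
        (run L (-Real.log (ρ 1) / 2) (1 / 2) fun n => ρ (n + 2)).2 + 1) ∂streamMeasure =
      ENNReal.ofReal a * mean L (1 / 2) (fun r => φ (true :: r.1, r.2 + 1)) +
        ENNReal.ofReal (1 - a) * mean L (1 / 2) (fun r => φ (false :: r.1, r.2 + 1)) := by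
  have hT : Measurable fun x : ℝ × (ℕ → ℝ) =>
      ((x.2 0, fun n => x.2 (n + 1)) : ℝ × (ℕ → ℝ)) := by
    have h0 : ∀ n, Measurable fun x : ℝ × (ℕ → ℝ) => x.2 n := fun n =>
      (measurable_pi_apply n).comp measurable_snd
    exact (h0 0).prodMk (measurable_pi_lambda _ fun n => h0 (n + 1))
  have hb : ∀ b, Measurable fun x : ℝ × (ℕ → ℝ) =>
      φ (b :: (run L (-Real.log (x.2 0) / 2) (1 / 2) fun n => x.2 (n + 1)).1,
        (run L (-Real.log (x.2 0) / 2) (1 / 2) fun n => x.2 (n + 1)).2 + 1) := fun b =>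
    (measurable_run_log L (1 / 2) fun r => φ (b :: r.1, r.2 + 1)).comp hT
  have hf : Measurable fun x : ℝ × (ℕ → ℝ) =>
      φ (decide (x.1 < a) :: (run L (-Real.log (x.2 0) / 2) (1 / 2) fun n => x.2 (n + 1)).1,
        (run L (-Real.log (x.2 0) / 2) (1 / 2) fun n => x.2 (n + 1)).2 + 1) := by
    have hs : MeasurableSet {x : ℝ × (ℕ → ℝ) | x.1 < a} :=
      measurableSet_lt measurable_fst measurable_const
    convert measurable_ite_ennreal hs (hb true) (hb false) using 2 with x
    by_cases h : x.1 < a <;> simp [h]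
  rw [lintegral_stream hf, ← lintegral_run, ← lintegral_run,
    ← lintegral_coin h0 h1 (fun b => ∫⁻ ρ, φ (b :: (run L (-Real.log (ρ 0) / 2) (1 / 2)
      fun n => ρ (n + 1)).1, (run L (-Real.log (ρ 0) / 2) (1 / 2) fun n => ρ (n + 1)).2 + 1)
      ∂streamMeasure)]

/-- The cap falls into the element, so it is hit whatever the length of the skip, and the coin alone
must produce the probability `p`. -/
theorem mean_cons_of_lt {p h : ℝ} (hp0 : 0 ≤ p) (hp1 : p ≤ 1) (hh : h < p) (L : List ℝ)
    (φ : List Bool × ℕ → ENNReal) :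
    mean (p :: L) h φ =
      ENNReal.ofReal p * mean L (1 / 2) (fun r => φ (true :: r.1, r.2 + 1)) +
        ENNReal.ofReal (1 - p) * mean L (1 / 2) (fun r => φ (false :: r.1, r.2 + 1)) := by
  rw [← lintegral_resolve hp0 hp1]
  simp only [mean, run, accept, not_le.2 hh, and_false, if_false, if_pos hh, lintegral_const,
    measure_univ, mul_one]

/-- This makes `p / (1 - exp (-2p))` a probability and explains the rate `2` together with the cap
`1/2`: from `exp (2p) ≥ 1 + 2p` one gets `(1 - p) exp (2p) ≥ 1 + p (1 - 2p) ≥ 1` when `p ≤ 1/2`. -/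
theorem le_one_sub_exp {p : ℝ} (hp0 : 0 ≤ p) (hp : p ≤ 1 / 2) : p ≤ 1 - Real.exp (-2 * p) := by
  have h1 : 2 * p + 1 ≤ Real.exp (2 * p) := Real.add_one_le_exp _
  have h2 : Real.exp (-2 * p) * Real.exp (2 * p) = 1 := by
    rw [← Real.exp_add]; simp
  have h3 := Real.exp_pos (-2 * p)
  nlinarith [mul_nonneg hp0 (by linarith : 0 ≤ 1 - 2 * p)]

/-- The element is passed with probability `exp (-2p)`, and the rest of the skip is again
exponential. Otherwise it is hit, with probability `1 - exp (-2p)`, and the acceptance probability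
is the quotient that makes the product equal to `p`. -/
theorem mean_cons_of_le {p h : ℝ} (hp0 : 0 ≤ p) (hh : h ≤ 1 / 2) (hp : p ≤ h) (L : List ℝ)
    (φ : List Bool × ℕ → ENNReal) :
    mean (p :: L) h φ =
      ENNReal.ofReal (Real.exp (-2 * p)) * mean L (h - p) (fun r => φ (false :: r.1, r.2)) +
        (ENNReal.ofReal p * mean L (1 / 2) (fun r => φ (true :: r.1, r.2 + 1)) +
        ENNReal.ofReal (1 - Real.exp (-2 * p) - p) *
          mean L (1 / 2) (fun r => φ (false :: r.1, r.2 + 1))) := by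
  have hle := le_one_sub_exp hp0 (hp.trans hh)
  set e := Real.exp (-2 * p) with he
  set a := p / (1 - e) with ha
  have ha0 : 0 ≤ a := div_nonneg hp0 (hp0.trans hle)
  have ha1 : a ≤ 1 := div_le_one_of_le₀ hle (hp0.trans hle)
  have hea : (1 - e) * a = p := by
    -- If `1 - e = 0` then `hle` forces `p = 0`, so the division by zero is harmless.
    rcases eq_or_ne (1 - e) 0 with h0 | h0
    · rw [h0, zero_mul]; linarith
    · rw [ha, mul_div_cancel₀ _ h0]
  have hf : Measurable fun g => ∫⁻ ρ, φ (false :: (run L g (h - p) ρ).1, (run L g (h - p) ρ).2)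
      ∂streamMeasure :=
    (measurable_run L (h - p) fun r => φ (false :: r.1, r.2)).lintegral_prod_right'
  have h1 := lintegral_memoryless hp0 hf (∫⁻ ρ, φ (decide (ρ 0 < a) ::
    (run L (-Real.log (ρ 1) / 2) (1 / 2) fun n => ρ (n + 2)).1,
      (run L (-Real.log (ρ 1) / 2) (1 / 2) fun n => ρ (n + 2)).2 + 1) ∂streamMeasure)
  rw [lintegral_resolve ha0 ha1, mul_add, ← mul_assoc, ← mul_assoc,
    ← ENNReal.ofReal_mul (hp0.trans hle), ← ENNReal.ofReal_mul (hp0.trans hle), mul_sub, hea,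
    mul_one] at h1
  rw [show mean L (h - p) (fun r => φ (false :: r.1, r.2)) = ∫⁻ u, ∫⁻ ρ,
    φ (false :: (run L (-Real.log u / 2) (h - p) ρ).1, (run L (-Real.log u / 2) (h - p) ρ).2)
      ∂streamMeasure ∂unifMeasure from rfl, ← h1]
  change lintegral _ _ = _
  refine lintegral_congr fun u => ?_
  by_cases hu : p ≤ -Real.log u / 2
  · simp [run, hu, hp]
  · rw [if_neg hu, ← lintegral_resolve ha0 ha1]
    simp [run, hu, accept, not_lt.2 hp, ha, he]

/-- The probability of a sequence of independent coin tosses. -/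
noncomputable def tossProb : List ℝ → List Bool → ℝ
  | p :: L, b :: bs => (if b then p else 1 - p) * tossProb L bs
  | [], [] => 1
  | _, _ => 0

theorem mean_zero (L : List ℝ) (h : ℝ) : mean L h (fun _ => 0) = 0 := by simp [mean]

open Classical in
/-- The elements are included independently, with the prescribed probabilities. -/
theorem mean_bits {L : List ℝ} (hL : ∀ p ∈ L, 0 ≤ p ∧ p ≤ 1) : ∀ {h : ℝ} {bs : List Bool},
    h ≤ 1 / 2 → mean L h (fun r => if r.1 = bs then 1 else 0) = ENNReal.ofReal (tossProb L bs) := by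
  induction L with
  | nil =>
    intro h bs _
    cases bs <;> simp [mean, run, tossProb]
  | cons p L ih =>
    intro h bs hh
    obtain ⟨hp0, hp1⟩ := hL p (by simp)
    have ih' := @ih fun p hp => hL p (by simp [hp])
    have hhalf : (1 / 2 : ℝ) ≤ 1 / 2 := le_rfl
    cases bs with
    | nil =>
      rcases lt_or_ge h p with hlt | hle
      · rw [mean_cons_of_lt hp0 hp1 hlt]; simp [mean_zero, tossProb]
      · rw [mean_cons_of_le hp0 hh hle]; simp [mean_zero, tossProb]
    | cons b bs =>
      have hc : 0 ≤ (if b then p else 1 - p) := by split_ifs <;> linarith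
      rw [tossProb, ENNReal.ofReal_mul hc]
      rcases lt_or_ge h p with hlt | hle
      · rw [mean_cons_of_lt hp0 hp1 hlt]
        cases b <;> simp [mean_zero, ← ih' hhalf]
      · rw [mean_cons_of_le hp0 hh hle]
        have hle' := le_one_sub_exp hp0 (hle.trans hh)
        cases b
        · simp only [List.cons.injEq, true_and, reduceCtorEq, false_and, if_false, mean_zero,
            mul_zero, zero_add, Bool.false_eq_true]
          -- The element is left out either by being passed or by being hit and rejected: `e + (1 -
          -- e - p) = 1 - p`. The induction hypothesis gives the same value after both, since the
          -- law of the bits does not depend on the distance to the cap.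
          rw [ih' (by linarith), ih' hhalf, ← add_mul, ← ENNReal.ofReal_add (Real.exp_pos _).le
            (by linarith)]
          congr 2; ring
        · simp [mean_zero, ← ih' hhalf]

theorem mean_add_one (L : List ℝ) (h : ℝ) :
    mean L h (fun r => ((r.2 + 1 : ℕ) : ENNReal)) = mean L h (fun r => (r.2 : ENNReal)) + 1 := by
  have h1 : Measurable fun x : ℝ × (ℕ → ℝ) => ((run L (-Real.log x.1 / 2) h x.2).2 : ENNReal) :=
    measurable_run_log L h fun r => (r.2 : ENNReal)
  unfold mean
  simp only [Nat.cast_add, Nat.cast_one]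
  simp_rw [lintegral_add_right _ measurable_const]
  simp

/-- The expected number of hits. -/
theorem mean_hits {L : List ℝ} (hL : ∀ p ∈ L, 0 ≤ p ∧ p ≤ 1) : ∀ {h : ℝ}, h ≤ 1 / 2 →
    mean L h (fun r => (r.2 : ENNReal)) ≤ ENNReal.ofReal (4 * L.sum + 2 * (1 / 2 - h)) := by
  -- Amortization. An element that ends before the cap is hit with probability at most `2p`, given
  -- that the skip reaches it. A hit at the cap presupposes a walk of length `1/2` since the
  -- previous hit and is paid for by `2` per unit of length. Together this gives `4` per unit, plus
  -- the credit `2 * (1/2 - h)` for the distance `1/2 - h` already walked.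
  induction L with
  | nil => intro h _; simp [mean, run]
  | cons p L ih =>
    intro h hh
    obtain ⟨hp0, hp1⟩ := hL p (by simp)
    have hL' : ∀ p ∈ L, 0 ≤ p ∧ p ≤ 1 := fun p hp => hL p (by simp [hp])
    have ih' := @ih hL'
    have hsum : 0 ≤ L.sum := List.sum_nonneg fun p hp => (hL' p hp).1
    have hhalf : mean L (1 / 2) (fun r => ((r.2 + 1 : ℕ) : ENNReal)) ≤
        ENNReal.ofReal (4 * L.sum + 1) := by
      rw [mean_add_one]
      refine (add_le_add_left (ih' le_rfl) 1).trans ?_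
      rw [← ENNReal.ofReal_one, ← ENNReal.ofReal_add (by linarith) zero_le_one]
      exact ENNReal.ofReal_le_ofReal (by linarith)
    rcases lt_or_ge h p with hlt | hle
    · rw [mean_cons_of_lt hp0 hp1 hlt, ← add_mul, ← ENNReal.ofReal_add hp0 (by linarith)]
      simp only [add_sub_cancel, ENNReal.ofReal_one, one_mul, List.sum_cons]
      exact hhalf.trans (ENNReal.ofReal_le_ofReal (by linarith))
    · rw [mean_cons_of_le hp0 hh hle]
      have hle' := le_one_sub_exp hp0 (hle.trans hh)
      set e := Real.exp (-2 * p) with he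
      have he0 : 0 < e := Real.exp_pos _
      have he1 : 1 - e ≤ 2 * p := by
        have := Real.add_one_le_exp (-2 * p); linarith
      rw [← add_mul, ← ENNReal.ofReal_add hp0 (by linarith)]
      refine (add_le_add (mul_le_mul_right (ih' (h := h - p) (by linarith)) _)
        (mul_le_mul_right hhalf _)).trans ?_
      rw [← ENNReal.ofReal_mul he0.le, ← ENNReal.ofReal_mul (by linarith),
        ← ENNReal.ofReal_add (mul_nonneg he0.le (by linarith))
          (mul_nonneg (by linarith) (by linarith))]
      refine ENNReal.ofReal_le_ofReal ?_
      rw [List.sum_cons]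
      nlinarith

end SkipSampling

/-! ## Join orders -/

namespace JoinSchema

variable {m k : ℕ}

/-- The relations of a join order: the root `r`, and the first components of the edges. -/
def nodes (r : Fin k) : List (Fin k × Fin k) → List (Fin k)
  | [] => [r]
  | (c, _) :: es => c :: nodes r es

/-- A join order: a root `r` and a list of edges; the first edge `(c, q)` says that `c` is a leaf
with neighbour `q` in the join tree, and the other edges form a join order of the other relations. -/
def IsJoinOrder (Q : JoinSchema m k) (r : Fin k) : List (Fin k × Fin k) → Prop
  | [] => True
  | (c, q) :: es => c ∉ nodes r es ∧ q ∈ nodes r es ∧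
      (∀ w ∈ nodes r es, Q.attrs c ∩ Q.attrs w ⊆ Q.attrs q) ∧ Q.IsJoinOrder r es

/-- The common attributes of two relations. -/
noncomputable def keyAttrs (Q : JoinSchema m k) (c q : Fin k) : List ℕ :=
  (Q.attrs c ∩ Q.attrs q).toList.map Fin.val

theorem keyAttrs_le (Q : JoinSchema m k) (c q : Fin k) : ∀ a ∈ Q.keyAttrs c q, a ≤ m := by
  intro a ha
  obtain ⟨b, -, rfl⟩ := List.mem_map.1 ha
  exact b.2.le

theorem IsJoinOrder.nodup {Q : JoinSchema m k} {r : Fin k} : ∀ {es : List (Fin k × Fin k)},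
    Q.IsJoinOrder r es → (nodes r es).Nodup
  | [], _ => List.nodup_singleton r
  | (_, _) :: _, h => List.nodup_cons.2 ⟨h.1, h.2.2.2.nodup⟩

/-- Remove a leaf of the tree and recurse. The vertices are an abstract type with an embedding `ι`,
because removing a leaf changes the vertex type. -/
theorem exists_joinOrder_of_isTree (Q : JoinSchema m k) (n : ℕ) :
    ∀ (V : Type) [Fintype V] (G : SimpleGraph V) (ι : V → Fin k), Fintype.card V = n → G.IsTree →
      Function.Injective ι → (∀ a, (G.induce {v | a ∈ Q.attrs (ι v)}).Preconnected) →
      ∃ r es, Q.IsJoinOrder r es ∧ ∀ j, j ∈ nodes r es ↔ ∃ v, ι v = j := by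
  classical
  induction n with
  | zero =>
    intro V _ G ι hV hG
    obtain ⟨v⟩ := hG.connected.nonempty
    exact absurd hV (Fintype.card_pos_iff.2 ⟨v⟩).ne'
  | succ n ih =>
    intro V _ G ι hV hG hι hpre
    rcases subsingleton_or_nontrivial V with hs | hn
    · obtain ⟨v⟩ := hG.connected.nonempty
      refine ⟨ι v, [], trivial, fun j => ?_⟩
      simp only [nodes, List.mem_singleton]
      exact ⟨fun h => ⟨v, h.symm⟩, fun ⟨w, hw⟩ => by rw [← hw, Subsingleton.elim w v]⟩
    obtain ⟨v, hv⟩ := hG.exists_vert_degree_one_of_nontrivial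
    obtain ⟨q, hvq, hq⟩ := SimpleGraph.degree_eq_one_iff_existsUnique_adj.1 hv
    have hcard : Fintype.card ({v}ᶜ : Set V) = n := by
      rw [Fintype.card_compl_set, hV]; simp
    obtain ⟨r, es, hes, hmem⟩ := ih ({v}ᶜ : Set V) (G.induce {v}ᶜ) (fun w => ι w) hcard
      ⟨hG.connected.induce_compl_singleton_of_degree_eq_one hv, hG.isAcyclic.induce _⟩
      (fun x y h => Subtype.ext (hι h)) (by
        intro a
        -- Inside the subtree of `a` the leaf `v` has at most one neighbour, so deleting it does not
        -- disconnect the rest.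
        have hsub := (hpre a).induce_of_degree_eq_one (s := {x | x.1 ≠ v}) (by
          rintro ⟨x, hx⟩ hxv
          obtain rfl : x = v := by simpa using hxv
          intro y hy z hz
          have h1 := hq y.1 hy
          have h2 := hq z.1 hz
          exact Subtype.ext (h1.trans h2.symm))
        rintro ⟨⟨x, hxv⟩, hx⟩ ⟨⟨y, hyv⟩, hy⟩
        let f : ((G.induce {v | a ∈ Q.attrs (ι v)}).induce {x | x.1 ≠ v}) →g
            ((G.induce {v}ᶜ).induce {w | a ∈ Q.attrs (ι w.1)}) :=
          ⟨fun z => ⟨⟨z.1.1, z.2⟩, z.1.2⟩, fun h => h⟩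
        exact (hsub ⟨⟨x, hx⟩, hxv⟩ ⟨⟨y, hy⟩, hyv⟩).map f)
    refine ⟨r, (ι v, ι q) :: es, ⟨?_, ?_, ?_, hes⟩, ?_⟩
    · rw [hmem]
      rintro ⟨w, hw⟩
      exact w.2 (hι hw)
    · rw [hmem]
      exact ⟨⟨q, fun h => hvq.ne (Set.mem_singleton_iff.1 h).symm⟩, rfl⟩
    · intro w hw a ha
      obtain ⟨⟨w, hwv⟩, rfl⟩ := (hmem _).1 hw
      obtain ⟨hav, haw⟩ := Finset.mem_inter.1 ha
      -- A walk from the leaf `v` to `w` within the subtree of `a` can only begin with the edge to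
      -- `q`, so `q` contains `a`.
      obtain ⟨p⟩ := hpre a ⟨v, hav⟩ ⟨w, haw⟩
      cases p with
      | nil => exact absurd rfl hwv
      | cons h p =>
        rename_i y
        have := hq y.1 h
        rw [← this]
        exact y.2
    · intro j
      simp only [nodes, List.mem_cons, hmem]
      constructor
      · rintro (rfl | ⟨w, rfl⟩)
        exacts [⟨v, rfl⟩, ⟨w, rfl⟩]
      · rintro ⟨w, rfl⟩
        by_cases hw : w = v
        · exact Or.inl (by rw [hw])
        · exact Or.inr ⟨⟨w, hw⟩, rfl⟩

theorem IsAcyclic.exists_joinOrder {Q : JoinSchema m k} (h : Q.IsAcyclic) :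
    ∃ r es, Q.IsJoinOrder r es ∧ ∀ j, j ∈ nodes r es := by
  obtain ⟨G, hG, hpre⟩ := h
  obtain ⟨r, es, h1, h2⟩ := Q.exists_joinOrder_of_isTree _ (Fin k) G id rfl hG
    Function.injective_id fun a => (hpre a).preconnected
  exact ⟨r, es, h1, fun j => (h2 j).2 ⟨j, rfl⟩⟩

end JoinSchema

/-! ## Locating a number in a weighted list -/

/-- The number `y` lies in the interval of the element `b` if the elements of the list `l` are
represented by consecutive intervals, whose lengths are their weights; this interval starts at `s`. -/
def Located {β : Type*} (l : List β) (w : β → ℝ) (y : ℝ) (b : β) (s : ℝ) : Prop :=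
  ∃ l₁ l₂, l = l₁ ++ b :: l₂ ∧ s = (l₁.map w).sum ∧ s ≤ y ∧ y < s + w b

namespace Located

variable {β γ : Type*} {l : List β} {w : β → ℝ} {y s : ℝ} {b : β}

theorem mem (h : Located l w y b s) : b ∈ l := by
  obtain ⟨l₁, l₂, rfl, -⟩ := h; simp

theorem pos (h : Located l w y b s) : 0 < w b := by
  obtain ⟨l₁, l₂, -, -, h1, h2⟩ := h; linarith

/-- If every element is replaced by a list of the same total weight, its interval is merely
subdivided, so a position can be located in two stages. -/
theorem flatMap {e : β → List γ} {w' : γ → ℝ} {c : γ} {s' : ℝ} (h : Located l w y b s)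
    (hsum : ∀ b ∈ l, ((e b).map w').sum = w b) (h' : Located (e b) w' (y - s) c s') :
    Located (l.flatMap e) w' y c (s + s') := by
  obtain ⟨l₁, l₂, rfl, h1, h2, h3⟩ := h
  obtain ⟨m₁, m₂, h4, h5, h6, h7⟩ := h'
  refine ⟨l₁.flatMap e ++ m₁, m₂ ++ l₂.flatMap e, by simp [h4], ?_, by linarith, by linarith⟩
  have : ∀ l : List β, (∀ b ∈ l, ((e b).map w').sum = w b) →
      ((l.flatMap e).map w').sum = (l.map w).sum := by
    intro l hl
    induction l with
    | nil => simp
    | cons a l ih =>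
      simp [ih fun b hb => hl b (by simp [hb]), hl a (by simp)]
  rw [List.map_append, List.sum_append, this l₁ fun b hb => hsum b (by simp [hb]), h1, h5]

/-- Rescaling: multiplying all weights by `P` stretches the picture by the factor `P`. -/
theorem map {F : β → γ} {w' : γ → ℝ} {P : ℝ} (hP : 0 < P) (h : Located l w y b s)
    (hw : ∀ b ∈ l, w' (F b) = w b * P) : Located (l.map F) w' (y * P) (F b) (s * P) := by
  obtain ⟨l₁, l₂, rfl, h1, h2, h3⟩ := h
  refine ⟨l₁.map F, l₂.map F, by simp, ?_, by gcongr, ?_⟩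
  · rw [h1, ← List.sum_map_mul_right, List.map_map]
    refine congrArg List.sum (List.map_congr_left fun b hb => ?_)
    exact (hw b (by simp [hb])).symm
  · rw [hw b (by simp), ← add_mul]
    gcongr

end Located

/-! ## The join results in lexicographic order -/

/-- A join of numbered tuples: `val g a` is the value of the tuple `g` at the attribute `a`, and
`tup j` lists the tuples of the `j`-th relation. -/
structure TupleLists (m k : ℕ) where
  attrs : JoinSchema m k
  val : ℕ → ℕ → ℝ
  tup : Fin k → List ℕ

namespace TupleLists

open JoinSchema

variable {m k : ℕ} (D : TupleLists m k)

/-- The values of a tuple at a list of attributes. -/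
def key (A : List ℕ) (g : ℕ) : List ℝ := A.map (D.val g)

theorem key_eq_key {c q : Fin k} {g g' : ℕ} :
    D.key (D.attrs.keyAttrs c q) g = D.key (D.attrs.keyAttrs c q) g' ↔
      ∀ a : Fin m, a ∈ D.attrs.attrs c → a ∈ D.attrs.attrs q → D.val g a = D.val g' a := by
  simp [key, JoinSchema.keyAttrs]

open Classical in
/-- The tuples of the `c`-th relation that can be joined with the tuple `g` of the `q`-th. -/
noncomputable def grp (c q : Fin k) (g : ℕ) : List ℕ :=
  (D.tup c).filter fun g' => D.key (D.attrs.keyAttrs c q) g' = D.key (D.attrs.keyAttrs c q) g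

/-- The join results, as assignments of tuples to the relations. -/
noncomputable def results (r : Fin k) : List (Fin k × Fin k) → List (Fin k → ℕ)
  | [] => (D.tup r).map fun g => Function.update (fun _ => 0) r g
  | (c, q) :: es => (results r es).flatMap fun f =>
      (D.grp c q (f q)).map fun g => Function.update f c g

open Classical in
/-- Multiply the weight of each tuple of `q` by the total weight of its join partners in `c`. -/
noncomputable def pushWeights (w : ℕ → ℝ) (c q : Fin k) (g : ℕ) : ℝ :=
  if g ∈ D.tup q then w g * ((D.grp c q g).map w).sum else w g

/-- The weights after all edges have been processed. -/
noncomputable def finalWeights (w : ℕ → ℝ) : List (Fin k × Fin k) → ℕ → ℝ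
  | [] => w
  | (c, q) :: es => finalWeights (D.pushWeights w c q) es

/-- The weight of an assignment. -/
def weight (w : ℕ → ℝ) (r : Fin k) (es : List (Fin k × Fin k)) (f : Fin k → ℕ) : ℝ :=
  ((nodes r es).map fun j => w (f j)).prod

variable {D}

/-- The construction matches a new tuple of `c` with its neighbour `q` only. By the intersection
property of a join order, an attribute shared with any other relation occurs in `q` too, so
agreement with `q` implies agreement with all. The value `0` at unused relations makes an assignment
unique. -/
theorem mem_results {r : Fin k} : ∀ {es : List (Fin k × Fin k)}, D.attrs.IsJoinOrder r es →
    ∀ {f : Fin k → ℕ}, f ∈ D.results r es ↔ (∀ j ∈ nodes r es, f j ∈ D.tup j) ∧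
      (∀ j ∉ nodes r es, f j = 0) ∧ ∀ j ∈ nodes r es, ∀ j' ∈ nodes r es, ∀ a : Fin m,
        a ∈ D.attrs.attrs j → a ∈ D.attrs.attrs j' → D.val (f j) a = D.val (f j') a
  | [], _, f => by
    simp only [results, List.mem_map, nodes, List.mem_singleton, forall_eq, implies_true, and_true]
    constructor
    · rintro ⟨g, hg, rfl⟩
      exact ⟨by simpa using hg, fun j hj => by simp [hj]⟩
    · rintro ⟨h1, h2⟩
      refine ⟨f r, h1, funext fun j => ?_⟩
      by_cases hj : j = r
      · subst hj; simp
      · simp [hj, h2]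
  | (c, q) :: es, ⟨hc, hq, hrip, hes⟩, f => by
    simp only [results, List.mem_flatMap, List.mem_map, grp, List.mem_filter, decide_eq_true_eq,
      key_eq_key]
    have hne : ∀ j ∈ nodes r es, j ≠ c := fun j hj h => hc (h ▸ hj)
    constructor
    · rintro ⟨f, hf, g, ⟨hg, hkey⟩, rfl⟩
      obtain ⟨h1, h2, h3⟩ := (mem_results hes).1 hf
      have h4 : ∀ j ∈ nodes r es, ∀ a : Fin m, a ∈ D.attrs.attrs c → a ∈ D.attrs.attrs j →
          D.val g a = D.val (f j) a := by
        intro j hj a hac haj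
        have haq := hrip j hj (Finset.mem_inter.2 ⟨hac, haj⟩)
        rw [hkey a hac haq, h3 q hq j hj a haq haj]
      simp only [nodes, List.mem_cons, not_or, forall_eq_or_imp, Function.update_self,
        implies_true, true_and]
      refine ⟨⟨hg, fun j hj => ?_⟩, fun j hj => ?_, fun j hj a => ?_, fun j hj => ⟨?_, ?_⟩⟩
      · rw [Function.update_of_ne (hne j hj)]; exact h1 j hj
      · rw [Function.update_of_ne hj.1]; exact h2 j hj.2
      · rw [Function.update_of_ne (hne j hj)]; exact h4 j hj a
      · intro a haj hac
        rw [Function.update_of_ne (hne j hj)]; exact (h4 j hj a hac haj).symm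
      · intro j' hj' a
        rw [Function.update_of_ne (hne j hj), Function.update_of_ne (hne j' hj')]
        exact h3 j hj j' hj' a
    · rintro ⟨h1, h2, h3⟩
      simp only [nodes, List.mem_cons, forall_eq_or_imp, not_or] at h1 h2 h3
      refine ⟨Function.update f c 0, (mem_results hes).2 ⟨?_, ?_, ?_⟩, f c, ⟨h1.1, ?_⟩, by simp⟩
      · intro j hj; rw [Function.update_of_ne (hne j hj)]; exact h1.2 j hj
      · intro j hj
        by_cases hjc : j = c
        · subst hjc; simp
        · rw [Function.update_of_ne hjc]; exact h2 j ⟨hjc, hj⟩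
      · intro j hj j' hj' a
        rw [Function.update_of_ne (hne j hj), Function.update_of_ne (hne j' hj')]
        exact (h3.2 j hj).2 j' hj' a
      · intro a hac haq
        rw [Function.update_of_ne (hne q hq)]
        exact h3.1.2 q hq a hac haq

/-- An extension determines both the tuple at `c` and the assignment it extends, since the latter is
`0` at `c`. -/
theorem nodup_results (hD : ∀ j, (D.tup j).Nodup) {r : Fin k} : ∀ {es : List (Fin k × Fin k)},
    D.attrs.IsJoinOrder r es → (D.results r es).Nodup
  | [], _ => (hD r).map fun g g' h => by simpa using congrFun h r
  | (c, q) :: es, ⟨hc, hq, hrip, hes⟩ => by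
    rw [results, List.nodup_flatMap]
    refine ⟨fun f _ => ((hD c).filter _).map fun g g' h => by simpa using congrFun h c, ?_⟩
    refine (nodup_results hD hes).imp_of_mem fun {f f'} hf hf' hne => ?_
    rw [Function.onFun, List.disjoint_left]
    intro u hu hu'
    simp only [List.mem_map] at hu hu'
    obtain ⟨g, -, rfl⟩ := hu
    obtain ⟨g', -, h⟩ := hu'
    refine hne (funext fun j => ?_)
    by_cases hj : j = c
    · subst hj
      rw [((mem_results hes).1 hf).2.1 j hc, ((mem_results hes).1 hf').2.1 j hc]
    · simpa [hj] using (congrFun h j).symm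

theorem weight_update {w : ℕ → ℝ} {r c q : Fin k} {es : List (Fin k × Fin k)}
    (hc : c ∉ nodes r es) (f : Fin k → ℕ) (g : ℕ) :
    weight w r ((c, q) :: es) (Function.update f c g) = w g * weight w r es f := by
  simp only [weight, nodes, List.map_cons, List.prod_cons, Function.update_self]
  congr 2
  refine List.map_congr_left fun j hj => ?_
  have hjc : j ≠ c := by rintro rfl; exact hc hj
  rw [Function.update_of_ne hjc]

/-- The relations use disjoint tuple numbers and `q` occurs once among the nodes, so exactly one
factor of the product changes. -/
theorem weight_pushWeights (hdisj : ∀ i j, i ≠ j → (D.tup i).Disjoint (D.tup j)) {w : ℕ → ℝ}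
    {r c q : Fin k} {es : List (Fin k × Fin k)} (hes : D.attrs.IsJoinOrder r es)
    (hq : q ∈ nodes r es) {f : Fin k → ℕ} (hf : f ∈ D.results r es) :
    weight (D.pushWeights w c q) r es f =
      ((D.grp c q (f q)).map w).sum * weight w r es f := by
  have h1 := ((mem_results hes).1 hf).1
  have hnd := hes.nodup
  unfold weight
  rw [← List.prod_toFinset _ hnd, ← List.prod_toFinset _ hnd,
    ← Finset.mul_prod_erase _ _ (List.mem_toFinset.2 hq),
    ← Finset.mul_prod_erase _ (fun j => w (f j)) (List.mem_toFinset.2 hq), ← mul_assoc]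
  congr 1
  · simp [pushWeights, h1 q hq, mul_comm]
  · refine Finset.prod_congr rfl fun j hj => ?_
    obtain ⟨hjq, hj⟩ := Finset.mem_erase.1 hj
    rw [pushWeights, if_neg]
    exact fun h => hdisj j q hjq (h1 j (List.mem_toFinset.1 hj)) h

/-- The invariant of elimination: under the pushed weights an assignment weighs as much as all its
extensions together. This is the hypothesis that `Located.flatMap` needs. -/
theorem sum_weight_extensions (hdisj : ∀ i j, i ≠ j → (D.tup i).Disjoint (D.tup j)) {w : ℕ → ℝ}
    {r c q : Fin k} {es : List (Fin k × Fin k)} (hes : D.attrs.IsJoinOrder r ((c, q) :: es))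
    {f : Fin k → ℕ} (hf : f ∈ D.results r es) :
    (((D.grp c q (f q)).map fun g => Function.update f c g).map
      (weight w r ((c, q) :: es))).sum = weight (D.pushWeights w c q) r es f := by
  rw [weight_pushWeights hdisj hes.2.2.2 hes.2.1 hf, ← List.sum_map_mul_right, List.map_map]
  exact congrArg _ (List.map_congr_left fun g _ => weight_update hes.1 f g)

/-- Once all leaves have been eliminated the total weight of the join can be read off at the root;
the query compares its position with this number in order to stop. -/
theorem sum_weight (hdisj : ∀ i j, i ≠ j → (D.tup i).Disjoint (D.tup j)) {r : Fin k} :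
    ∀ {es : List (Fin k × Fin k)} (w : ℕ → ℝ), D.attrs.IsJoinOrder r es →
      ((D.results r es).map (weight w r es)).sum = ((D.tup r).map (D.finalWeights w es)).sum
  | [], w, _ => by simp [results, weight, nodes, finalWeights, Function.comp_def]
  | (c, q) :: es, w, h => by
    rw [finalWeights, ← sum_weight hdisj _ h.2.2.2, results]
    have : ∀ l : List (Fin k → ℕ), (∀ f ∈ l, f ∈ D.results r es) →
        ((l.flatMap fun f => (D.grp c q (f q)).map fun g => Function.update f c g).map
          (weight w r ((c, q) :: es))).sum =
        (l.map (weight (D.pushWeights w c q) r es)).sum := by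
      intro l hl
      induction l with
      | nil => simp
      | cons f l ih =>
        rw [List.flatMap_cons, List.map_append, List.sum_append,
          sum_weight_extensions hdisj h (hl f (by simp)), ih fun f hf => hl f (by simp [hf])]
        simp
    exact this _ fun _ => id

/-- Extending a located assignment by a tuple of one more relation. -/
theorem located_extend (hdisj : ∀ i j, i ≠ j → (D.tup i).Disjoint (D.tup j)) {w : ℕ → ℝ}
    {r c q : Fin k} {es : List (Fin k × Fin k)} (hes : D.attrs.IsJoinOrder r ((c, q) :: es))
    {f : Fin k → ℕ} {y s S W s' : ℝ} {g : ℕ} (hS : S = ((D.grp c q (f q)).map w).sum)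
    (hS0 : 0 ≤ S) (hW : W = weight (D.pushWeights w c q) r es f)
    (h : Located (D.results r es) (weight (D.pushWeights w c q) r es) y f s)
    (h' : Located (D.grp c q (f q)) w ((y - s) * S / W) g s') :
    Located (D.results r ((c, q) :: es)) (weight w r ((c, q) :: es)) y (Function.update f c g)
      (s + s' * (W / S)) ∧
    weight w r ((c, q) :: es) (Function.update f c g) = w g * (W / S) := by
  have hWpos := h.pos
  rw [← hW] at hWpos
  have hWS := weight_pushWeights hdisj (w := w) (c := c) hes.2.2.2 hes.2.1 h.mem
  rw [← hW, ← hS] at hWS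
  have hSpos : 0 < S := lt_of_le_of_ne hS0 fun h0 => by rw [← h0, zero_mul] at hWS; linarith
  have hP : W / S = weight w r es f := by rw [hWS, mul_div_cancel_left₀ _ hSpos.ne']
  have hwt : ∀ g, weight w r ((c, q) :: es) (Function.update f c g) = w g * (W / S) := fun g => by
    rw [hP, weight_update hes.1]
  -- `W / S` is the weight of `f` without `c`, so the extension by `g` occupies `w g * (W / S)`
  -- inside the interval of `f`. Dividing the offset `y - s` by this factor gives the position among
  -- the weights of the group.
  refine ⟨h.flatMap (fun f hf => sum_weight_extensions hdisj hes hf) ?_, hwt g⟩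
  have := h'.map (F := fun g => Function.update f c g) (div_pos hWpos hSpos) fun g _ => hwt g
  rwa [show (y - s) * S / W * (W / S) = y - s by field_simp] at this

end TupleLists

/-! ## Memory layout -/

/-- The contents of the input: the sizes of the relations, and the words of the records. -/
structure JoinData (m k : ℕ) where
  sz : ℕ → ℕ
  val : ℕ → ℕ → ℝ

namespace JoinData

variable {m k : ℕ} (D : JoinData m k)

/-- The number of tuples in the relations before the `j`-th one. -/
def off (j : ℕ) : ℕ := ∑ i ∈ Finset.range j, D.sz i

/-- The number of words of the input. -/
def base : ℕ := k + (m + 1) * D.off k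

/-- The memory behind the input is an array of records with four fields; this is the address of
the `α`-th field of the `i`-th record. -/
def cell (α i : ℕ) : ℕ := D.base + 4 * i + α

/-- The memory contains the input. -/
def HasInput (s : RamState) : Prop :=
  (∀ j < k, s.mem j = D.sz j) ∧ ∀ g < D.off k, ∀ a ≤ m, s.mem (k + (m + 1) * g + a) = D.val g a

theorem off_succ (j : ℕ) : D.off (j + 1) = D.off j + D.sz j := Finset.sum_range_succ _ _

theorem off_mono {i j : ℕ} (h : i ≤ j) : D.off i ≤ D.off j :=
  Finset.sum_le_sum_of_subset (Finset.range_mono h)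

theorem off_add_sz_le {j : ℕ} (hj : j < k) : D.off j + D.sz j ≤ D.off k := by
  rw [← off_succ]; exact D.off_mono hj

theorem off_add_sz_le_off {i j : ℕ} (h : i < j) : D.off i + D.sz i ≤ D.off j := by
  rw [← off_succ]; exact D.off_mono h

theorem cell_inj {α β i j : ℕ} (hα : α < 4) (hβ : β < 4) :
    D.cell α i = D.cell β j ↔ α = β ∧ i = j := by
  unfold cell; omega

theorem base_le_cell (α i : ℕ) : D.base ≤ D.cell α i := by unfold cell; omega

theorem input_lt_base {g a : ℕ} (hg : g < D.off k) (ha : a ≤ m) :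
    k + (m + 1) * g + a < D.base := by
  unfold base
  have : (m + 1) * (g + 1) ≤ (m + 1) * D.off k := Nat.mul_le_mul_left _ hg
  rw [Nat.mul_add, mul_one] at this
  omega

/-- The memory changes only at the fields selected by `M`. -/
def Frame (M : ℕ → ℕ → Prop) (s s' : RamState) : Prop :=
  (∀ a < D.base, s'.mem a = s.mem a) ∧
    ∀ α i, α < 4 → ¬ M α i → s'.mem (D.cell α i) = s.mem (D.cell α i)

variable {D} {M M' : ℕ → ℕ → Prop} {s s' s'' : RamState}

theorem Frame.of_mem_eq (h : s'.mem = s.mem) : D.Frame M s s' :=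
  ⟨fun a _ => by rw [h], fun α i _ _ => by rw [h]⟩

theorem Frame.trans (h : D.Frame M s s') (h' : D.Frame M s' s'') : D.Frame M s s'' :=
  ⟨fun a ha => (h'.1 a ha).trans (h.1 a ha),
    fun α i hα hM => (h'.2 α i hα hM).trans (h.2 α i hα hM)⟩

theorem Frame.mono (h : D.Frame M s s') (hM : ∀ α i, M α i → M' α i) : D.Frame M' s s' :=
  ⟨h.1, fun α i hα hM' => h.2 α i hα fun h => hM' (hM α i h)⟩

theorem Frame.setMem {α i : ℕ} {v : ℝ} (hα : α < 4) (h : M α i) :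
    D.Frame M s (s.setMem (D.cell α i) v) := by
  refine ⟨fun a ha => ?_, fun β j hβ hM => ?_⟩
  · rw [RamState.mem_setMem, if_neg]
    have := D.base_le_cell α i
    omega
  · rw [RamState.mem_setMem, if_neg]
    rw [D.cell_inj hβ hα]
    rintro ⟨rfl, rfl⟩
    exact hM h

theorem HasInput.of_below (hs : D.HasInput s) (h : ∀ a < D.base, s'.mem a = s.mem a) :
    D.HasInput s' := by
  refine ⟨fun j hj => ?_, fun g hg a ha => ?_⟩
  · rw [h _ (by unfold base; omega)]; exact hs.1 j hj
  · rw [h _ (D.input_lt_base hg ha)]; exact hs.2 g hg a ha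

theorem HasInput.frame (hs : D.HasInput s) (h : D.Frame M s s') : D.HasInput s' :=
  hs.of_below h.1

theorem HasInput.of_mem_eq (hs : D.HasInput s) (h : s'.mem = s.mem) : D.HasInput s' :=
  hs.of_below fun a _ => by rw [h]

@[simp] theorem hasInput_setReg {x : ℕ} {v : ℝ} : D.HasInput (s.setReg x v) ↔ D.HasInput s :=
  Iff.rfl

theorem HasInput.setMem {α i : ℕ} {v : ℝ} (hs : D.HasInput s) :
    D.HasInput (s.setMem (D.cell α i) v) :=
  hs.of_below fun a ha => by
    rw [RamState.mem_setMem, if_neg]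
    have := D.base_le_cell α i
    omega

end JoinData

/-! ## Address computations -/

namespace Layout

/-- The number of tuples in the relations before the `j`-th one. -/
def offE : ℕ → RamExpr
  | 0 => .lit 0
  | j + 1 => .add (offE j) (.load (.lit j))

/-- The address of a field of a record. -/
def cellE (m k α : ℕ) (e : RamExpr) : RamExpr :=
  .add (.add (.add (.lit k) (.mul (.lit (m + 1 : ℕ)) (offE k))) (.mul (.lit 4) e)) (.lit α)

/-- A field of a record. -/
def fldE (m k α : ℕ) (e : RamExpr) : RamExpr := .load (cellE m k α e)

/-- A word of an input tuple. -/
def recE (m k : ℕ) (e : RamExpr) (a : ℕ) : RamExpr :=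
  .load (.add (.add (.lit k) (.mul (.lit (m + 1 : ℕ)) e)) (.lit a))

variable {m k : ℕ} {D : JoinData m k} {s : RamState}

theorem eval_offE (hs : D.HasInput s) : ∀ {j : ℕ}, j ≤ k → (offE j).eval s = (D.off j : ℝ)
  | 0, _ => by simp [offE, JoinData.off]
  | j + 1, hj => by
    have h := hs.1 j hj
    simp [offE, D.off_succ, eval_offE hs (Nat.le_of_succ_le hj), h]

theorem floor_cellE (hs : D.HasInput s) {e : RamExpr} {i : ℕ} (he : e.eval s = (i : ℝ)) (α : ℕ) :
    ⌊(cellE m k α e).eval s⌋₊ = D.cell α i := by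
  have : (cellE m k α e).eval s = (D.cell α i : ℝ) := by
    simp [cellE, he, eval_offE hs le_rfl, JoinData.cell, JoinData.base]
  rw [this, Nat.floor_natCast]

theorem eval_fldE (hs : D.HasInput s) {e : RamExpr} {i : ℕ} (he : e.eval s = (i : ℝ)) (α : ℕ) :
    (fldE m k α e).eval s = s.mem (D.cell α i) := by
  rw [fldE, RamExpr.eval, floor_cellE hs he]

theorem eval_recE (hs : D.HasInput s) {e : RamExpr} {g a : ℕ} (he : e.eval s = (g : ℝ))
    (hg : g < D.off k) (ha : a ≤ m) : (recE m k e a).eval s = D.val g a := by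
  have : RamExpr.eval s (.add (.add (.lit k) (.mul (.lit (m + 1 : ℕ)) e)) (.lit a)) =
      ((k + (m + 1) * g + a : ℕ) : ℝ) := by
    simp [he]
  rw [recE, RamExpr.eval, this, Nat.floor_natCast]
  exact hs.2 g hg a ha

end Layout

/-! ## Binary search -/

namespace Layout

/-- Binary search for the first position in `[reg 2, reg 3)` for which `T` holds; the position that
is tested is in register `4`. -/
def bsearch (T : RamTest) : RamProg :=
  .loop (.lt (.reg 2) (.reg 3))
    (.seq (.assign 4 (.floor (.div (.add (.reg 2) (.reg 3)) (.lit 2))))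
      (.ite T (.assign 3 (.reg 4)) (.assign 2 (.add (.reg 4) (.lit 1)))))

/-- The states `s` and `s'` differ at most in the registers that satisfy `X`. -/
def RegFrame (X : ℕ → Prop) (s s' : RamState) : Prop :=
  s'.mem = s.mem ∧ s'.rnd = s.rnd ∧ ∀ x, ¬ X x → s'.reg x = s.reg x

theorem RegFrame.trans {X : ℕ → Prop} {s s' s'' : RamState} (h : RegFrame X s s')
    (h' : RegFrame X s' s'') : RegFrame X s s'' :=
  ⟨h'.1.trans h.1, h'.2.1.trans h.2.1, fun x hx => (h'.2.2 x hx).trans (h.2.2 x hx)⟩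

theorem RegFrame.mono {X X' : ℕ → Prop} {s s' : RamState} (h : RegFrame X s s')
    (hX : ∀ x, X x → X' x) : RegFrame X' s s' :=
  ⟨h.1, h.2.1, fun x hx => h.2.2 x fun h' => hx (hX x h')⟩

theorem RegFrame.refl (X : ℕ → Prop) (s : RamState) : RegFrame X s s := ⟨rfl, rfl, fun _ _ => rfl⟩

theorem RegFrame.setReg {X : ℕ → Prop} {s s' : RamState} (h : RegFrame X s s') {x : ℕ} (hx : X x)
    (v : ℝ) : RegFrame X s (s'.setReg x v) := by
  refine ⟨h.1, h.2.1, fun y hy => ?_⟩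
  rw [RamState.reg_setReg, if_neg (by rintro rfl; exact hy hx), h.2.2 y hy]

theorem floor_half (n : ℕ) : ((⌊(n : ℝ) / 2⌋ : ℤ) : ℝ) = ((n / 2 : ℕ) : ℝ) := by
  have : ⌊(n : ℝ) / 2⌋ = ((n / 2 : ℕ) : ℤ) := by
    have := Nat.floor_div_eq_div (K := ℝ) n 2
    rw [← this, Int.natCast_floor_eq_floor (by positivity)]
    norm_num
  rw [this, Int.cast_natCast]

/-- The invariant is that `P` fails below register `2` and holds from register `3` on, and that
their distance is below a power of two which is halved in each round. The hypothesis `hT` only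
demands that the test be right in states that differ from `s` in the search registers. -/
theorem runs_bsearch (T : RamTest) (P : ℕ → Prop) {lo hi n : ℕ} {s : RamState}
    (h2 : s.reg 2 = lo) (h3 : s.reg 3 = hi) (hle : lo ≤ hi) (hn : hi - lo < 2 ^ n)
    (hT : ∀ s', RegFrame (fun x => x = 2 ∨ x = 3 ∨ x = 4) s s' →
      ∀ q, lo ≤ q → q < hi → s'.reg 4 = q → (T.holds s' ↔ P q))
    (hP : ∀ q q', lo ≤ q → q ≤ q' → q' < hi → P q → P q') :
    Runs (bsearch T) s ((n + 1) * (T.cost + 20))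
      fun s' => RegFrame (fun x => x = 2 ∨ x = 3 ∨ x = 4) s s' ∧
        ∃ p, lo ≤ p ∧ p ≤ hi ∧ s'.reg 2 = p ∧ (∀ q, lo ≤ q → q < p → ¬ P q) ∧
          ∀ q, p ≤ q → q < hi → P q := by
  have key := Runs.loop (b := .lt (.reg 2) (.reg 3))
    (c := .seq (.assign 4 (.floor (.div (.add (.reg 2) (.reg 3)) (.lit 2))))
      (.ite T (.assign 3 (.reg 4)) (.assign 2 (.add (.reg 4) (.lit 1)))))
    (t := T.cost + 14)
    (R := fun s' => RegFrame (fun x => x = 2 ∨ x = 3 ∨ x = 4) s s' ∧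
        ∃ p, lo ≤ p ∧ p ≤ hi ∧ s'.reg 2 = p ∧ (∀ q, lo ≤ q → q < p → ¬ P q) ∧
          ∀ q, p ≤ q → q < hi → P q)
    (Inv := fun n s' => RegFrame (fun x => x = 2 ∨ x = 3 ∨ x = 4) s s' ∧
      ∃ p p' : ℕ, lo ≤ p ∧ p ≤ p' ∧ p' ≤ hi ∧ s'.reg 2 = p ∧ s'.reg 3 = p' ∧
        p' - p < 2 ^ n ∧ (∀ q, lo ≤ q → q < p → ¬ P q) ∧ ∀ q, p' ≤ q → q < hi → P q)
    (by
      rintro n s' ⟨hf, p, p', hp, hpp, hp', e2, e3, hlt, hl, hr⟩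
      by_cases hlt' : p < p'
      · right
        refine ⟨by simp [e2, e3, hlt'], ?_⟩
        set mid := (p + p') / 2 with hmid
        have hn0 : n ≠ 0 := by rintro rfl; simp at hlt; omega
        obtain ⟨n, rfl⟩ := Nat.exists_eq_succ_of_ne_zero hn0
        rw [Nat.succ_eq_add_one, pow_succ] at hlt
        have hev : RamExpr.eval s' (.floor (.div (.add (.reg 2) (.reg 3)) (.lit 2))) = mid := by
          have := floor_half (p + p')
          push_cast at this
          simp [e2, e3, hmid, this]
        have hf1 := hf.setReg (x := 4) (by simp) mid
        have hTm := hT _ hf1 mid (by omega) (by omega) (by simp)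
        refine (RamProg.LoopFree.runs (by simp) s' (R := fun s'' => ∃ n' < n + 1,
          RegFrame (fun x => x = 2 ∨ x = 3 ∨ x = 4) s s'' ∧
          ∃ p p' : ℕ, lo ≤ p ∧ p ≤ p' ∧ p' ≤ hi ∧ s''.reg 2 = p ∧ s''.reg 3 = p' ∧
          p' - p < 2 ^ n' ∧ (∀ q, lo ≤ q → q < p → ¬ P q) ∧ ∀ q, p' ≤ q → q < hi → P q)
          ?_).mono (by simp [RamProg.scost, RamExpr.cost]; omega) (fun _ h => h)
        rw [RamProg.den_seq, RamProg.den_assign, hev]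
        refine ⟨n, Nat.lt_succ_self n, ?_⟩
        by_cases h : T.holds (s'.setReg 4 mid)
        · rw [RamProg.den_ite_pos h, RamProg.den_assign]
          refine ⟨hf1.setReg (by simp) _, p, mid, hp, by omega, by omega, by simp [e2],
            by simp, by omega, hl, fun q hq hq' => ?_⟩
          exact hP mid q (by omega) hq hq' (hTm.1 h)
        · rw [RamProg.den_ite_neg h, RamProg.den_assign]
          refine ⟨hf1.setReg (by simp) _, mid + 1, p', by omega, by omega, hp', by simp,
            by simp [e3], by omega, fun q hq hq' h' => ?_, hr⟩
          exact h (hTm.2 (hP q mid hq (by omega) (by omega) h'))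
      · left
        refine ⟨by simp [e2, e3]; omega, hf, p, hp, by omega, e2, hl, fun q hq hq' => ?_⟩
        exact hr q (by omega) hq') n s
    ⟨RegFrame.refl _ s, lo, hi, le_rfl, hle, le_rfl, h2, h3, hn, fun q h h' => by omega,
      fun q h h' => by omega⟩
  refine key.mono ?_ fun _ h => h
  simp only [RamTest.cost, RamExpr.cost]
  nlinarith

/-! ## Comparing keys -/

/-- Lexicographic comparison of the tuples whose numbers are given by two expressions. -/
def ltKeyT (m k : ℕ) : List ℕ → RamExpr → RamExpr → RamTest
  | [], _, _ => .lt (.lit 0) (.lit 0)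
  | a :: A, x, y => .or (.lt (recE m k x a) (recE m k y a))
      (.and (.eq (recE m k x a) (recE m k y a)) (ltKeyT m k A x y))

variable {m k : ℕ} {D : JoinData m k} {s : RamState}

theorem holds_ltKeyT (hs : D.HasInput s) {x y : RamExpr} {g g' : ℕ} (hx : x.eval s = g)
    (hy : y.eval s = g') (hg : g < D.off k) (hg' : g' < D.off k) :
    ∀ {A : List ℕ}, (∀ a ∈ A, a ≤ m) →
    ((ltKeyT m k A x y).holds s ↔ A.map (D.val g) < A.map (D.val g'))
  | [], _ => by simp [ltKeyT]
  | a :: A, hA => by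
    have ha := hA a (by simp)
    have ih := holds_ltKeyT hs hx hy hg hg' (A := A) fun a h => hA a (by simp [h])
    simp only [ltKeyT, RamTest.holds, eval_recE hs hx hg ha, eval_recE hs hy hg' ha, ih,
      List.map_cons, List.cons_lt_cons_iff]

end Layout

/-! ## Tournament trees -/

namespace Tournament

variable {κ : Type*} [LinearOrder κ] (key : ℕ → κ)

/-- The better one of two optional numbers: `0` stands for none, and `g + 1` for the number `g`. -/
def better (x y : ℕ) : ℕ := if x = 0 ∨ (y ≠ 0 ∧ key (y - 1) < key (x - 1)) then y else x

/-- `x` is at least as good as `y`. -/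
def Beats (x y : ℕ) : Prop := y = 0 ∨ (x ≠ 0 ∧ key (x - 1) ≤ key (y - 1))

/-- Each inner node `v ∈ [1, n)` of the tree `b` contains the better one of its children. -/
def IsTree (n : ℕ) (b : ℕ → ℕ) : Prop :=
  ∀ v, 1 ≤ v → v < n → b v = better key (b (2 * v)) (b (2 * v + 1))

variable {key}

theorem better_eq_or (x y : ℕ) : better key x y = x ∨ better key x y = y := by
  unfold better; split_ifs <;> simp

theorem better_beats (x y : ℕ) : Beats key (better key x y) x ∧ Beats key (better key x y) y := by
  unfold better Beats
  split_ifs with h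
  · rcases h with rfl | ⟨h1, h2⟩
    · simp only [true_or, true_and]
      by_cases hy : y = 0
      · exact Or.inl hy
      · exact Or.inr ⟨hy, le_rfl⟩
    · exact ⟨Or.inr ⟨h1, h2.le⟩, Or.inr ⟨h1, le_rfl⟩⟩
  · push Not at h
    refine ⟨Or.inr ⟨h.1, le_rfl⟩, ?_⟩
    by_cases hy : y = 0
    · exact Or.inl hy
    · exact Or.inr ⟨h.1, h.2 hy⟩

theorem Beats.trans {x y z : ℕ} (h : Beats key x y) (h' : Beats key y z) : Beats key x z := by
  unfold Beats at *
  rcases h' with h' | ⟨h1, h2⟩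
  · exact Or.inl h'
  · rcases h with h | ⟨h3, h4⟩
    · exact absurd h h1
    · exact Or.inr ⟨h3, h4.trans h2⟩

/-- The parent of `v` is `v / 2`; induct along the path to the root. -/
theorem IsTree.root_beats {n : ℕ} {b : ℕ → ℕ} (h : IsTree key n b) (v : ℕ) :
    1 ≤ v → v < 2 * n → Beats key (b 1) (b v) := by
  induction v using Nat.strong_induction_on with
  | _ v ih =>
    intro h1 h2
    rcases Nat.lt_or_ge 1 v with hv | hv
    · have h3 := ih (v / 2) (by omega) (by omega) (by omega)
      have h4 := h (v / 2) (by omega) (by omega)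
      have h5 := better_beats (key := key) (b (2 * (v / 2))) (b (2 * (v / 2) + 1))
      rw [← h4] at h5
      rcases Nat.mod_two_eq_zero_or_one v with hm | hm
      · rw [show 2 * (v / 2) = v by omega] at h5
        exact h3.trans h5.1
      · rw [show 2 * (v / 2) + 1 = v by omega] at h5
        exact h3.trans h5.2
    · obtain rfl : v = 1 := by omega
      by_cases h0 : b 1 = 0
      · exact Or.inl h0
      · exact Or.inr ⟨h0, le_rfl⟩

/-- An inner node copies one of its children, so its value comes from a leaf. With `root_beats`, the
root holds a best leaf. The induction on `2 * n - v` descends the tree. -/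
theorem IsTree.exists_leaf {n : ℕ} {b : ℕ → ℕ} (h : IsTree key n b) (d : ℕ) : ∀ v, 2 * n - v = d →
    1 ≤ v → v < 2 * n → ∃ q, n ≤ q ∧ q < 2 * n ∧ b v = b q := by
  induction d using Nat.strong_induction_on with
  | _ d ih =>
    intro v hd h1 h2
    rcases Nat.lt_or_ge v n with hv | hv
    · have h4 := h v h1 hv
      rcases better_eq_or (key := key) (b (2 * v)) (b (2 * v + 1)) with h5 | h5
      · obtain ⟨q, hq, hq', he⟩ := ih (2 * n - 2 * v) (by omega) (2 * v) rfl (by omega) (by omega)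
        exact ⟨q, hq, hq', by rw [h4, h5, he]⟩
      · obtain ⟨q, hq, hq', he⟩ :=
          ih (2 * n - (2 * v + 1)) (by omega) (2 * v + 1) rfl (by omega) (by omega)
        exact ⟨q, hq, hq', by rw [h4, h5, he]⟩
    · exact ⟨v, hv, h2, rfl⟩

end Tournament

/-! ## Sorting a relation -/

namespace Layout

open Tournament

/-- The number of tuples of the `j`-th relation. -/
def szE (j : ℕ) : RamExpr := .load (.lit j)

/-- Recompute the node of the tournament tree whose number is in register `11`. -/
def combine (m k : ℕ) (A : List ℕ) : RamProg :=
  .seq (.assign 12 (fldE m k 3 (.mul (.lit 2) (.reg 11))))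
    (.seq (.assign 13 (fldE m k 3 (.add (.mul (.lit 2) (.reg 11)) (.lit 1))))
      (.seq (.assign 14 (.sub (.reg 12) (.lit 1)))
        (.seq (.assign 15 (.sub (.reg 13) (.lit 1)))
          (.ite (.or (.eq (.reg 12) (.lit 0))
              (.and (.not (.eq (.reg 13) (.lit 0))) (ltKeyT m k A (.reg 15) (.reg 14))))
            (.store (cellE m k 3 (.reg 11)) (.reg 13))
            (.store (cellE m k 3 (.reg 11)) (.reg 12))))))

/-- Recompute the nodes on the path from the node in register `11` to the root. -/
def fixPath (m k : ℕ) (A : List ℕ) : RamProg :=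
  .loop (.le (.lit 1) (.reg 11))
    (.seq (combine m k A) (.assign 11 (.floor (.div (.reg 11) (.lit 2)))))

/-- Store register `16` in the leaf whose number is in register `11`. -/
def setLeaf (m k : ℕ) (A : List ℕ) : RamProg :=
  .seq (.store (cellE m k 3 (.reg 11)) (.reg 16))
    (.seq (.assign 11 (.floor (.div (.reg 11) (.lit 2)))) (fixPath m k A))

/-- Sort the tuples of the `j`-th relation by the attributes in `A`. -/
def sortRel (m k : ℕ) (A : List ℕ) (j : ℕ) : RamProg :=
  .seq (.assign 10 (.lit 0))
  (.seq (.loop (.lt (.reg 10) (szE j))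
    (.seq (.seq (.assign 11 (.add (szE j) (.reg 10)))
        (.assign 16 (.add (.add (offE j) (.reg 10)) (.lit 1))))
      (.seq (setLeaf m k A) (.assign 10 (.add (.reg 10) (.lit 1))))))
  (.seq (.assign 10 (.lit 0))
  (.loop (.lt (.reg 10) (szE j))
    (.seq (.seq (.assign 17 (fldE m k 3 (.lit 1)))
      (.seq (.store (cellE m k 0 (.add (offE j) (.reg 10))) (.sub (.reg 17) (.lit 1)))
        (.seq (.assign 11 (.add (szE j) (.sub (.sub (.reg 17) (.lit 1)) (offE j))))
          (.assign 16 (.lit 0)))))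
      (.seq (setLeaf m k A) (.assign 10 (.add (.reg 10) (.lit 1))))))))

variable {m k : ℕ} {D : JoinData m k} {s : RamState} {A : List ℕ}

theorem eval_szE (hs : D.HasInput s) {j : ℕ} (hj : j < k) : (szE j).eval s = (D.sz j : ℝ) := by
  simp [szE, hs.1 j hj]

theorem loopFree_combine : (combine m k A).LoopFree := by simp [combine]

theorem den_combine (hs : D.HasInput s) (hA : ∀ a ∈ A, a ≤ m) {v x y : ℕ} (hv : s.reg 11 = v)
    (hx : s.mem (D.cell 3 (2 * v)) = x) (hy : s.mem (D.cell 3 (2 * v + 1)) = y)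
    (hxN : x ≤ D.off k) (hyN : y ≤ D.off k) :
    ∃ s₁, RegFrame (fun r => 12 ≤ r ∧ r ≤ 15) s s₁ ∧ (combine m k A).den s =
      s₁.setMem (D.cell 3 v) (better (fun g => A.map (D.val g)) x y : ℕ) := by
  have e1 : (fldE m k 3 (.mul (.lit 2) (.reg 11))).eval s = x := by
    rw [eval_fldE (D := D) (i := 2 * v) hs (by simp [hv]), hx]
  have e2 : (fldE m k 3 (.add (.mul (.lit 2) (.reg 11)) (.lit 1))).eval (s.setReg 12 x) = y := by
    rw [eval_fldE (D := D) (i := 2 * v + 1) (by simpa using hs) (by simp [hv]), ← hy,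
      RamState.mem_setReg]
  set s₁ := (((s.setReg 12 x).setReg 13 y).setReg 14 (x - 1)).setReg 15 (y - 1) with hs₁
  have hin : D.HasInput s₁ := hs
  have hf : RegFrame (fun r => 12 ≤ r ∧ r ≤ 15) s s₁ :=
    ((((RegFrame.refl _ s).setReg (by simp) _).setReg (by simp) _).setReg (by simp) _).setReg
      (by simp) _
  have r11 : s₁.reg 11 = v := by simp [hs₁, hv]
  have r12 : s₁.reg 12 = x := by simp [hs₁]
  have r13 : s₁.reg 13 = y := by simp [hs₁]
  have r14 : s₁.reg 14 = x - 1 := by simp [hs₁]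
  have r15 : s₁.reg 15 = y - 1 := by simp [hs₁]
  have htest : RamTest.holds s₁ (.or (.eq (.reg 12) (.lit 0))
      (.and (.not (.eq (.reg 13) (.lit 0))) (ltKeyT m k A (.reg 15) (.reg 14)))) ↔
      (x = 0 ∨ (y ≠ 0 ∧ A.map (D.val (y - 1)) < A.map (D.val (x - 1)))) := by
    simp only [RamTest.holds, RamExpr.eval, r12, r13, Rat.cast_zero, Nat.cast_eq_zero]
    -- Only if neither entry is empty are `x - 1` and `y - 1` tuple numbers; otherwise the outcome
    -- of the key comparison is irrelevant.
    by_cases hx0 : x = 0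
    · simp [hx0]
    by_cases hy0 : y = 0
    · simp [hx0, hy0]
    rw [holds_ltKeyT (D := D) (g := y - 1) (g' := x - 1) hin
      (by rw [RamExpr.eval, r15, Nat.cast_sub (by omega)]; simp) (by rw [RamExpr.eval, r14, Nat.cast_sub (by omega)]; simp)
      (by omega) (by omega) hA]
  refine ⟨s₁, hf, ?_⟩
  have hcell := floor_cellE (D := D) (e := .reg 11) (i := v) hin r11 3
  simp only [combine, RamProg.den_seq, RamProg.den_assign, e1, e2]
  have hs₁' : (((s.setReg 12 ↑x).setReg 13 ↑y).setReg 14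
      (RamExpr.eval ((s.setReg 12 ↑x).setReg 13 ↑y) ((RamExpr.reg 12).sub (RamExpr.lit 1)))).setReg
        15 (RamExpr.eval (((s.setReg 12 ↑x).setReg 13 ↑y).setReg 14
          (RamExpr.eval ((s.setReg 12 ↑x).setReg 13 ↑y) ((RamExpr.reg 12).sub (RamExpr.lit 1))))
          ((RamExpr.reg 13).sub (RamExpr.lit 1))) = s₁ := by
    simp [hs₁]
  rw [hs₁']
  unfold better
  by_cases h : RamTest.holds s₁ (.or (.eq (.reg 12) (.lit 0))
      (.and (.not (.eq (.reg 13) (.lit 0))) (ltKeyT m k A (.reg 15) (.reg 14))))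
  · rw [RamProg.den_ite_pos h, RamProg.den_store, hcell, if_pos (htest.1 h)]
    simp [r13]
  · rw [RamProg.den_ite_neg h, RamProg.den_store, hcell, if_neg (fun h' => h (htest.2 h'))]
    simp [r12]

/-- The fields `1, …, 2 * n - 1` contain the tree `b`. -/
structure HasTree (D : JoinData m k) (n : ℕ) (b : ℕ → ℕ) (s : RamState) : Prop where
  mem : ∀ i, 1 ≤ i → i < 2 * n → s.mem (D.cell 3 i) = b i
  le : ∀ i, 1 ≤ i → i < 2 * n → b i ≤ D.off k

theorem HasTree.update {n : ℕ} {b : ℕ → ℕ} (h : HasTree D n b s) {v x : ℕ} (hx : x ≤ D.off k)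
    {s₁ : RamState} (hs₁ : s₁.mem = s.mem) :
    HasTree D n (Function.update b v x) (s₁.setMem (D.cell 3 v) x) := by
  refine ⟨fun i h1 h2 => ?_, fun i h1 h2 => ?_⟩
  · simp only [RamState.mem_setMem, D.cell_inj (show 3 < 4 by norm_num) (show 3 < 4 by norm_num),
      hs₁, true_and]
    by_cases hi : i = v
    · simp [hi]
    · simp [hi, h.mem i h1 h2]
  · by_cases hi : i = v
    · simp [hi, hx]
    · simp [hi, h.le i h1 h2]

/-- The tree condition may fail at the single node `v`. Recomputing `v` moves the possible defect to
`v / 2`, and it disappears when `v = 0`, which is not a node. The exponent `d` bounds the length of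
the path. -/
theorem runs_fixPath (hs : D.HasInput s) (hA : ∀ a ∈ A, a ≤ m) {n v d : ℕ} {b : ℕ → ℕ}
    (hv : s.reg 11 = v) (hvn : v < n) (hd : v < 2 ^ d) (hb : HasTree D n b s)
    (htree : ∀ u, 1 ≤ u → u < n → u ≠ v →
      b u = better (fun g => A.map (D.val g)) (b (2 * u)) (b (2 * u + 1))) :
    Runs (fixPath m k A) s ((d + 1) * ((combine m k A).scost + 20)) fun s' =>
      D.Frame (fun α i => α = 3 ∧ 1 ≤ i ∧ i < n) s s' ∧
      (∀ x, ¬ (11 ≤ x ∧ x ≤ 15) → s'.reg x = s.reg x) ∧ ∃ b', HasTree D n b' s' ∧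
        IsTree (fun g => A.map (D.val g)) n b' ∧ ∀ i, n ≤ i → b' i = b i := by
  have key := Runs.loop (b := .le (.lit 1) (.reg 11))
    (c := .seq (combine m k A) (.assign 11 (.floor (.div (.reg 11) (.lit 2)))))
    (t := (combine m k A).scost + 5)
    (R := fun s' =>
      D.Frame (fun α i => α = 3 ∧ 1 ≤ i ∧ i < n) s s' ∧
      (∀ x, ¬ (11 ≤ x ∧ x ≤ 15) → s'.reg x = s.reg x) ∧ ∃ b', HasTree D n b' s' ∧
        IsTree (fun g => A.map (D.val g)) n b' ∧ ∀ i, n ≤ i → b' i = b i)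
    (Inv := fun d s' => D.Frame (fun α i => α = 3 ∧ 1 ≤ i ∧ i < n) s s' ∧
      (∀ x, ¬ (11 ≤ x ∧ x ≤ 15) → s'.reg x = s.reg x) ∧ ∃ v : ℕ, s'.reg 11 = v ∧ v < n ∧ v < 2 ^ d ∧
        ∃ b', HasTree D n b' s' ∧ (∀ i, n ≤ i → b' i = b i) ∧
        ∀ u, 1 ≤ u → u < n → u ≠ v →
          b' u = better (fun g => A.map (D.val g)) (b' (2 * u)) (b' (2 * u + 1)))
    (by
      rintro d s' ⟨hf, hr, v, hv, hvn, hvd, b', hb', hleaf, htree⟩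
      rcases Nat.eq_zero_or_pos v with rfl | hv0
      · left
        exact ⟨by simp [hv], hf, hr, b', hb', fun u h1 h2 => htree u h1 h2 (by omega), hleaf⟩
      · right
        refine ⟨by simp [hv]; omega, ?_⟩
        have hd0 : d ≠ 0 := by rintro rfl; simp at hvd; omega
        obtain ⟨d, rfl⟩ := Nat.exists_eq_succ_of_ne_zero hd0
        rw [Nat.succ_eq_add_one, pow_succ] at hvd
        have hs' := hs.frame hf
        set x := better (fun g => A.map (D.val g)) (b' (2 * v)) (b' (2 * v + 1)) with hx
        have hxN : x ≤ D.off k := by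
          rcases better_eq_or (key := fun g => A.map (D.val g)) (b' (2 * v)) (b' (2 * v + 1))
            with h | h <;> rw [hx, h] <;> exact hb'.le _ (by omega) (by omega)
        obtain ⟨s₁, hf₁, hden⟩ := den_combine hs' hA hv (hb'.mem _ (by omega) (by omega))
          (hb'.mem _ (by omega) (by omega)) (hb'.le _ (by omega) (by omega))
          (hb'.le _ (by omega) (by omega))
        refine (RamProg.LoopFree.runs (by simp [loopFree_combine]) s' ?_).mono
          (by simp [RamProg.scost, RamExpr.cost]) fun _ h => h
        rw [RamProg.den_seq, hden, ← hx, RamProg.den_assign]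
        have e : RamExpr.eval (s₁.setMem (D.cell 3 v) x) (.floor (.div (.reg 11) (.lit 2))) =
            ((v / 2 : ℕ) : ℝ) := by
          have := hf₁.2.2 11 (by simp)
          simp only [RamExpr.eval, RamState.reg_setMem, this, hv, Rat.cast_ofNat]
          exact floor_half v
        rw [e]
        refine ⟨d, Nat.lt_succ_self d, ?_, ?_, v / 2, by simp, by omega, by omega,
          Function.update b' v x, ⟨(hb'.update hxN hf₁.1).mem, (hb'.update hxN hf₁.1).le⟩, ?_, ?_⟩
        · exact (hf.trans (.of_mem_eq hf₁.1)).trans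
            ((JoinData.Frame.setMem (by norm_num) ⟨rfl, by omega, hvn⟩).trans (.of_mem_eq rfl))
        · intro r hr'
          rw [RamState.reg_setReg, if_neg (by omega), RamState.reg_setMem, hf₁.2.2 r (by omega),
            hr r hr']
        · intro i hi
          rw [Function.update_of_ne (by omega), hleaf i hi]
        · intro u h1 h2 h3
          rw [Function.update_of_ne (a := 2 * u) (by omega),
            Function.update_of_ne (a := 2 * u + 1) (by omega)]
          by_cases hu : u = v
          · rw [hu, Function.update_self]
          · rw [Function.update_of_ne hu, htree u h1 h2 hu]) d s
    ⟨.of_mem_eq rfl, fun _ _ => rfl, v, hv, hvn, hd, b, hb, fun _ _ => rfl, htree⟩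
  refine key.mono ?_ fun _ h => h
  simp only [RamTest.cost, RamExpr.cost]
  nlinarith

/-- Changing the leaf `p` can violate the condition only at its parent `p / 2`. For `n = 1` the leaf
is the root and the parent is `0`, so there is nothing to repair. -/
theorem runs_setLeaf (hs : D.HasInput s) (hA : ∀ a ∈ A, a ≤ m) {n p x d : ℕ} {b : ℕ → ℕ}
    (hp : s.reg 11 = p) (hx : s.reg 16 = x) (hxN : x ≤ D.off k) (hpn : n ≤ p) (hpn' : p < 2 * n)
    (hd : n < 2 ^ d) (hb : HasTree D n b s) (htree : IsTree (fun g => A.map (D.val g)) n b) :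
    Runs (setLeaf m k A) s ((cellE m k 3 (.reg 11)).cost + 7 +
        (d + 1) * ((combine m k A).scost + 20)) fun s' =>
      D.Frame (fun α i => α = 3 ∧ 1 ≤ i ∧ i < 2 * n) s s' ∧
      (∀ x, ¬ (11 ≤ x ∧ x ≤ 15) → s'.reg x = s.reg x) ∧ ∃ b', HasTree D n b' s' ∧
        IsTree (fun g => A.map (D.val g)) n b' ∧ b' p = x ∧
          ∀ i, n ≤ i → i ≠ p → b' i = b i := by
  have hcell := floor_cellE (D := D) (e := .reg 11) (i := p) hs hp 3
  set s₁ := (s.setMem (D.cell 3 p) x).setReg 11 ((p / 2 : ℕ) : ℝ) with hs₁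
  have hF : D.Frame (fun α i => α = 3 ∧ 1 ≤ i ∧ i < 2 * n) s s₁ :=
    JoinData.Frame.setMem (by norm_num) ⟨rfl, by omega, hpn'⟩
  have hden : (RamProg.seq (.store (cellE m k 3 (.reg 11)) (.reg 16))
      (.assign 11 (.floor (.div (.reg 11) (.lit 2))))).den s = s₁ := by
    rw [RamProg.den_seq, RamProg.den_store, hcell, RamProg.den_assign]
    simp only [RamExpr.eval, RamState.reg_setMem, hp, hx, Rat.cast_ofNat, floor_half, hs₁]
  have hb₁ : HasTree D n (Function.update b p x) s₁ :=
    ⟨(hb.update hxN rfl).mem, (hb.update hxN rfl).le⟩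
  have h2 := runs_fixPath (hs.frame hF) hA (n := n) (v := p / 2) (d := d)
    (b := Function.update b p x) (by simp [hs₁]) (by omega) (by omega) hb₁ (by
      intro u h1 h2 h3
      rw [Function.update_of_ne (by omega), Function.update_of_ne (by omega),
        Function.update_of_ne (by omega)]
      exact htree u h1 h2)
  have h1 : ∀ {t R}, Runs (fixPath m k A) s₁ t R →
      Runs (setLeaf m k A) s ((cellE m k 3 (.reg 11)).cost + 7 + t) R := by
    intro t R h
    rw [← hden] at h
    obtain ⟨t', s', h3, h4, h5⟩ := h
    refine ⟨_, s', .seq (.store _ _ _) (.seq (.assign _ _ _) h3), ?_, h5⟩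
    simp only [RamExpr.cost]
    omega
  refine (h1 h2).mono le_rfl ?_
  rintro s' ⟨hf, hr, b', hb', ht', hl⟩
  refine ⟨hF.trans (hf.mono ?_), ?_, b', hb', ht', ?_, ?_⟩
  · rintro α i ⟨h1, h2, h3⟩; exact ⟨h1, h2, by omega⟩
  · intro r h
    rw [hr r h, hs₁, RamState.reg_setReg, if_neg (by omega), RamState.reg_setMem]
  · rw [hl p hpn, Function.update_self]
  · intro i hi hip
    rw [hl i hi, Function.update_of_ne hip]

end Layout

namespace Layout

open Tournament

variable {m k : ℕ} {A : List ℕ}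

/-- The sorted list of the tuples of the `j`-th relation is stored in the field `0`. -/
def HasList (D : JoinData m k) (j : ℕ) (l : List ℕ) (s : RamState) : Prop :=
  ∀ t (h : t < l.length), s.mem (D.cell 0 (D.off j + t)) = l[t]

/-- The tree of zeros satisfies the tree condition, which is why the working field has to be zero at
the start; the tuples are then inserted one leaf at a time. -/
theorem runs_insertAll {D : JoinData m k} {s : RamState} (hs : D.HasInput s) (hA : ∀ a ∈ A, a ≤ m)
    {j d : ℕ} (hj : j < k) (hd : D.sz j < 2 ^ d) (h10 : s.reg 10 = 0)
    (h0 : ∀ i, s.mem (D.cell 3 i) = 0) :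
    Runs (.loop (.lt (.reg 10) (szE j))
      (.seq (.seq (.assign 11 (.add (szE j) (.reg 10)))
          (.assign 16 (.add (.add (offE j) (.reg 10)) (.lit 1))))
        (.seq (setLeaf m k A) (.assign 10 (.add (.reg 10) (.lit 1)))))) s
      (D.sz j * (5 + ((offE j).cost + 20 + ((cellE m k 3 (.reg 11)).cost + 7 +
        (d + 1) * ((combine m k A).scost + 20)))) + 5) fun s' =>
      D.Frame (fun α i => α = 3 ∧ 1 ≤ i ∧ i < 2 * D.sz j) s s' ∧
      ∃ b, HasTree D (D.sz j) b s' ∧ IsTree (fun g => A.map (D.val g)) (D.sz j) b ∧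
        ∀ t < D.sz j, b (D.sz j + t) = D.off j + t + 1 := by
  set n := D.sz j with hn
  have hoff := D.off_add_sz_le hj
  refine (Runs.loop (R := fun s' => D.Frame (fun α i => α = 3 ∧ 1 ≤ i ∧ i < 2 * n) s s' ∧
      ∃ b, HasTree D n b s' ∧ IsTree (fun g => A.map (D.val g)) n b ∧
        ∀ t < n, b (n + t) = D.off j + t + 1)
    (t := (offE j).cost + 20 + ((cellE m k 3 (.reg 11)).cost + 7 +
        (d + 1) * ((combine m k A).scost + 20)))
    (Inv := fun r s' => D.Frame (fun α i => α = 3 ∧ 1 ≤ i ∧ i < 2 * n) s s' ∧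
      ∃ i : ℕ, s'.reg 10 = i ∧ i + r = n ∧ ∃ b, HasTree D n b s' ∧
        IsTree (fun g => A.map (D.val g)) n b ∧
        ∀ t < n, b (n + t) = if t < i then D.off j + t + 1 else 0) ?_ n s ?_).mono
    (by simp [RamTest.cost, RamExpr.cost, szE]) fun _ h => h
  · rintro r s' ⟨hf, i, hi, hir, b, hb, ht, hl⟩
    have hs' := hs.frame hf
    have hsz := eval_szE hs' hj
    rcases Nat.eq_zero_or_pos r with rfl | hr
    · left
      refine ⟨?_, hf, b, hb, ht, fun t htn => by rw [hl t htn, if_pos (by omega)]⟩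
      simp only [RamTest.holds, hsz, RamExpr.eval, hi, not_lt, Nat.cast_le]
      omega
    · right
      refine ⟨?_, ?_⟩
      · simp only [RamTest.holds, hsz, RamExpr.eval, hi, Nat.cast_lt]
        omega
      set s₁ := (s'.setReg 11 ((n + i : ℕ) : ℝ)).setReg 16 ((D.off j + i + 1 : ℕ) : ℝ) with hs₁
      have hden : (RamProg.seq (.assign 11 (.add (szE j) (.reg 10)))
          (.assign 16 (.add (.add (offE j) (.reg 10)) (.lit 1)))).den s' = s₁ := by
        have h1 : RamExpr.eval s' (.add (szE j) (.reg 10)) = ((n + i : ℕ) : ℝ) := by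
          rw [RamExpr.eval, hsz, RamExpr.eval, hi]; push_cast; rfl
        have h2 : RamExpr.eval (s'.setReg 11 ((n + i : ℕ) : ℝ))
            (.add (.add (offE j) (.reg 10)) (.lit 1)) = ((D.off j + i + 1 : ℕ) : ℝ) := by
          have h3 : D.HasInput (s'.setReg 11 ((n + i : ℕ) : ℝ)) := hs'
          have h4 := eval_offE h3 hj.le
          simp only [RamExpr.eval, h4]
          simp [hi]
        simp only [RamProg.den_seq, RamProg.den_assign, h1, h2, hs₁]
      have hmem₁ : s₁.mem = s'.mem := rfl
      have hs1 : D.HasInput s₁ := hs'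
      have h3 := runs_setLeaf (s := s₁) hs1 hA (n := n) (p := n + i) (x := D.off j + i + 1)
        (d := d) (b := b) (by simp [hs₁]) (by simp [hs₁]) (by omega) (by omega) (by omega) hd
        ⟨hb.mem, hb.le⟩ ht
      have h4 : Runs (RamProg.seq (.assign 11 (.add (szE j) (.reg 10)))
          (.assign 16 (.add (.add (offE j) (.reg 10)) (.lit 1)))) s' ((offE j).cost + 12)
          fun s'' => s'' = s₁ :=
        (RamProg.LoopFree.runs (by simp) s' hden).mono
          (by simp [RamProg.scost, RamExpr.cost, szE]; omega) fun _ h => h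
      refine (h4.seq' (R' := fun s'' => ∃ n' < r, D.Frame (fun α i => α = 3 ∧ 1 ≤ i ∧ i < 2 * n) s s''
        ∧ ∃ i : ℕ, s''.reg 10 = i ∧ i + n' = n ∧ ∃ b, HasTree D n b s'' ∧
          IsTree (fun g => A.map (D.val g)) n b ∧
          ∀ t < n, b (n + t) = if t < i then D.off j + t + 1 else 0)
        (u := ((cellE m k 3 (.reg 11)).cost + 7 + (d + 1) * ((combine m k A).scost + 20)) + 4)
        ?_).mono (by omega) fun _ h => h
      rintro _ rfl
      refine h3.seq' fun s'' ⟨hf', hr', b', hb', ht', hp', hl'⟩ => ?_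
      refine RamProg.LoopFree.runs (c := .assign 10 (.add (.reg 10) (.lit 1))) trivial s'' ?_
      have h10' : s''.reg 10 = i := by rw [hr' 10 (by norm_num), hs₁]; simp [hi]
      refine ⟨r - 1, by omega, (hf.trans (.of_mem_eq hmem₁)).trans (hf'.trans (.of_mem_eq rfl)),
        i + 1, by simp [h10'], by omega, b', ⟨hb'.mem, hb'.le⟩, ht', fun t htn => ?_⟩
      by_cases hti : t = i
      · subst hti; rw [hp', if_pos (by omega)]
      · rw [hl' _ (by omega) (by omega), hl t htn]
        by_cases h : t < i
        · rw [if_pos h, if_pos (by omega)]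
        · rw [if_neg h, if_neg (by omega)]
  · refine ⟨.of_mem_eq rfl, 0, by simp [h10], by omega, fun _ => 0, ⟨fun i _ _ => by simp [h0],
      fun _ _ _ => Nat.zero_le _⟩, fun v _ _ => by simp [better], fun t _ => by simp⟩

/-- The root holds a tuple with least key among those not yet extracted, so appending it to the
output keeps the output sorted and bounded by the remaining tuples; its leaf is then emptied. -/
theorem runs_extractAll {D : JoinData m k} {s : RamState} (hs : D.HasInput s)
    (hA : ∀ a ∈ A, a ≤ m) {j d : ℕ} (hj : j < k) (hd : D.sz j < 2 ^ d) (h10 : s.reg 10 = 0)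
    {b : ℕ → ℕ} (hb : HasTree D (D.sz j) b s)
    (ht : IsTree (fun g => A.map (D.val g)) (D.sz j) b)
    (hl : ∀ t < D.sz j, b (D.sz j + t) = D.off j + t + 1) :
    Runs (.loop (.lt (.reg 10) (szE j))
      (.seq (.seq (.assign 17 (fldE m k 3 (.lit 1)))
        (.seq (.store (cellE m k 0 (.add (offE j) (.reg 10))) (.sub (.reg 17) (.lit 1)))
          (.seq (.assign 11 (.add (szE j) (.sub (.sub (.reg 17) (.lit 1)) (offE j))))
            (.assign 16 (.lit 0)))))
        (.seq (setLeaf m k A) (.assign 10 (.add (.reg 10) (.lit 1)))))) s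
      (D.sz j * (5 + ((fldE m k 3 (.lit 1)).cost + (cellE m k 0 (.add (offE j) (.reg 10))).cost +
        (offE j).cost + 30 + ((cellE m k 3 (.reg 11)).cost + 7 +
        (d + 1) * ((combine m k A).scost + 20)))) + 5) fun s' =>
      D.Frame (fun α i => (α = 0 ∧ D.off j ≤ i ∧ i < D.off j + D.sz j) ∨
        (α = 3 ∧ 1 ≤ i ∧ i < 2 * D.sz j)) s s' ∧
      (∀ i, 1 ≤ i → i < 2 * D.sz j → s'.mem (D.cell 3 i) = 0) ∧
      ∃ l : List ℕ, l.Perm (List.range' (D.off j) (D.sz j)) ∧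
        l.Pairwise (fun g g' => A.map (D.val g) ≤ A.map (D.val g')) ∧ HasList D j l s' := by
  set n := D.sz j with hn
  have hoff := D.off_add_sz_le hj
  set M : ℕ → ℕ → Prop := fun α i => (α = 0 ∧ D.off j ≤ i ∧ i < D.off j + n) ∨
        (α = 3 ∧ 1 ≤ i ∧ i < 2 * n) with hM
  set c₀ := (fldE m k 3 (.lit 1)).cost + (cellE m k 0 (.add (offE j) (.reg 10))).cost +
        (offE j).cost + 30 with hc₀
  set Inv : ℕ → RamState → Prop := fun r s' => D.Frame M s s' ∧
      ∃ l : List ℕ, s'.reg 10 = l.length ∧ l.length + r = n ∧ l.Nodup ∧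
        (∀ g ∈ l, D.off j ≤ g ∧ g < D.off j + n) ∧
        l.Pairwise (fun g g' => A.map (D.val g) ≤ A.map (D.val g')) ∧ HasList D j l s' ∧
        (∀ g ∈ l, ∀ t < n, D.off j + t ∉ l → A.map (D.val g) ≤ A.map (D.val (D.off j + t))) ∧
        ∃ b, HasTree D n b s' ∧
        IsTree (fun g => A.map (D.val g)) n b ∧
        ∀ t < n, b (n + t) = if D.off j + t ∈ l then 0 else D.off j + t + 1 with hInv
  refine (Runs.loop (R := fun s' => D.Frame M s s' ∧
      (∀ i, 1 ≤ i → i < 2 * n → s'.mem (D.cell 3 i) = 0) ∧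
      ∃ l : List ℕ, l.Perm (List.range' (D.off j) n) ∧
        l.Pairwise (fun g g' => A.map (D.val g) ≤ A.map (D.val g')) ∧ HasList D j l s')
    (t := c₀ + ((cellE m k 3 (.reg 11)).cost + 7 + (d + 1) * ((combine m k A).scost + 20)))
    (Inv := Inv) ?_ n s ?_).mono (by simp [RamTest.cost, RamExpr.cost, szE]) fun _ h => h
  · rintro r s' ⟨hf, l, hi, hir, hnd, hlr, hsort, hlist, hmin, b, hb, ht, hl⟩
    have hs' := hs.frame hf
    have hsz := eval_szE hs' hj
    have hsub : l ⊆ List.range' (D.off j) n := fun g hg => by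
      rw [List.mem_range'_1]; exact hlr g hg
    rcases Nat.eq_zero_or_pos r with rfl | hr
    · left
      have hperm : l.Perm (List.range' (D.off j) n) :=
        (List.subperm_of_subset hnd hsub).perm_of_length_le (by simp; omega)
      refine ⟨?_, hf, fun i h1 h2 => ?_, l, hperm, hsort, hlist⟩
      · simp only [RamTest.holds, hsz, RamExpr.eval, hi, not_lt, Nat.cast_le]
        omega
      -- All leaves are empty now and each node agrees with some leaf, so the whole tree is zero
      -- again.
      · obtain ⟨q, hq, hq', he⟩ := ht.exists_leaf _ i rfl h1 h2
        rw [hb.mem i h1 h2, he, show q = n + (q - n) by omega, hl _ (by omega), if_pos]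
        · simp
        · rw [hperm.mem_iff, List.mem_range'_1]; omega
    · right
      refine ⟨?_, ?_⟩
      · simp only [RamTest.holds, hsz, RamExpr.eval, hi, Nat.cast_lt]
        omega
      -- the root contains the best remaining tuple
      obtain ⟨g, hg, hgl⟩ : ∃ t, t < n ∧ D.off j + t ∉ l := by
        by_contra! hcon
        have : List.range' (D.off j) n ⊆ l := fun g hg => by
          rw [List.mem_range'_1] at hg
          have := hcon (g - D.off j) (by omega)
          rwa [show D.off j + (g - D.off j) = g by omega] at this
        have := (List.subperm_of_subset List.nodup_range' this).length_le
        simp at this; omega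
      have hne : b 1 ≠ 0 := by
        intro h0
        rcases ht.root_beats (n + g) (by omega) (by omega) with h | h
        · rw [hl g hg, if_neg hgl] at h; omega
        · exact h.1 h0
      obtain ⟨q, hq, hq', he⟩ := ht.exists_leaf _ 1 rfl le_rfl (by omega)
      obtain ⟨t₀, rfl⟩ : ∃ t, q = n + t := ⟨q - n, by omega⟩
      have ht₀ : t₀ < n := by omega
      have ht₀l : D.off j + t₀ ∉ l := by
        intro h; rw [hl t₀ ht₀, if_pos h] at he; exact hne he
      rw [hl t₀ ht₀, if_neg ht₀l] at he
      have hbest : ∀ t < n, D.off j + t ∉ l →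
          A.map (D.val (D.off j + t₀)) ≤ A.map (D.val (D.off j + t)) := by
        intro t htn htl
        rcases ht.root_beats (n + t) (by omega) (by omega) with h | h
        · rw [hl t htn, if_neg htl] at h; omega
        · have := h.2
          rw [he, hl t htn, if_neg htl] at this
          simpa using this
      set i := l.length with hlen
      set s₁ := (((s'.setReg 17 ((D.off j + t₀ + 1 : ℕ) : ℝ)).setMem (D.cell 0 (D.off j + i))
        ((D.off j + t₀ : ℕ) : ℝ)).setReg 11 ((n + t₀ : ℕ) : ℝ)).setReg 16 0 with hs₁
      have hden : (RamProg.seq (.assign 17 (fldE m k 3 (.lit 1)))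
          (.seq (.store (cellE m k 0 (.add (offE j) (.reg 10))) (.sub (.reg 17) (.lit 1)))
          (.seq (.assign 11 (.add (szE j) (.sub (.sub (.reg 17) (.lit 1)) (offE j))))
            (.assign 16 (.lit 0))))).den s' = s₁ := by
        have h1 : RamExpr.eval s' (fldE m k 3 (.lit 1)) = ((D.off j + t₀ + 1 : ℕ) : ℝ) := by
          rw [eval_fldE (D := D) (i := 1) hs' (by simp), hb.mem 1 le_rfl (by omega), he]
        have h2 : ⌊RamExpr.eval (s'.setReg 17 ((D.off j + t₀ + 1 : ℕ) : ℝ))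
            (cellE m k 0 (.add (offE j) (.reg 10)))⌋₊ = D.cell 0 (D.off j + i) := by
          refine floor_cellE (by simpa using hs') ?_ 0
          rw [RamExpr.eval, eval_offE (D := D) (by simpa using hs') hj.le]
          simp [hi]
        have h3 : D.HasInput ((s'.setReg 17 ((D.off j + t₀ + 1 : ℕ) : ℝ)).setMem
            (D.cell 0 (D.off j + i)) ((D.off j + t₀ : ℕ) : ℝ)) :=
          JoinData.HasInput.setMem hs'
        have h4 : RamExpr.eval (s'.setReg 17 ((D.off j + t₀ + 1 : ℕ) : ℝ))
            (.sub (.reg 17) (.lit 1)) = ((D.off j + t₀ : ℕ) : ℝ) := by simp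
        have h5 : RamExpr.eval ((s'.setReg 17 ((D.off j + t₀ + 1 : ℕ) : ℝ)).setMem
            (D.cell 0 (D.off j + i)) ((D.off j + t₀ : ℕ) : ℝ))
            (.add (szE j) (.sub (.sub (.reg 17) (.lit 1)) (offE j))) = ((n + t₀ : ℕ) : ℝ) := by
          rw [RamExpr.eval, eval_szE h3 hj, RamExpr.eval, eval_offE h3 hj.le]
          simp [hn]
        have h6 : ∀ s : RamState, RamExpr.eval s (.lit 0) = 0 := fun s => by simp
        simp only [RamProg.den_seq, RamProg.den_assign, RamProg.den_store, h1, h2, h4, h5, h6, hs₁]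
      have hF₁ : D.Frame M s' s₁ :=
        (JoinData.Frame.setMem (s := s'.setReg 17 ((D.off j + t₀ + 1 : ℕ) : ℝ)) (α := 0)
          (i := D.off j + i) (v := ((D.off j + t₀ : ℕ) : ℝ)) (by norm_num)
          (Or.inl ⟨rfl, by omega, by omega⟩))
      have hs1 : D.HasInput s₁ := hs'.frame hF₁
      have hmem3 : ∀ u, s₁.mem (D.cell 3 u) = s'.mem (D.cell 3 u) := by
        intro u
        simp [hs₁, D.cell_inj]
      have h3 := runs_setLeaf (s := s₁) hs1 hA (n := n) (p := n + t₀) (x := 0)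
        (d := d) (b := b) (by simp [hs₁]) (by simp [hs₁]) (by omega) (by omega) (by omega) hd
        ⟨fun u h1 h2 => by rw [hmem3]; exact hb.mem u h1 h2, hb.le⟩ ht
      have h4 : Runs (RamProg.seq (.assign 17 (fldE m k 3 (.lit 1)))
          (.seq (.store (cellE m k 0 (.add (offE j) (.reg 10))) (.sub (.reg 17) (.lit 1)))
          (.seq (.assign 11 (.add (szE j) (.sub (.sub (.reg 17) (.lit 1)) (offE j))))
            (.assign 16 (.lit 0))))) s' (c₀ - 5) fun s'' => s'' = s₁ :=
        (RamProg.LoopFree.runs (by simp) s' hden).mono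
          (by simp [RamProg.scost, RamExpr.cost, szE, hc₀]; omega) fun _ h => h
      refine (h4.seq' (R' := fun s'' => ∃ n' < r, Inv n' s'')
        (u := ((cellE m k 3 (.reg 11)).cost + 7 + (d + 1) * ((combine m k A).scost + 20)) + 4)
        ?_).mono (by omega) fun _ h => h
      rintro _ rfl
      refine h3.seq' fun s'' ⟨hf', hr', b', hb', ht', hp', hl'⟩ => ?_
      refine RamProg.LoopFree.runs (c := .assign 10 (.add (.reg 10) (.lit 1))) trivial s'' ?_
      have h10' : s''.reg 10 = i := by rw [hr' 10 (by norm_num), hs₁]; simp [hi]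
      have hf'' : D.Frame M s₁ s'' := hf'.mono fun α i h => Or.inr h
      refine ⟨r - 1, by omega, hf.trans (hF₁.trans (hf''.trans (.of_mem_eq rfl))),
        l ++ [D.off j + t₀], by simp [h10', hlen], by simp; omega, ?_, ?_, ?_, ?_, ?_, b',
        ⟨hb'.mem, hb'.le⟩, ht', fun t htn => ?_⟩
      · rw [List.nodup_append]
        exact ⟨hnd, List.nodup_singleton _, by rintro a ha b hb rfl; simp at hb; exact ht₀l (hb ▸ ha)⟩
      · intro g hg
        rw [List.mem_append, List.mem_singleton] at hg
        rcases hg with hg | rfl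
        · exact hlr g hg
        · omega
      · rw [List.pairwise_append]
        refine ⟨hsort, List.pairwise_singleton _ _, fun g hg g' hg' => ?_⟩
        rw [List.mem_singleton.1 hg']
        exact hmin g hg t₀ ht₀ ht₀l
      · intro t ht
        have e1 : ((RamProg.assign 10 ((RamExpr.reg 10).add (RamExpr.lit 1))).den s'').mem
            (D.cell 0 (D.off j + t)) = s₁.mem (D.cell 0 (D.off j + t)) :=
          hf'.2 0 _ (by norm_num) (by rintro ⟨h, -⟩; omega)
        rw [e1, hs₁]
        simp only [RamState.mem_setReg, RamState.mem_setMem,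
          D.cell_inj (show 0 < 4 by norm_num) (show 0 < 4 by norm_num), true_and,
          Nat.add_left_cancel_iff]
        rw [List.length_append, List.length_singleton] at ht
        by_cases hti : t = i
        · subst hti; simp [hlen]
        · rw [if_neg hti, List.getElem_append_left (by omega)]
          exact hlist t (by omega)
      · intro g hg t htn htl
        rw [List.mem_append, List.mem_singleton] at hg htl
        push Not at htl
        rcases hg with hg | rfl
        · exact hmin g hg t htn htl.1
        · exact hbest t htn htl.1
      · by_cases htt : t = t₀
        · subst htt; rw [hp', if_pos (by simp)]
        · rw [hl' _ (by omega) (by omega), hl t htn]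
          have : D.off j + t ∈ l ++ [D.off j + t₀] ↔ D.off j + t ∈ l := by
            simp [htt]
          simp only [this]
  · exact ⟨.of_mem_eq rfl, [], by simp [h10], by simp, List.nodup_nil, by simp, List.Pairwise.nil,
      fun t h => by simp at h, by simp, b, hb, ht, fun t h => by simp [hl t h]⟩

/-- Sorting with a tournament tree. The working field is left zero: the next relation can reuse it,
and the tree, which may extend beyond the index, does not count towards its size. The constant is
chosen before the data. -/
theorem runs_sortRel (hA : ∀ a ∈ A, a ≤ m) (j : ℕ) (hj : j < k) :
    ∃ K, ∀ (D : JoinData m k) (s : RamState) (d : ℕ), D.HasInput s → D.sz j < 2 ^ d →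
      (∀ i, s.mem (D.cell 3 i) = 0) →
      Runs (sortRel m k A j) s (K * ((D.sz j + 1) * (d + 1))) fun s' =>
        D.Frame (fun α i => (α = 0 ∧ D.off j ≤ i ∧ i < D.off j + D.sz j) ∨ α = 3) s s' ∧
        (∀ i, s'.mem (D.cell 3 i) = 0) ∧
        ∃ l : List ℕ, l.Perm (List.range' (D.off j) (D.sz j)) ∧
          l.Pairwise (fun g g' => A.map (D.val g) ≤ A.map (D.val g')) ∧ HasList D j l s' := by
  set c₁ := (offE j).cost + (cellE m k 3 (.reg 11)).cost + (combine m k A).scost +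
    (fldE m k 3 (.lit 1)).cost + (cellE m k 0 (.add (offE j) (.reg 10))).cost with hc₁
  refine ⟨4 * c₁ + 200, fun D s d hs hd h0 => ?_⟩
  set X₁ := 5 + ((offE j).cost + 20 + ((cellE m k 3 (.reg 11)).cost + 7 +
        (d + 1) * ((combine m k A).scost + 20))) with hX₁
  set X₂ := 5 + ((fldE m k 3 (.lit 1)).cost + (cellE m k 0 (.add (offE j) (.reg 10))).cost +
        (offE j).cost + 30 + ((cellE m k 3 (.reg 11)).cost + 7 +
        (d + 1) * ((combine m k A).scost + 20))) with hX₂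
  have htime : 2 + (D.sz j * X₁ + 5 + (2 + (D.sz j * X₂ + 5))) ≤
      (4 * c₁ + 200) * ((D.sz j + 1) * (d + 1)) := by
    have hd1 : c₁ + 62 ≤ (c₁ + 62) * (d + 1) := Nat.le_mul_of_pos_right _ (by omega)
    have hc : (d + 1) * ((combine m k A).scost + 20) ≤ (d + 1) * (c₁ + 20) :=
      Nat.mul_le_mul_left _ (by omega)
    have h1 : X₁ ≤ (2 * c₁ + 82) * (d + 1) := by nlinarith
    have h2 : X₂ ≤ (2 * c₁ + 82) * (d + 1) := by nlinarith
    have h3 := Nat.mul_le_mul_left (D.sz j) h1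
    have h4 := Nat.mul_le_mul_left (D.sz j) h2
    have h5 : 14 * 1 ≤ 14 * (d + 1) := Nat.mul_le_mul_left _ (by omega)
    nlinarith [Nat.zero_le (D.sz j * d), Nat.zero_le (c₁ * d)]
  refine Runs.mono (R := fun s' =>
    D.Frame (fun α i => (α = 0 ∧ D.off j ≤ i ∧ i < D.off j + D.sz j) ∨
      (α = 3 ∧ 1 ≤ i ∧ i < 2 * D.sz j)) s s' ∧
    (∀ i, 1 ≤ i → i < 2 * D.sz j → s'.mem (D.cell 3 i) = 0) ∧
      ∃ l : List ℕ, l.Perm (List.range' (D.off j) (D.sz j)) ∧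
        l.Pairwise (fun g g' => A.map (D.val g) ≤ A.map (D.val g')) ∧ HasList D j l s') ?_ htime ?_
  · refine Runs.seq' (R := fun s' => s' = s.setReg 10 0)
      (RamProg.LoopFree.runs (c := .assign 10 (.lit 0)) trivial s (by simp)) ?_
    rintro _ rfl
    refine (runs_insertAll (s := s.setReg 10 0) hs hA hj hd (by simp) h0).seq' ?_
    rintro s₁ ⟨hf₁, b, hb, ht, hl⟩
    refine Runs.seq' (R := fun s' => s' = s₁.setReg 10 0)
      (RamProg.LoopFree.runs (c := .assign 10 (.lit 0)) trivial s₁ (by simp)) ?_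
    rintro _ rfl
    have hs₁ : D.HasInput s₁ := JoinData.HasInput.frame (s := s.setReg 10 0) hs hf₁
    refine (runs_extractAll (s := s₁.setReg 10 0) hs₁ hA hj hd (by simp)
      ⟨hb.mem, hb.le⟩ ht hl).mono le_rfl ?_
    rintro s₂ ⟨hf₂, h3, hl⟩
    exact ⟨(hf₁.mono fun α i h => Or.inr h).trans hf₂, h3, hl⟩
  · rintro s' ⟨hf, h3, hl⟩
    refine ⟨hf.mono fun α i h => h.imp id fun h => h.1, fun i => ?_, hl⟩
    by_cases hi : 1 ≤ i ∧ i < 2 * D.sz j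
    · exact h3 i hi.1 hi.2
    · rw [hf.2 3 i (by norm_num) (by omega), h0]

end Layout

/-! ### Segments of lists and their sums. -/

namespace List

/-- In a sorted list the tuples with a given key form a segment, so their total weight is a
difference of two prefix sums. -/
theorem filter_eq_drop_take {α : Type*} (p : α → Bool) :
    ∀ (l : List α) (lo hi : ℕ), lo ≤ hi → hi ≤ l.length →
      (∀ t (h : t < l.length), p l[t] = true ↔ lo ≤ t ∧ t < hi) → l.filter p = (l.take hi).drop lo
  | [], lo, hi, h1, h2, _ => by simp
  | a :: l, lo, 0, h1, h2, h => by
    have h3 : ∀ b ∈ a :: l, ¬ p b = true := by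
      intro b hb
      obtain ⟨t, ht, rfl⟩ := List.mem_iff_getElem.1 hb
      rw [h t ht]; omega
    simp [List.filter_eq_nil_iff.2 h3]
  | a :: l, 0, hi + 1, h1, h2, h => by
    have h3 : p a = true := (h 0 (by simp)).2 ⟨by omega, by omega⟩
    have ih := filter_eq_drop_take p l 0 hi (by omega) (by simpa using h2) fun t ht => by
      have := h (t + 1) (by simpa using ht)
      rw [List.getElem_cons_succ] at this
      rw [this]; omega
    simpa [h3] using ih
  | a :: l, lo + 1, hi + 1, h1, h2, h => by
    have h3 : ¬ p a = true := fun h' => by have := (h 0 (by simp)).1 h'; omega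
    have ih := filter_eq_drop_take p l lo hi (by omega) (by simpa using h2) fun t ht => by
      have := h (t + 1) (by simpa using ht)
      rw [List.getElem_cons_succ] at this
      rw [this]; omega
    simpa [h3] using ih

theorem sum_map_take_succ {α : Type*} (w : α → ℝ) {l : List α} {i : ℕ} (h : i < l.length) :
    ((l.take (i + 1)).map w).sum = ((l.take i).map w).sum + w l[i] := by
  rw [List.take_add_one, List.getElem?_eq_getElem h]
  simp only [Option.toList_some, List.map_append, List.sum_append, List.map_cons, List.map_nil,
    List.sum_cons, List.sum_nil, add_zero]

theorem sum_drop_take {l : List ℝ} {lo hi : ℕ} (h : lo ≤ hi) :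
    ((l.take hi).drop lo).sum = (l.take hi).sum - (l.take lo).sum := by
  have h1 := congrArg List.sum (List.take_append_drop lo (l.take hi))
  rw [List.sum_append, List.take_take, min_eq_left h] at h1
  linarith

end List

/-! ### Prefix sums of a sorted relation, and the range of a key. -/

namespace Layout

variable {m k : ℕ} {A : List ℕ} {D : JoinData m k} {s : RamState}

/-- The weights of the tuples are stored in the field `1`. -/
def HasWeights (D : JoinData m k) (w : ℕ → ℝ) (s : RamState) : Prop :=
  ∀ g < D.off k, s.mem (D.cell 1 g) = w g

/-- The prefix sums of the weights of the tuples of the `j`-th relation are stored in the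
field `2`. -/
def HasPrefix (D : JoinData m k) (j : ℕ) (l : List ℕ) (w : ℕ → ℝ) (s : RamState) : Prop :=
  ∀ t ≤ l.length, s.mem (D.cell 2 (D.off j + j + t)) = ((l.take t).map w).sum

/-- The tuple at a position of the sorted `j`-th relation. -/
def srtE (m k j : ℕ) (e : RamExpr) : RamExpr := fldE m k 0 (.add (offE j) e)

/-- The total weight of the tuples before a position of the sorted `j`-th relation. -/
def preE (m k j : ℕ) (e : RamExpr) : RamExpr := fldE m k 2 (.add (.add (offE j) (.lit j)) e)

theorem eval_srtE (hs : D.HasInput s) {j : ℕ} (hj : j ≤ k) {l : List ℕ} (hl : HasList D j l s)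
    {e : RamExpr} {t : ℕ} (he : e.eval s = t) (ht : t < l.length) :
    (srtE m k j e).eval s = l[t] := by
  rw [srtE, eval_fldE (i := D.off j + t) hs (by simp [eval_offE hs hj, he]), hl t ht]

theorem eval_preE (hs : D.HasInput s) {j : ℕ} (hj : j ≤ k) {l : List ℕ} {w : ℕ → ℝ}
    (hl : HasPrefix D j l w s) {e : RamExpr} {t : ℕ} (he : e.eval s = t) (ht : t ≤ l.length) :
    (preE m k j e).eval s = ((l.take t).map w).sum := by
  rw [preE, eval_fldE (i := D.off j + j + t) hs (by simp [eval_offE hs hj, he]), hl t ht]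

/-- Compute the prefix sums of the weights of the sorted `j`-th relation. -/
def prefixRel (m k j : ℕ) : RamProg :=
  .seq (.seq (.assign 12 (.lit 0)) (.seq
    (.store (cellE m k 2 (.add (.add (offE j) (.lit j)) (.reg 12))) (.reg 12))
    (.assign 10 (.lit 0))))
  (.loop (.lt (.reg 10) (szE j))
    (.seq (.assign 12 (.add (.reg 12) (fldE m k 1 (srtE m k j (.reg 10)))))
      (.seq (.assign 10 (.add (.reg 10) (.lit 1)))
        (.store (cellE m k 2 (.add (.add (offE j) (.lit j)) (.reg 10))) (.reg 12)))))

/-- A relation with `n` tuples has `n + 1` prefix sums; the shift by `j` in the addresses keeps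
those of different relations apart. -/
theorem runs_prefixRel (j : ℕ) (hj : j < k) :
    ∃ K, ∀ (D : JoinData m k) (s : RamState) (w : ℕ → ℝ) (l : List ℕ), D.HasInput s →
      HasWeights D w s → HasList D j l s → l.length = D.sz j → (∀ g ∈ l, g < D.off k) →
      Runs (prefixRel m k j) s (K * (D.sz j + 1)) fun s' =>
        D.Frame (fun α i => α = 2 ∧ D.off j + j ≤ i ∧ i ≤ D.off j + j + D.sz j) s s' ∧
        HasPrefix D j l w s' := by
  set c₁ := RamProg.seq (.assign 12 (.lit 0)) (.seq
    (.store (cellE m k 2 (.add (.add (offE j) (.lit j)) (.reg 12))) (.reg 12))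
    (.assign 10 (.lit 0))) with hc₁
  set c₂ := RamProg.seq (.assign 12 (.add (.reg 12) (fldE m k 1 (srtE m k j (.reg 10)))))
      (.seq (.assign 10 (.add (.reg 10) (.lit 1)))
        (.store (cellE m k 2 (.add (.add (offE j) (.lit j)) (.reg 10))) (.reg 12))) with hc₂
  refine ⟨c₁.scost + c₂.scost + 20, fun D s w l hs hw hl hlen hlN => ?_⟩
  set M : ℕ → ℕ → Prop := fun α i => α = 2 ∧ D.off j + j ≤ i ∧ i ≤ D.off j + j + D.sz j with hM
  set Inv : ℕ → RamState → Prop := fun r s' => D.Frame M s s' ∧ ∃ i : ℕ, s'.reg 10 = i ∧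
    i + r = D.sz j ∧ s'.reg 12 = ((l.take i).map w).sum ∧
    ∀ t ≤ i, s'.mem (D.cell 2 (D.off j + j + t)) = ((l.take t).map w).sum with hInv
  have hloop := Runs.loop (b := .lt (.reg 10) (szE j)) (c := c₂) (t := c₂.scost) (Inv := Inv)
    (R := fun s' => D.Frame M s s' ∧ HasPrefix D j l w s') (by
      rintro r s' ⟨hf, i, hi, hir, hacc, hpre⟩
      have hs' := hs.frame hf
      have hsz := eval_szE hs' hj
      rcases Nat.eq_zero_or_pos r with rfl | hr
      · left
        refine ⟨?_, hf, fun t ht => hpre t (by omega)⟩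
        simp only [RamTest.holds, hsz, RamExpr.eval, hi, not_lt, Nat.cast_le]
        omega
      · right
        refine ⟨?_, ?_⟩
        · simp only [RamTest.holds, hsz, RamExpr.eval, hi, Nat.cast_lt]
          omega
        have hil : i < l.length := by omega
        have hl' : HasList D j l s' := fun t ht => by
          rw [hf.2 0 _ (by norm_num) (by rintro ⟨h, -⟩; omega), hl t ht]
        have e1 : RamExpr.eval s' (.add (.reg 12) (fldE m k 1 (srtE m k j (.reg 10)))) =
            ((l.take (i + 1)).map w).sum := by
          have h1 := eval_srtE hs' hj.le hl' (e := .reg 10) hi hil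
          rw [RamExpr.eval, eval_fldE hs' h1, hf.2 1 _ (by norm_num) (by rintro ⟨h, -⟩; omega),
            hw _ (hlN _ (List.getElem_mem hil)), RamExpr.eval, hacc,
            List.sum_map_take_succ w hil]
        set s₁ := (s'.setReg 12 ((l.take (i + 1)).map w).sum).setReg 10 ((i + 1 : ℕ) : ℝ) with hs₁
        have e2 : RamExpr.eval (s'.setReg 12 ((l.take (i + 1)).map w).sum)
            (.add (.reg 10) (.lit 1)) = ((i + 1 : ℕ) : ℝ) := by simp [hi]
        have hs1 : D.HasInput s₁ := hs'
        have e3 : ⌊RamExpr.eval s₁ (cellE m k 2 (.add (.add (offE j) (.lit j)) (.reg 10)))⌋₊ =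
            D.cell 2 (D.off j + j + (i + 1)) :=
          floor_cellE hs1 (by
            have h10 : s₁.reg 10 = ((i + 1 : ℕ) : ℝ) := by simp [hs₁]
            simp only [RamExpr.eval, eval_offE hs1 hj.le, h10]
            push_cast; ring) 2
        refine RamProg.LoopFree.runs (by simp [hc₂]) s' ?_
        rw [hc₂, RamProg.den_seq, RamProg.den_assign, e1, RamProg.den_seq, RamProg.den_assign, e2,
          RamProg.den_store, e3]
        have hF : D.Frame M s₁ (s₁.setMem (D.cell 2 (D.off j + j + (i + 1)))
            (RamExpr.eval s₁ (.reg 12))) :=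
          JoinData.Frame.setMem (by norm_num) ⟨rfl, by omega, by omega⟩
        refine ⟨r - 1, by omega, hf.trans ((JoinData.Frame.of_mem_eq rfl).trans hF), i + 1,
          by simp, by omega, by simp, fun t ht => ?_⟩
        simp only [RamState.mem_setMem, D.cell_inj (show 2 < 4 by norm_num)
          (show 2 < 4 by norm_num), true_and, Nat.add_left_cancel_iff]
        split_ifs with h
        · subst h; simp
        · exact hpre t (by omega))
  have h1 : Runs c₁ s c₁.scost fun s' => Inv (D.sz j) s' := by
    refine RamProg.LoopFree.runs (by simp [hc₁]) s ?_
    have hs1 : D.HasInput (s.setReg 12 0) := hs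
    have e3 : ⌊RamExpr.eval (s.setReg 12 0)
        (cellE m k 2 (.add (.add (offE j) (.lit j)) (.reg 12)))⌋₊ =
        D.cell 2 (D.off j + j + 0) := floor_cellE hs1 (by simp [eval_offE hs1 hj.le]) 2
    have h6 : ∀ s : RamState, RamExpr.eval s (.lit 0) = 0 := fun s => by simp
    rw [hc₁, RamProg.den_seq, RamProg.den_assign, h6, RamProg.den_seq, RamProg.den_store, e3,
      RamProg.den_assign, h6]
    refine ⟨(JoinData.Frame.setMem (s := s.setReg 12 0) (α := 2) (by norm_num)
      ⟨rfl, by omega, by omega⟩).trans (.of_mem_eq rfl), 0, by simp, by omega, by simp,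
      fun t ht => ?_⟩
    obtain rfl : t = 0 := by omega
    simp
  refine (h1.seq' fun s' h => hloop _ s' h).mono ?_ fun _ h => h
  simp only [RamTest.cost, RamExpr.cost, szE]
  nlinarith [Nat.zero_le (c₁.scost * D.sz j)]

/-- Compute the range `[reg 20, reg 21)` of the positions in the sorted `c`-th relation of the
tuples whose key agrees with that of the tuple in register `x`. -/
def findRange (m k : ℕ) (A : List ℕ) (c x : ℕ) : RamProg :=
  .seq (.seq (.assign 2 (.lit 0)) (.assign 3 (szE c)))
  (.seq (bsearch (.not (ltKeyT m k A (srtE m k c (.reg 4)) (.reg x))))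
  (.seq (.seq (.assign 20 (.reg 2)) (.assign 3 (szE c)))
  (.seq (bsearch (ltKeyT m k A (.reg x) (srtE m k c (.reg 4))))
    (.assign 21 (.reg 2)))))

/-- The registers used by `findRange`. -/
def FindRegs (x : ℕ) : Prop := x = 2 ∨ x = 3 ∨ x = 4 ∨ x = 20 ∨ x = 21

theorem HasList.of_mem_eq {j : ℕ} {l : List ℕ} {s s' : RamState} (h : HasList D j l s)
    (hs : s'.mem = s.mem) : HasList D j l s' := fun t ht => by rw [hs, h t ht]

theorem HasPrefix.of_mem_eq {j : ℕ} {l : List ℕ} {w : ℕ → ℝ} {s s' : RamState}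
    (h : HasPrefix D j l w s) (hs : s'.mem = s.mem) : HasPrefix D j l w s' :=
  fun t ht => by rw [hs, h t ht]

/-- The first search finds the first key that is not smaller than the given one, the second search,
started there, the first key that is larger. -/
theorem runs_findRange (hA : ∀ a ∈ A, a ≤ m) (c : ℕ) (hc : c < k) (x : ℕ) (hx : ¬ FindRegs x) :
    ∃ K, ∀ (D : JoinData m k) (s : RamState) (d : ℕ) (l : List ℕ) (g : ℕ), D.HasInput s →
      D.sz c < 2 ^ d → HasList D c l s → l.length = D.sz c → (∀ g ∈ l, g < D.off k) →
      l.Pairwise (fun g g' => A.map (D.val g) ≤ A.map (D.val g')) → s.reg x = g → g < D.off k →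
      Runs (findRange m k A c x) s (K * (d + 1)) fun s' => RegFrame FindRegs s s' ∧
        ∃ lo hi : ℕ, lo ≤ hi ∧ hi ≤ l.length ∧ s'.reg 20 = lo ∧ s'.reg 21 = hi ∧
          ∀ t (h : t < l.length), A.map (D.val l[t]) = A.map (D.val g) ↔ lo ≤ t ∧ t < hi := by
  have hxr : x ≠ 2 ∧ x ≠ 3 ∧ x ≠ 4 ∧ x ≠ 20 ∧ x ≠ 21 := by
    unfold FindRegs at hx; push Not at hx; exact hx
  set T₁ : RamTest := .not (ltKeyT m k A (srtE m k c (.reg 4)) (.reg x)) with hT₁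
  set T₂ : RamTest := ltKeyT m k A (.reg x) (srtE m k c (.reg 4)) with hT₂
  refine ⟨T₁.cost + T₂.cost + 60, fun D s d l g hs hd hl hlen hlN hsort hg hgN => ?_⟩
  have hmono : ∀ t t' (ht : t < l.length) (ht' : t' < l.length), t ≤ t' →
      A.map (D.val l[t]) ≤ A.map (D.val l[t']) := by
    intro t t' ht ht' h
    rcases h.eq_or_lt with rfl | h
    · exact le_rfl
    · exact List.pairwise_iff_getElem.1 hsort t t' ht ht' h
  have h234 : ∀ y, (y = 2 ∨ y = 3 ∨ y = 4) → FindRegs y := by unfold FindRegs; tauto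
  -- the state before the first search
  set s₁ := (s.setReg 2 0).setReg 3 (D.sz c) with hs₁
  have hf₁ : RegFrame FindRegs s s₁ :=
    ((RegFrame.refl _ s).setReg (by simp [FindRegs]) _).setReg (by simp [FindRegs]) _
  have hd₁ : (RamProg.seq (.assign 2 (.lit 0)) (.assign 3 (szE c))).den s = s₁ := by
    have h6 : RamExpr.eval s (.lit 0) = 0 := by simp
    have h7 : RamExpr.eval (s.setReg 2 0) (szE c) = D.sz c := eval_szE (D := D) hs hc
    simp only [RamProg.den_seq, RamProg.den_assign, h6, h7, hs₁]
  refine Runs.mono (t := (2 + ((szE c).cost + 1)) + ((d + 1) * (T₁.cost + 20) +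
    ((2 + ((szE c).cost + 1)) + ((d + 1) * (T₂.cost + 20) + 2)))) ?_ (by
      simp only [szE, RamExpr.cost]; nlinarith) fun _ h => h
  refine Runs.seq' (R := fun s' => s' = s₁)
    (RamProg.LoopFree.runs (by simp) s hd₁) ?_
  rintro _ rfl
  refine (runs_bsearch T₁ (fun t => ∃ h : t < l.length, A.map (D.val g) ≤ A.map (D.val l[t]))
    (lo := 0) (hi := D.sz c) (n := d) (s := s₁) (by simp [hs₁]) (by simp [hs₁]) (Nat.zero_le _)
    (by omega) ?_ ?_).seq' ?_
  · intro s' hf t _ ht h4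
    have hs' : D.HasInput s' := hs.of_mem_eq (hf.1.trans hf₁.1)
    have hl' := hl.of_mem_eq (hf.1.trans hf₁.1)
    have htl : t < l.length := by omega
    have e1 := eval_srtE hs' hc.le hl' (e := .reg 4) h4 htl
    have e2 : RamExpr.eval s' (.reg x) = g := by
      rw [RamExpr.eval, hf.2.2 x (by tauto), hf₁.2.2 x hx, hg]
    rw [hT₁, RamTest.holds, holds_ltKeyT hs' e1 e2 (hlN _ (List.getElem_mem _)) hgN hA, not_lt]
    exact ⟨fun h => ⟨htl, h⟩, fun ⟨_, h⟩ => h⟩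
  · rintro t t' - htt' ht' ⟨h1, h2⟩
    exact ⟨by omega, h2.trans (hmono t t' h1 (by omega) htt')⟩
  rintro s₂ ⟨hf₂, lo, -, hlo', hlo, hlt, hge⟩
  have hf₂' : RegFrame FindRegs s s₂ := hf₁.trans (hf₂.mono h234)
  have hs₂ := hs.of_mem_eq hf₂'.1
  set s₃ := (s₂.setReg 20 lo).setReg 3 (D.sz c) with hs₃
  have hf₃ : RegFrame FindRegs s s₃ :=
    (hf₂'.setReg (by simp [FindRegs]) _).setReg (by simp [FindRegs]) _
  have hd₃ : (RamProg.seq (.assign 20 (.reg 2)) (.assign 3 (szE c))).den s₂ = s₃ := by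
    have h6 : RamExpr.eval s₂ (.reg 2) = lo := hlo
    have h7 : RamExpr.eval (s₂.setReg 20 lo) (szE c) = D.sz c := eval_szE (D := D) hs₂ hc
    simp only [RamProg.den_seq, RamProg.den_assign, h6, h7, hs₃]
  refine Runs.seq' (R := fun s' => s' = s₃)
    (RamProg.LoopFree.runs (by simp) s₂ hd₃) ?_
  rintro _ rfl
  refine (runs_bsearch T₂ (fun t => ∃ h : t < l.length, A.map (D.val g) < A.map (D.val l[t]))
    (lo := lo) (hi := D.sz c) (n := d) (s := s₃) (by simp [hs₃, hlo]) (by simp [hs₃]) hlo'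
    (by omega) ?_ ?_).seq' ?_
  · intro s' hf t _ ht h4
    have hs' : D.HasInput s' := hs.of_mem_eq (hf.1.trans hf₃.1)
    have hl' := hl.of_mem_eq (hf.1.trans hf₃.1)
    have htl : t < l.length := by omega
    have e1 := eval_srtE hs' hc.le hl' (e := .reg 4) h4 htl
    have e2 : RamExpr.eval s' (.reg x) = g := by
      rw [RamExpr.eval, hf.2.2 x (by tauto), hf₃.2.2 x hx, hg]
    rw [hT₂, holds_ltKeyT hs' e2 e1 hgN (hlN _ (List.getElem_mem _)) hA]
    exact ⟨fun h => ⟨htl, h⟩, fun ⟨_, h⟩ => h⟩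
  · rintro t t' - htt' ht' ⟨h1, h2⟩
    exact ⟨by omega, h2.trans_le (hmono t t' h1 (by omega) htt')⟩
  rintro s₄ ⟨hf₄, hi, hlohi, hhi', hhi, hlt', hge'⟩
  have hf₄' : RegFrame FindRegs s s₄ := hf₃.trans (hf₄.mono h234)
  refine RamProg.LoopFree.runs (c := .assign 21 (.reg 2)) trivial s₄ ?_
  rw [RamProg.den_assign]
  refine ⟨hf₄'.setReg (by simp [FindRegs]) _, lo, hi, hlohi, by omega, ?_, by simp [hhi], ?_⟩
  · rw [RamState.reg_setReg, if_neg (by norm_num), hf₄.2.2 20 (by norm_num), hs₃]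
    simp
  · intro t ht
    constructor
    · intro h
      refine ⟨?_, ?_⟩
      · by_contra hcon
        exact hlt t (Nat.zero_le _) (by omega) ⟨ht, h.ge⟩
      · by_contra hcon
        obtain ⟨_, h'⟩ := hge' t (by omega) (by omega)
        exact absurd h h'.ne'
    · rintro ⟨h1, h2⟩
      obtain ⟨_, h3⟩ := hge t h1 (by omega)
      have h4 := hlt' t h1 h2
      refine le_antisymm ?_ h3
      by_contra hcon
      exact h4 ⟨ht, not_le.1 hcon⟩

end Layout

/-! ### Pushing weights along an edge of the join tree. -/

namespace Layout

variable {m k : ℕ} {A : List ℕ} {D : JoinData m k} {s : RamState}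

/-- Multiply the weight of each tuple of the `q`-th relation by the total weight of the tuples of
the sorted `c`-th relation with the same key. -/
def pushRel (m k : ℕ) (A : List ℕ) (c q : ℕ) : RamProg :=
  .seq (.assign 22 (offE q)) (.loop (.lt (.reg 22) (offE (q + 1)))
    (.seq (findRange m k A c 22)
      (.seq (.store (cellE m k 1 (.reg 22))
        (.mul (fldE m k 1 (.reg 22)) (.sub (preE m k c (.reg 21)) (preE m k c (.reg 20)))))
        (.assign 22 (.add (.reg 22) (.lit 1))))))

open Classical in
theorem sum_filter_eq {l : List ℕ} {w : ℕ → ℝ} {g lo hi : ℕ} (hle : lo ≤ hi)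
    (hhi : hi ≤ l.length)
    (h : ∀ t (h : t < l.length), A.map (D.val l[t]) = A.map (D.val g) ↔ lo ≤ t ∧ t < hi) :
    ((l.filter fun g' => A.map (D.val g') = A.map (D.val g)).map w).sum =
      ((l.take hi).map w).sum - ((l.take lo).map w).sum := by
  rw [List.filter_eq_drop_take _ l lo hi hle hhi (fun t ht => by simpa using h t ht),
    List.map_drop, List.map_take, List.sum_drop_take hle, List.map_take]

-- One range search per tuple of `q` suffices: the total weight of its partners is a difference of
-- two stored prefix sums, so the partners themselves are never visited. The prefix sums lie in
-- another field and are not affected by the updates.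
open Classical in
theorem runs_pushRel (hA : ∀ a ∈ A, a ≤ m) (c q : ℕ) (hc : c < k) (hq : q < k) :
    ∃ K, ∀ (D : JoinData m k) (s : RamState) (d : ℕ) (w : ℕ → ℝ) (l : List ℕ), D.HasInput s →
      D.sz c < 2 ^ d → HasWeights D w s → HasList D c l s → HasPrefix D c l w s →
      l.length = D.sz c → (∀ g ∈ l, g < D.off k) →
      l.Pairwise (fun g g' => A.map (D.val g) ≤ A.map (D.val g')) →
      Runs (pushRel m k A c q) s (K * ((D.sz q + 1) * (d + 1))) fun s' =>
        D.Frame (fun α i => α = 1 ∧ i < D.off k) s s' ∧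
        HasWeights D (fun g => if D.off q ≤ g ∧ g < D.off q + D.sz q then
          w g * ((l.filter fun g' => A.map (D.val g') = A.map (D.val g)).map w).sum else w g) s' := by
  obtain ⟨K, hK⟩ := runs_findRange hA c hc 22 (by simp [FindRegs])
  set c₂ := RamProg.seq (.store (cellE m k 1 (.reg 22))
        (.mul (fldE m k 1 (.reg 22)) (.sub (preE m k c (.reg 21)) (preE m k c (.reg 20)))))
        (.assign 22 (.add (.reg 22) (.lit 1))) with hc₂
  set T : RamTest := .lt (.reg 22) (offE (q + 1)) with hT
  refine ⟨K + c₂.scost + 2 * T.cost + (offE q).cost + 10,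
    fun D s d w l hs hd hw hl hpre hlen hlN hsort => ?_⟩
  set S : ℕ → ℝ := fun g => ((l.filter fun g' => A.map (D.val g') = A.map (D.val g)).map w).sum
    with hS
  set Inv : ℕ → RamState → Prop := fun r s' => D.Frame (fun α i => α = 1 ∧ i < D.off k) s s' ∧ ∃ i : ℕ,
    s'.reg 22 = ((D.off q + i : ℕ) : ℝ) ∧ i + r = D.sz q ∧
      HasWeights D (fun g => if D.off q ≤ g ∧ g < D.off q + i then w g * S g else w g) s' with hInv
  have hoff := D.off_add_sz_le hq
  have hloop := Runs.loop (b := T) (c := .seq (findRange m k A c 22) c₂)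
    (t := K * (d + 1) + c₂.scost) (Inv := Inv)
    (R := fun s' => D.Frame (fun α i => α = 1 ∧ i < D.off k) s s' ∧
      HasWeights D (fun g => if D.off q ≤ g ∧ g < D.off q + D.sz q then w g * S g else w g) s') (by
      rintro r s' ⟨hf, i, hi, hir, hw'⟩
      have hs' := hs.frame hf
      have hoffq := eval_offE hs' (j := q + 1) hq
      rw [D.off_succ] at hoffq
      rcases Nat.eq_zero_or_pos r with rfl | hr
      · left
        obtain rfl : i = D.sz q := by omega
        refine ⟨?_, hf, hw'⟩
        simp only [hT, RamTest.holds, hoffq, RamExpr.eval, hi, not_lt, le_refl]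
      · right
        refine ⟨?_, ?_⟩
        · simp only [hT, RamTest.holds, hoffq, RamExpr.eval, hi, Nat.cast_lt]
          omega
        have hg : D.off q + i < D.off k := by omega
        have hl' : HasList D c l s' := fun t ht => by
          rw [hf.2 0 _ (by norm_num) (by norm_num), hl t ht]
        have hpre' : HasPrefix D c l w s' := fun t ht => by
          rw [hf.2 2 _ (by norm_num) (by norm_num), hpre t ht]
        refine (hK D s' d l (D.off q + i) hs' hd hl' hlen hlN hsort hi hg).seq' ?_
        rintro s₁ ⟨hf₁, lo, hi', hlohi, hhi, e20, e21, hrange⟩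
        have hs₁ := hs'.of_mem_eq hf₁.1
        have h22 : s₁.reg 22 = ((D.off q + i : ℕ) : ℝ) := by
          rw [hf₁.2.2 22 (by simp [FindRegs]), hi]
        refine RamProg.LoopFree.runs (by simp [hc₂]) s₁ ?_
        have e1 := floor_cellE hs₁ (e := .reg 22) h22 1
        have hwi : s'.mem (D.cell 1 (D.off q + i)) = w (D.off q + i) :=
          (hw' _ hg).trans (if_neg (by omega))
        have e2 : RamExpr.eval s₁ (.mul (fldE m k 1 (.reg 22))
            (.sub (preE m k c (.reg 21)) (preE m k c (.reg 20)))) =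
            w (D.off q + i) * S (D.off q + i) := by
          rw [RamExpr.eval, RamExpr.eval, eval_fldE hs₁ (e := .reg 22) h22,
            eval_preE hs₁ hc.le (hpre'.of_mem_eq hf₁.1) (e := .reg 21) e21 hhi,
            eval_preE hs₁ hc.le (hpre'.of_mem_eq hf₁.1) (e := .reg 20) e20 (hlohi.trans hhi),
            hf₁.1, hwi, hS]
          simp only [sum_filter_eq hlohi hhi hrange]
        rw [hc₂, RamProg.den_seq, RamProg.den_store, e1, e2, RamProg.den_assign]
        refine ⟨r - 1, by omega, (hf.trans (.of_mem_eq hf₁.1)).trans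
          ((JoinData.Frame.setMem (show 1 < 4 by norm_num) ⟨rfl, hg⟩).trans (.of_mem_eq rfl)), i + 1, ?_, by omega,
          fun g hg' => ?_⟩
        · simp [h22]; ring
        · simp only [RamState.mem_setReg, RamState.mem_setMem,
            D.cell_inj (show 1 < 4 by norm_num) (show 1 < 4 by norm_num), true_and, hf₁.1]
          by_cases hgi : g = D.off q + i
          · rw [if_pos hgi, if_pos (by omega), hgi]
          · rw [if_neg hgi, hw' g hg']
            beta_reduce
            by_cases hg2 : D.off q ≤ g ∧ g < D.off q + i
            · rw [if_pos hg2, if_pos (by omega)]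
            · rw [if_neg hg2, if_neg (by omega)])
  have h1 : Runs (.assign 22 (offE q)) s ((offE q).cost + 1) fun s' => Inv (D.sz q) s' := by
    refine RamProg.LoopFree.runs (c := .assign 22 (offE q)) trivial s ?_
    rw [RamProg.den_assign, eval_offE hs hq.le]
    refine ⟨.of_mem_eq rfl, 0, by simp, by omega, fun g hg => ?_⟩
    exact (hw g hg).trans (if_neg (by omega)).symm
  refine (h1.seq' fun s' h => hloop _ s' h).mono ?_ fun _ h => h
  set X := K + c₂.scost + T.cost + 1 with hX
  have hx : T.cost + 1 + (K * (d + 1) + c₂.scost) ≤ X * (d + 1) := by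
    have := Nat.le_mul_of_pos_right (T.cost + 1 + c₂.scost) (show 0 < d + 1 by omega)
    rw [hX]; nlinarith
  have hy := Nat.mul_le_mul_left (D.sz q) hx
  have hz : T.cost + (offE q).cost + 2 ≤
      (T.cost + (offE q).cost + 2) * ((D.sz q + 1) * (d + 1)) :=
    Nat.le_mul_of_pos_right _ (by positivity)
  have : D.sz q * (X * (d + 1)) ≤ X * ((D.sz q + 1) * (d + 1)) := by nlinarith
  calc _ ≤ X * ((D.sz q + 1) * (d + 1)) +
        (T.cost + (offE q).cost + 2) * ((D.sz q + 1) * (d + 1)) := by omega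
    _ = (X + (T.cost + (offE q).cost + 2)) * ((D.sz q + 1) * (d + 1)) := by ring
    _ ≤ _ := Nat.mul_le_mul_right _ (by omega)

/-- Initialize the weights. -/
def initWeights (m k : ℕ) : RamProg :=
  .seq (.assign 22 (.lit 0)) (.loop (.lt (.reg 22) (offE k))
    (.seq (.store (cellE m k 1 (.reg 22)) (recE m k (.reg 22) m))
      (.assign 22 (.add (.reg 22) (.lit 1)))))

theorem runs_initWeights (m k : ℕ) :
    ∃ K, ∀ (D : JoinData m k) (s : RamState), D.HasInput s →
      Runs (initWeights m k) s (K * (D.off k + 1)) fun s' =>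
        D.Frame (fun α i => α = 1 ∧ i < D.off k) s s' ∧ HasWeights D (fun g => D.val g m) s' := by
  set c₂ := RamProg.seq (.store (cellE m k 1 (.reg 22)) (recE m k (.reg 22) m))
      (.assign 22 (.add (.reg 22) (.lit 1))) with hc₂
  set T : RamTest := .lt (.reg 22) (offE k) with hT
  refine ⟨c₂.scost + T.cost + 4, fun D s hs => ?_⟩
  set Inv : ℕ → RamState → Prop := fun r s' => D.Frame (fun α i => α = 1 ∧ i < D.off k) s s' ∧
    ∃ i : ℕ, s'.reg 22 = i ∧ i + r = D.off k ∧ ∀ g < i, s'.mem (D.cell 1 g) = D.val g m with hInv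
  have hloop := Runs.loop (b := T) (c := c₂) (t := c₂.scost) (Inv := Inv)
    (R := fun s' => D.Frame (fun α i => α = 1 ∧ i < D.off k) s s' ∧
      HasWeights D (fun g => D.val g m) s') (by
      rintro r s' ⟨hf, i, hi, hir, hw'⟩
      have hs' := hs.frame hf
      have hoffk := eval_offE hs' (j := k) le_rfl
      rcases Nat.eq_zero_or_pos r with rfl | hr
      · left
        obtain rfl : i = D.off k := by omega
        refine ⟨?_, hf, hw'⟩
        simp only [hT, RamTest.holds, hoffk, RamExpr.eval, hi, not_lt, le_refl]
      · right
        refine ⟨?_, ?_⟩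
        · simp only [hT, RamTest.holds, hoffk, RamExpr.eval, hi, Nat.cast_lt]
          omega
        have e1 := floor_cellE hs' (e := .reg 22) hi 1
        have e2 := eval_recE hs' (e := .reg 22) hi (by omega) le_rfl
        refine RamProg.LoopFree.runs (by simp [hc₂]) s' ?_
        rw [hc₂, RamProg.den_seq, RamProg.den_store, e1, e2, RamProg.den_assign]
        refine ⟨r - 1, by omega, hf.trans
          ((JoinData.Frame.setMem (by norm_num) ⟨rfl, by omega⟩).trans (.of_mem_eq rfl)), i + 1,
          by simp [hi], by omega, fun g hg' => ?_⟩
        simp only [RamState.mem_setReg, RamState.mem_setMem,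
            D.cell_inj (show 1 < 4 by norm_num) (show 1 < 4 by norm_num), true_and]
        split_ifs with h
        · rw [h]
        · exact hw' g (by omega))
  have h1 : Runs (.assign 22 (.lit 0)) s 2 fun s' => Inv (D.off k) s' := by
    refine RamProg.LoopFree.runs (c := .assign 22 (.lit 0)) trivial s ?_
    exact ⟨.of_mem_eq rfl, 0, by simp, by omega, fun g hg => by omega⟩
  refine (h1.seq' fun s' h => hloop _ s' h).mono ?_ fun _ h => h
  nlinarith [Nat.zero_le (D.off k)]

/-! ## Building the index -/

/-- The `j`-th relation has been sorted by the attributes `A`, and the prefix sums of its weights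
have been computed. -/
def Indexed (D : JoinData m k) (j : ℕ) (A : List ℕ) (w : ℕ → ℝ) (s : RamState) : Prop :=
  ∃ l : List ℕ, l.Perm (List.range' (D.off j) (D.sz j)) ∧
    l.Pairwise (fun g g' => A.map (D.val g) ≤ A.map (D.val g')) ∧ HasList D j l s ∧
    HasPrefix D j l w s

/-- The part of the index that belongs to the `j`-th relation. -/
def IndexCells (D : JoinData m k) (j α i : ℕ) : Prop :=
  (α = 0 ∧ D.off j ≤ i ∧ i < D.off j + D.sz j) ∨
    (α = 2 ∧ D.off j + j ≤ i ∧ i ≤ D.off j + j + D.sz j)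

theorem Indexed.frame {j : ℕ} {w : ℕ → ℝ} {s s' : RamState} {M : ℕ → ℕ → Prop}
    (h : Indexed D j A w s) (hf : D.Frame M s s') (hM : ∀ α i, IndexCells D j α i → ¬ M α i) :
    Indexed D j A w s' := by
  obtain ⟨l, hl, hsort, hlist, hpre⟩ := h
  have hlen : l.length = D.sz j := by simpa using hl.length_eq
  refine ⟨l, hl, hsort, fun t ht => ?_, fun t ht => ?_⟩
  · rw [hf.2 0 _ (by norm_num) (hM _ _ (Or.inl ⟨rfl, by omega, by omega⟩)), hlist t ht]
  · rw [hf.2 2 _ (by norm_num) (hM _ _ (Or.inr ⟨rfl, by omega, by omega⟩)), hpre t ht]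

theorem Indexed.congr {j : ℕ} {w w' : ℕ → ℝ} (h : Indexed D j A w s)
    (hw : ∀ g, D.off j ≤ g → g < D.off j + D.sz j → w g = w' g) : Indexed D j A w' s := by
  obtain ⟨l, hl, hsort, hlist, hpre⟩ := h
  refine ⟨l, hl, hsort, hlist, fun t ht => ?_⟩
  rw [hpre t ht]
  refine congrArg List.sum (List.map_congr_left fun g hg => ?_)
  have := List.mem_range'_1.1 (hl.mem_iff.1 (List.mem_of_mem_take hg))
  exact hw g this.1 this.2

theorem runs_index (hA : ∀ a ∈ A, a ≤ m) (j : ℕ) (hj : j < k) :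
    ∃ K, ∀ (D : JoinData m k) (s : RamState) (d : ℕ) (w : ℕ → ℝ), D.HasInput s → D.sz j < 2 ^ d →
      (∀ i, s.mem (D.cell 3 i) = 0) → HasWeights D w s →
      Runs (.seq (sortRel m k A j) (prefixRel m k j)) s (K * ((D.sz j + 1) * (d + 1))) fun s' =>
        D.Frame (fun α i => α = 3 ∨ IndexCells D j α i) s s' ∧ (∀ i, s'.mem (D.cell 3 i) = 0) ∧
        Indexed D j A w s' := by
  obtain ⟨K₁, h₁⟩ := runs_sortRel hA j hj
  obtain ⟨K₂, h₂⟩ := runs_prefixRel (m := m) j hj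
  refine ⟨K₁ + K₂, fun D s d w hs hd h0 hw => ?_⟩
  refine ((h₁ D s d hs hd h0).seq' (R' := fun s' =>
    D.Frame (fun α i => α = 3 ∨ IndexCells D j α i) s s' ∧ (∀ i, s'.mem (D.cell 3 i) = 0) ∧
        Indexed D j A w s') (u := K₂ * (D.sz j + 1)) ?_).mono ?_ fun _ h => h
  · rintro s₁ ⟨hf₁, h3, l, hl, hsort, hlist⟩
    have hlen : l.length = D.sz j := by simpa using hl.length_eq
    have hoff := D.off_add_sz_le hj
    have hlN : ∀ g ∈ l, g < D.off k := fun g hg => by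
      have := List.mem_range'_1.1 (hl.mem_iff.1 hg); omega
    refine (h₂ D s₁ w l (hs.frame hf₁) (fun g hg => ?_) hlist hlen hlN).mono le_rfl ?_
    · rw [hf₁.2 1 _ (by norm_num) (by omega), hw g hg]
    rintro s₂ ⟨hf₂, hpre⟩
    refine ⟨(hf₁.mono ?_).trans (hf₂.mono ?_), fun i => ?_, l, hl, hsort, fun t ht => ?_, hpre⟩
    · rintro α i (h | h)
      · exact Or.inr (Or.inl h)
      · exact Or.inl h
    · exact fun α i h => Or.inr (Or.inr h)
    · rw [hf₂.2 3 _ (by norm_num) (by omega), h3]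
    · rw [hf₂.2 0 _ (by norm_num) (by omega), hlist t ht]
  · have : K₂ * (D.sz j + 1) ≤ K₂ * ((D.sz j + 1) * (d + 1)) :=
      Nat.mul_le_mul_left _ (Nat.le_mul_of_pos_right _ (by omega))
    rw [add_mul K₁ K₂]; omega

/-- Build the index for the relations of a join order. -/
noncomputable def buildIndex (Q : JoinSchema m k) (r : Fin k) : List (Fin k × Fin k) → RamProg
  | [] => .seq (sortRel m k [] r) (prefixRel m k r)
  | (c, q) :: es => .seq (.seq (sortRel m k (Q.keyAttrs c q) c) (prefixRel m k c))
      (.seq (pushRel m k (Q.keyAttrs c q) c q) (buildIndex Q r es))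

/-- The index consists of the sorted relations with the prefix sums of their final weights. -/
def HasIndex (D : JoinData m k) (Q : JoinSchema m k) (r : Fin k) (es : List (Fin k × Fin k))
    (w : ℕ → ℝ) (s : RamState) : Prop :=
  Indexed D r [] w s ∧ ∀ e ∈ es, Indexed D e.1 (Q.keyAttrs e.1 e.2) w s

end Layout

/-- The tuples of the relations, in the order of the input. -/
def JoinData.lists {m k : ℕ} (D : JoinData m k) (Q : JoinSchema m k) : TupleLists m k :=
  ⟨Q, D.val, fun j => List.range' (D.off j) (D.sz j)⟩

theorem JoinData.mem_lists {m k : ℕ} {D : JoinData m k} {Q : JoinSchema m k} {j : Fin k} {g : ℕ} :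
    g ∈ (D.lists Q).tup j ↔ D.off j ≤ g ∧ g < D.off j + D.sz j := by
  simp [lists, List.mem_range'_1]

theorem JoinData.disjoint_ranges {m k : ℕ} (D : JoinData m k) {i j g : ℕ} (h : i ≠ j)
    (hi : D.off i ≤ g ∧ g < D.off i + D.sz i) (hj : D.off j ≤ g ∧ g < D.off j + D.sz j) : False := by
  rcases lt_or_gt_of_ne h with h | h
  · have := D.off_add_sz_le_off h; omega
  · have := D.off_add_sz_le_off h; omega

/-! ### Dependence of the final weights on the processing order and on the lists. -/

namespace TupleLists

open JoinSchema

variable {m k : ℕ} {T T' : TupleLists m k}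

/-- The weights of a relation are frozen once it has been removed, so prefix sums computed just
before its removal are those of the final weights. -/
theorem finalWeights_of_notMem {r : Fin k} {g : ℕ} : ∀ {es : List (Fin k × Fin k)} {w : ℕ → ℝ},
    T.attrs.IsJoinOrder r es → (∀ j ∈ nodes r es, g ∉ T.tup j) → T.finalWeights w es g = w g
  | [], w, _, _ => rfl
  | (c, q) :: es, w, h, hg => by
    rw [finalWeights, finalWeights_of_notMem h.2.2.2 fun j hj => hg j (List.mem_cons_of_mem _ hj),
      pushWeights, if_neg (hg q (List.mem_cons_of_mem _ h.2.1))]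

/-- Weights are computed from the input order of the tuples, whereas the query uses the sorted
order; sums over groups do not see the difference. -/
theorem pushWeights_congr (h1 : T.attrs = T'.attrs) (h2 : T.val = T'.val)
    (h3 : ∀ j, (T.tup j).Perm (T'.tup j)) (w : ℕ → ℝ) (c q : Fin k) :
    T.pushWeights w c q = T'.pushWeights w c q := by
  obtain ⟨Q, v, t⟩ := T
  obtain ⟨Q', v', t'⟩ := T'
  obtain rfl : Q = Q' := h1
  obtain rfl : v = v' := h2
  funext g
  have h4 : g ∈ t q ↔ g ∈ t' q := (h3 q).mem_iff
  have h5 := (((h3 c).filter fun g' => key ⟨Q, v, t⟩ (Q.keyAttrs c q) g' =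
    key ⟨Q, v, t⟩ (Q.keyAttrs c q) g).map w).sum_eq
  simp only [pushWeights, h4]
  split_ifs
  · exact congrArg _ h5
  · rfl

theorem finalWeights_congr (h1 : T.attrs = T'.attrs) (h2 : T.val = T'.val)
    (h3 : ∀ j, (T.tup j).Perm (T'.tup j)) : ∀ (es : List (Fin k × Fin k)) (w : ℕ → ℝ),
    T.finalWeights w es = T'.finalWeights w es
  | [], _ => rfl
  | (c, q) :: es, w => by
    rw [finalWeights, finalWeights, pushWeights_congr h1 h2 h3, finalWeights_congr h1 h2 h3 es]

end TupleLists

namespace Layout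

open JoinSchema

variable {m k : ℕ}

/-- Each leaf is sorted and summed when its weights already incorporate everything that was
eliminated into it, and only then pushed to its neighbour. Later stages touch neither its cells nor
its weights. -/
theorem runs_buildIndex (Q : JoinSchema m k) (r : Fin k) :
    ∀ (es : List (Fin k × Fin k)), Q.IsJoinOrder r es →
    ∃ K, ∀ (D : JoinData m k) (s : RamState) (d : ℕ) (w : ℕ → ℝ), D.HasInput s →
      D.off k < 2 ^ d → (∀ i, s.mem (D.cell 3 i) = 0) → HasWeights D w s →
      Runs (buildIndex Q r es) s (K * ((D.off k + 1) * (d + 1))) fun s' =>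
        D.Frame (fun α i => (α = 1 ∧ i < D.off k) ∨ α = 3 ∨ ∃ j ∈ nodes r es, IndexCells D j α i) s s' ∧
        (∀ i, s'.mem (D.cell 3 i) = 0) ∧
        HasIndex D Q r es ((D.lists Q).finalWeights w es) s'
  | [], _ => by
    obtain ⟨K, hK⟩ := runs_index (m := m) (A := []) (by simp) r r.2
    refine ⟨K, fun D s d w hs hd h0 hw => ?_⟩
    have hoff := D.off_add_sz_le r.2
    refine (hK D s d w hs (by omega) h0 hw).mono
      (Nat.mul_le_mul_left _ (Nat.mul_le_mul_right _ (by omega))) ?_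
    rintro s' ⟨hf, h3, hI⟩
    refine ⟨hf.mono ?_, h3, hI, by simp⟩
    rintro α i (h | h)
    · exact Or.inr (Or.inl h)
    · exact Or.inr (Or.inr ⟨r, by simp [nodes], h⟩)
  | (c, q) :: es, hes => by
    obtain ⟨K, hK⟩ := runs_index (m := m) (Q.keyAttrs_le c q) c c.2
    obtain ⟨K₂, hK₂⟩ := runs_pushRel (Q.keyAttrs_le c q) c q c.2 q.2
    obtain ⟨K₃, hK₃⟩ := runs_buildIndex Q r es hes.2.2.2
    refine ⟨K + (K₂ + K₃), fun D s d w hs hd h0 hw => ?_⟩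
    have hoffc := D.off_add_sz_le c.2
    have hoffq := D.off_add_sz_le q.2
    rw [add_mul K, add_mul K₂]
    have hcn : ∀ j ∈ nodes r es, (c : ℕ) ≠ j := fun j hj h => hes.1 (by
      rwa [Fin.ext h])
    refine Runs.seq' ((hK D s d w hs (by omega) h0 hw).mono
      (Nat.mul_le_mul_left _ (Nat.mul_le_mul_right _ (by omega))) fun _ h => h) ?_
    rintro s₁ ⟨hf₁, h3₁, l, hl, hsort, hlist, hpre⟩
    have hs₁ := hs.frame hf₁
    have hlen : l.length = D.sz c := by simpa using hl.length_eq
    have hlN : ∀ g ∈ l, g < D.off k := fun g hg => by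
      have := List.mem_range'_1.1 (hl.mem_iff.1 hg); omega
    have hw₁ : HasWeights D w s₁ := fun g hg => by
      rw [hf₁.2 1 _ (by norm_num) (by unfold IndexCells; omega), hw g hg]
    refine Runs.seq' ((hK₂ D s₁ d w l hs₁ (by omega) hw₁ hlist hpre hlen hlN hsort).mono
      (Nat.mul_le_mul_left _ (Nat.mul_le_mul_right _ (by omega))) fun _ h => h) ?_
    rintro s₂ ⟨hf₂, hw₂⟩
    have hs₂ := hs₁.frame hf₂
    have hw₂' : HasWeights D ((D.lists Q).pushWeights w c q) s₂ := by
      intro g hg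
      rw [hw₂ g hg, TupleLists.pushWeights]
      beta_reduce
      have h5 := ((hl.filter fun g' => (Q.keyAttrs c q).map (D.val g') =
        (Q.keyAttrs c q).map (D.val g)).map w).sum_eq
      by_cases h : D.off q ≤ g ∧ g < D.off q + D.sz q
      · rw [if_pos h, if_pos (JoinData.mem_lists.2 h)]
        exact congrArg _ h5
      · rw [if_neg h, if_neg (fun h' => h (JoinData.mem_lists.1 h'))]
    have h3₂ : ∀ i, s₂.mem (D.cell 3 i) = 0 := fun i => by
      rw [hf₂.2 3 _ (by norm_num) (by norm_num), h3₁]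
    refine (hK₃ D s₂ d _ hs₂ hd h3₂ hw₂').mono le_rfl ?_
    rintro s₃ ⟨hf₃, h3₃, hI⟩
    refine ⟨(hf₁.mono ?_).trans ((hf₂.mono ?_).trans (hf₃.mono ?_)), h3₃, hI.1, ?_⟩
    · rintro α i (h | h)
      · exact Or.inr (Or.inl h)
      · exact Or.inr (Or.inr ⟨c, by simp [nodes], h⟩)
    · exact fun α i h => Or.inl h
    · rintro α i (h | h | ⟨j, hj, h⟩)
      · exact Or.inl h
      · exact Or.inr (Or.inl h)
      · exact Or.inr (Or.inr ⟨j, List.mem_cons_of_mem _ hj, h⟩)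
    · intro e he
      rcases List.mem_cons.1 he with rfl | he
      · have hI₁ : Indexed D c (Q.keyAttrs c q) w s₁ := ⟨l, hl, hsort, hlist, hpre⟩
        -- The push changes only the weight field, and the relations still to come occupy disjoint
        -- ranges of the index.
        have hI₃ := (hI₁.frame hf₂ (by unfold IndexCells; omega)).frame hf₃ (by
          rintro α i h (h' | h' | ⟨j, hj, h'⟩)
          · unfold IndexCells at h; omega
          · unfold IndexCells at h; omega
          · have hne := hcn j hj
            unfold IndexCells at h h'
            rcases lt_or_gt_of_ne hne with hlt | hlt
            · have := D.off_add_sz_le_off hlt; omega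
            · have := D.off_add_sz_le_off hlt; omega)
        -- The prefix sums were taken with `w`; on tuples of `c` this agrees with the final weights,
        -- because neither the push into `q` nor any later one affects them.
        refine hI₃.congr fun g h1 h2 => ?_
        rw [TupleLists.finalWeights, TupleLists.finalWeights_of_notMem (T := D.lists Q) (r := r)
          hes.2.2.2 fun j hj h => D.disjoint_ranges (hcn j hj) ⟨h1, h2⟩ (JoinData.mem_lists.1 h),
          TupleLists.pushWeights, if_neg fun h => D.disjoint_ranges (hcn q hes.2.1) ⟨h1, h2⟩
            (JoinData.mem_lists.1 h)]
      · exact hI.2 e he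

/-- The preprocessing. -/
noncomputable def build (Q : JoinSchema m k) (r : Fin k) (es : List (Fin k × Fin k)) : RamProg :=
  .seq (initWeights m k) (buildIndex Q r es)

theorem runs_build {Q : JoinSchema m k} {r : Fin k} {es : List (Fin k × Fin k)}
    (hes : Q.IsJoinOrder r es) :
    ∃ K, ∀ (D : JoinData m k) (s : RamState) (d : ℕ), D.HasInput s → D.off k < 2 ^ d →
      (∀ a, D.base ≤ a → s.mem a = 0) →
      Runs (build Q r es) s (K * ((D.off k + 1) * (d + 1))) fun s' => D.HasInput s' ∧
        HasIndex D Q r es ((D.lists Q).finalWeights (fun g => D.val g m) es) s' ∧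
        ∀ a, D.base + 4 * (D.off k + k + 1) ≤ a → s'.mem a = 0 := by
  obtain ⟨K, hK⟩ := runs_initWeights m k
  obtain ⟨K₂, hK₂⟩ := runs_buildIndex Q r es hes
  refine ⟨K + K₂, fun D s d hs hd h0 => ?_⟩
  rw [add_mul K K₂]
  refine Runs.seq' ((hK D s hs).mono (Nat.mul_le_mul_left _ (Nat.le_mul_of_pos_right _ (by omega)))
    fun _ h => h) ?_
  rintro s₁ ⟨hf₁, hw₁⟩
  have hs₁ := hs.frame hf₁
  refine (hK₂ D s₁ d _ hs₁ hd (fun i => ?_) hw₁).mono le_rfl ?_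
  · rw [hf₁.2 3 _ (by norm_num) (by norm_num), h0 _ (D.base_le_cell _ _)]
  rintro s₂ ⟨hf₂, h3, hI⟩
  refine ⟨hs₁.frame hf₂, hI, fun a ha => ?_⟩
  -- Every address from `D.base` on is a field of a unique record; the sorted lists, weights and
  -- prefix sums use record numbers of at most `D.off k + k`.
  have hbase : ∃ i α, α < 4 ∧ a = D.cell α i ∧ D.off k + k < i := by
    refine ⟨(a - D.base) / 4, (a - D.base) % 4, by omega, ?_, by omega⟩
    unfold JoinData.cell
    omega
  obtain ⟨i, α, hα, rfl, hi⟩ := hbase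
  have h0' : s.mem (D.cell α i) = 0 := h0 _ (D.base_le_cell _ _)
  by_cases hα3 : α = 3
  · rw [hα3, h3]
  · rw [hf₂.2 α i hα ?_, hf₁.2 α i hα (by omega), h0']
    rintro (h | h | ⟨j, hj, h⟩)
    · omega
    · exact hα3 h
    · have := D.off_add_sz_le j.2
      have := j.2
      unfold IndexCells at h
      omega

end Layout

/-! ### Locating a join result by binary search in the index. -/

theorem Located.of_position {l : List ℕ} {w : ℕ → ℝ} {lo hi p : ℕ} {t : ℝ} (h1 : lo ≤ p)
    (h2 : p < hi) (h3 : hi ≤ l.length)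
    (h4 : ((l.take p).map w).sum - ((l.take lo).map w).sum ≤ t)
    (h5 : t < ((l.take (p + 1)).map w).sum - ((l.take lo).map w).sum) :
    Located ((l.take hi).drop lo) w t l[p] (((l.take p).map w).sum - ((l.take lo).map w).sum) := by
  refine ⟨(l.take p).drop lo, (l.take hi).drop (p + 1), ?_, ?_, h4, ?_⟩
  · have h6 : l.take hi = l.take p ++ l[p] :: (l.take hi).drop (p + 1) := by
      conv_lhs => rw [← List.take_append_drop p (l.take hi)]
      rw [List.take_take, min_eq_left h2.le, List.drop_eq_getElem_cons (by simp; omega)]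
      simp
    conv_lhs => rw [h6]
    rw [List.drop_append_of_le_length (by simp; omega)]
  · rw [List.map_drop, List.map_take, List.sum_drop_take h1]
    simp only [List.map_take]
  · rw [List.sum_map_take_succ w (by omega)] at h5
    linarith

theorem List.sum_map_take_mono {l : List ℕ} {w : ℕ → ℝ} (hw : ∀ g, 0 ≤ w g) {i j : ℕ}
    (h : i ≤ j) : ((l.take i).map w).sum ≤ ((l.take j).map w).sum := by
  have h1 : l.take j = l.take i ++ (l.take j).drop i := by
    conv_lhs => rw [← List.take_append_drop i (l.take j), List.take_take, min_eq_left h]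
  rw [h1, List.map_append, List.sum_append]
  have : 0 ≤ (((l.take j).drop i).map w).sum := List.sum_nonneg fun x hx => by
    obtain ⟨g, -, rfl⟩ := List.mem_map.1 hx
    exact hw g
  linarith

namespace JoinSchema

variable {m k : ℕ} {Q : JoinSchema m k} {r : Fin k}

theorem fst_mem_nodes {e : Fin k × Fin k} : ∀ {es : List (Fin k × Fin k)}, e ∈ es → e.1 ∈ nodes r es
  | e' :: es, h => by
    rcases List.mem_cons.1 h with rfl | h
    · exact List.mem_cons_self
    · exact List.mem_cons_of_mem _ (fst_mem_nodes h)

theorem root_mem_nodes : ∀ {es : List (Fin k × Fin k)}, r ∈ nodes r es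
  | [] => List.mem_singleton.2 rfl
  | _ :: _ => List.mem_cons_of_mem _ root_mem_nodes

theorem IsJoinOrder.fst_ne_root {e : Fin k × Fin k} : ∀ {es : List (Fin k × Fin k)},
    Q.IsJoinOrder r es → e ∈ es → e.1 ≠ r
  | e' :: es, h, he => by
    rcases List.mem_cons.1 he with rfl | he
    · exact fun h' => h.1 (h' ▸ root_mem_nodes)
    · exact h.2.2.2.fst_ne_root he

theorem IsJoinOrder.eq_of_fst_eq {e e' : Fin k × Fin k} : ∀ {es : List (Fin k × Fin k)},
    Q.IsJoinOrder r es → e ∈ es → e' ∈ es → e.1 = e'.1 → e = e'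
  | e'' :: es, h, he, he', hee => by
    rcases List.mem_cons.1 he with h1 | h1 <;> rcases List.mem_cons.1 he' with h2 | h2
    · rw [h1, h2]
    · refine absurd (fst_mem_nodes (r := r) h2) ?_
      rw [← hee, h1]; exact h.1
    · refine absurd (fst_mem_nodes (r := r) h1) ?_
      rw [hee, h2]; exact h.1
    · exact h.2.2.2.eq_of_fst_eq h1 h2 hee

end JoinSchema

namespace TupleLists

variable {m k : ℕ} {T : TupleLists m k}

theorem pushWeights_nonneg {w : ℕ → ℝ} (hw : ∀ g, 0 ≤ w g) (c q : Fin k) (g : ℕ) :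
    0 ≤ T.pushWeights w c q g := by
  unfold pushWeights
  split_ifs
  · refine mul_nonneg (hw g) (List.sum_nonneg fun x hx => ?_)
    obtain ⟨g, -, rfl⟩ := List.mem_map.1 hx
    exact hw g
  · exact hw g

end TupleLists

namespace Layout

open JoinSchema

variable {m k : ℕ} {D : JoinData m k} {s : RamState}

/-- The lists of `T` are the sorted relations of the index. -/
structure IsStored (D : JoinData m k) (T : TupleLists m k) (r : Fin k) (es : List (Fin k × Fin k))
    (w : ℕ → ℝ) (s : RamState) : Prop where
  list_root : HasList D r (T.tup r) s
  prefix_root : HasPrefix D r (T.tup r) w s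
  sorted : ∀ e ∈ es, (T.tup e.1).Pairwise fun g g' =>
    (T.attrs.keyAttrs e.1 e.2).map (D.val g) ≤ (T.attrs.keyAttrs e.1 e.2).map (D.val g')
  list_fst : ∀ e ∈ es, HasList D e.1 (T.tup e.1) s
  prefix_fst : ∀ e ∈ es, HasPrefix D e.1 (T.tup e.1) w s

/-- Every relation is either the root or the first component of at most one edge, so a single sorted
list per relation can be chosen. Enumerating the join with these lists yields the lexicographic
order that the index represents. -/
theorem HasIndex.exists_isStored {Q : JoinSchema m k} {r : Fin k} {es : List (Fin k × Fin k)}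
    {w : ℕ → ℝ} (hes : Q.IsJoinOrder r es) (h : HasIndex D Q r es w s) :
    ∃ T : TupleLists m k, T.attrs = Q ∧ T.val = D.val ∧
      (∀ j : Fin k, (T.tup j).Perm (List.range' (D.off j) (D.sz j))) ∧ IsStored D T r es w s := by
  have key : ∀ j : Fin k, ∃ l : List ℕ, l.Perm (List.range' (D.off j) (D.sz j)) ∧
      (j = r → HasList D j l s ∧ HasPrefix D j l w s) ∧ ∀ e ∈ es, e.1 = j →
        (l.Pairwise fun g g' => (Q.keyAttrs e.1 e.2).map (D.val g) ≤
          (Q.keyAttrs e.1 e.2).map (D.val g')) ∧ HasList D j l s ∧ HasPrefix D j l w s := by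
    intro j
    by_cases hj : j = r
    · subst hj
      obtain ⟨l, h1, -, h2, h3⟩ := h.1
      exact ⟨l, h1, fun _ => ⟨h2, h3⟩, fun e he he' => absurd he' (hes.fst_ne_root he)⟩
    by_cases hj' : ∃ e ∈ es, e.1 = j
    · obtain ⟨e, he, rfl⟩ := hj'
      obtain ⟨l, h1, h2, h3, h4⟩ := h.2 e he
      refine ⟨l, h1, fun h => absurd h hj, fun e' he' hee => ?_⟩
      obtain rfl := hes.eq_of_fst_eq he' he hee
      exact ⟨h2, h3, h4⟩
    · exact ⟨_, List.Perm.refl _, fun h => absurd h hj, fun e he he' => absurd ⟨e, he, he'⟩ hj'⟩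
  choose l h1 h2 h3 using key
  exact ⟨⟨Q, D.val, l⟩, rfl, rfl, h1, (h2 r rfl).1, (h2 r rfl).2, fun e he => (h3 _ e he rfl).1,
    fun e he => (h3 _ e he rfl).2.1, fun e he => (h3 _ e he rfl).2.2⟩

/-- Find the first position after which the prefix sum exceeds register `22`. -/
def searchPrefix (m k c : ℕ) : RamProg :=
  bsearch (.lt (.reg 22) (preE m k c (.add (.reg 4) (.lit 1))))

/-- Weights are nonnegative, so prefix sums are monotone and binary search applies. The strict
inequality in the test ensures that a tuple of weight `0`, whose interval is empty, is never
returned. -/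
theorem runs_searchPrefix {c d lo hi : ℕ} {l : List ℕ} {w : ℕ → ℝ} {t : ℝ} (hc : c < k)
    (hs : D.HasInput s) (hw : ∀ g, 0 ≤ w g) (hpre : HasPrefix D c l w s) (h2 : s.reg 2 = lo)
    (h3 : s.reg 3 = hi) (h22 : s.reg 22 = t) (hhi : hi ≤ l.length) (hd : l.length < 2 ^ d)
    (hlo : ((l.take lo).map w).sum ≤ t) (hlt : t < ((l.take hi).map w).sum) :
    Runs (searchPrefix m k c) s
      ((d + 1) * ((RamTest.lt (.reg 22) (preE m k c (.add (.reg 4) (.lit 1)))).cost + 20))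
      fun s' => RegFrame (fun x => x = 2 ∨ x = 3 ∨ x = 4) s s' ∧ ∃ p : ℕ, lo ≤ p ∧ p < hi ∧
        s'.reg 2 = p ∧ ((l.take p).map w).sum ≤ t ∧ t < ((l.take (p + 1)).map w).sum := by
  have hlohi : lo < hi := by
    by_contra h
    have := List.sum_map_take_mono (l := l) hw (not_lt.1 h)
    linarith
  refine (runs_bsearch _ (fun p => t < ((l.take (p + 1)).map w).sum) h2 h3 hlohi.le
    (n := d) (by omega) ?_ ?_).mono le_rfl ?_
  · intro s' hf p _ hp h4
    have e := eval_preE (hs.of_mem_eq hf.1) hc.le (hpre.of_mem_eq hf.1)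
      (e := .add (.reg 4) (.lit 1)) (t := p + 1) (by simp [h4]) (by omega)
    rw [RamTest.holds, e, RamExpr.eval, hf.2.2 22 (by norm_num), h22]
  · intro p p' _ hpp _ h
    exact h.trans_le (List.sum_map_take_mono hw (by omega))
  · rintro s' ⟨hf, p, h1, h5, h6, h7, h8⟩
    have hphi : p < hi := by
      refine lt_of_le_of_ne h5 fun h => h7 (hi - 1) (by omega) (by omega) ?_
      rwa [Nat.sub_add_cancel (by omega)]
    refine ⟨hf, p, h1, hphi, h6, ?_, h8 p le_rfl hphi⟩
    rcases h1.eq_or_lt with rfl | h1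
    · exact hlo
    · have := h7 (p - 1) (by omega) (by omega)
      rwa [Nat.sub_add_cancel (by omega), not_lt] at this

/-- The registers used by `locate`. -/
def LocateRegs (x : ℕ) : Prop :=
  x = 2 ∨ x = 3 ∨ x = 4 ∨ x = 8 ∨ x = 9 ∨ x = 20 ∨ x = 21 ∨ x = 22 ∨ x = 23 ∨ 100 ≤ x

/-- Find the join result whose interval contains register `6`: register `8` contains the start of
the interval, register `9` its length, and the registers from `100` on the tuples. -/
noncomputable def locate (Q : JoinSchema m k) (r : Fin k) : List (Fin k × Fin k) → RamProg
  | [] => .seq (.seq (.assign 2 (.lit 0)) (.seq (.assign 3 (szE r)) (.assign 22 (.reg 6))))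
      (.seq (searchPrefix m k r)
      (.seq (.assign (r + 100) (srtE m k r (.reg 2)))
      (.seq (.assign 8 (preE m k r (.reg 2)))
        (.assign 9 (.sub (preE m k r (.add (.reg 2) (.lit 1))) (preE m k r (.reg 2)))))))
  | (c, q) :: es => .seq (locate Q r es)
      (.seq (findRange m k (Q.keyAttrs c q) c (q + 100))
      (.seq (.seq (.assign 23 (.sub (preE m k c (.reg 21)) (preE m k c (.reg 20))))
      (.seq (.assign 22 (.add (preE m k c (.reg 20))
        (.div (.mul (.sub (.reg 6) (.reg 8)) (.reg 23)) (.reg 9))))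
      (.seq (.assign 2 (.reg 20)) (.assign 3 (.reg 21)))))
      (.seq (searchPrefix m k c)
      (.seq (.assign (c + 100) (srtE m k c (.reg 2)))
      (.seq (.assign 8 (.add (.reg 8)
        (.mul (.sub (preE m k c (.reg 2)) (preE m k c (.reg 20))) (.div (.reg 9) (.reg 23)))))
        (.assign 9 (.mul (.sub (preE m k c (.add (.reg 2) (.lit 1))) (preE m k c (.reg 2)))
          (.div (.reg 9) (.reg 23)))))))))

/-- The registers describe the join result whose interval contains `y`. -/
def IsLocated (T : TupleLists m k) (r : Fin k) (es : List (Fin k × Fin k)) (w : ℕ → ℝ) (y : ℝ)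
    (s : RamState) : Prop :=
  ∃ f, Located (T.results r es) (TupleLists.weight w r es) y f (s.reg 8) ∧ s.reg 9 = TupleLists.weight w r es f ∧
    ∀ j ∈ nodes r es, s.reg (j + 100) = f j

/-- The recursion follows the join order from the root outwards. The smaller join is located with
respect to the pushed weights; the interval found there is divided among the partners in `c` in
proportion to their weights, and one further range search and prefix search select the partner. -/
theorem runs_locate (Q : JoinSchema m k) (r : Fin k) : ∀ es : List (Fin k × Fin k),
    Q.IsJoinOrder r es → ∃ K, ∀ (D : JoinData m k) (T : TupleLists m k) (s : RamState) (d : ℕ)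
      (w : ℕ → ℝ), T.attrs = Q → T.val = D.val →
      (∀ j : Fin k, (T.tup j).Perm (List.range' (D.off j) (D.sz j))) → D.HasInput s →
      D.off k < 2 ^ d → (∀ g, 0 ≤ w g) → IsStored D T r es (T.finalWeights w es) s →
      0 ≤ s.reg 6 → s.reg 6 < ((T.tup r).map (T.finalWeights w es)).sum →
      Runs (locate Q r es) s (K * (d + 1)) fun s' => RegFrame LocateRegs s s' ∧
        IsLocated T r es w (s.reg 6) s'
  | [], _ => by
    set c₁ := RamProg.seq (.assign 2 (.lit 0))
      (.seq (.assign 3 (szE r)) (.assign 22 (.reg 6))) with hc₁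
    set c₂ := RamProg.seq (.assign (r + 100) (srtE m k r (.reg 2)))
      (.seq (.assign 8 (preE m k r (.reg 2)))
        (.assign 9 (.sub (preE m k r (.add (.reg 2) (.lit 1))) (preE m k r (.reg 2))))) with hc₂
    refine ⟨c₁.scost + ((RamTest.lt (.reg 22) (preE m k r (.add (.reg 4) (.lit 1)))).cost + 20) +
      c₂.scost, fun D T s d w hQ hval hperm hs hd hw hst h0 hlt => ?_⟩
    have hlen : (T.tup r).length = D.sz r := by simpa using (hperm r).length_eq
    have hoff := D.off_add_sz_le r.2
    have hpre₀ : HasPrefix D r (T.tup r) w s := hst.prefix_root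
    change _ < ((T.tup r).map w).sum at hlt
    refine Runs.mono (t := c₁.scost + ((d + 1) * ((RamTest.lt (.reg 22)
      (preE m k r (.add (.reg 4) (.lit 1)))).cost + 20) + c₂.scost)) ?_ (by nlinarith) fun _ h => h
    set s₁ := ((s.setReg 2 0).setReg 3 (D.sz r)).setReg 22 (s.reg 6) with hs₁
    have hd₁ : c₁.den s = s₁ := by
      have h6 : RamExpr.eval s (.lit 0) = 0 := by simp
      have h7 : RamExpr.eval (s.setReg 2 0) (szE r) = D.sz r := eval_szE (D := D) hs r.2
      simp only [hc₁, RamProg.den_seq, RamProg.den_assign, h6, h7, hs₁]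
      simp
    have hf₁ : RegFrame LocateRegs s s₁ :=
      (((RegFrame.refl _ s).setReg (by simp [LocateRegs]) _).setReg (by simp [LocateRegs]) _).setReg
        (by simp [LocateRegs]) _
    refine Runs.seq' (R := fun s' => s' = s₁)
      (RamProg.LoopFree.runs (by simp) s hd₁) ?_
    rintro _ rfl
    refine (runs_searchPrefix (lo := 0) (hi := D.sz r) (d := d) r.2 (hs.of_mem_eq hf₁.1) hw
      (hpre₀.of_mem_eq hf₁.1) (by simp [hs₁]) (by simp [hs₁]) rfl hlen.ge (by omega)
      (by simpa [hs₁] using h0) ?_).seq' ?_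
    · rw [← hlen, List.take_length]; simpa [hs₁] using hlt
    rintro s₂ ⟨hf₂, p, -, hp, h2, hle, hlt'⟩
    have hf₂' : RegFrame LocateRegs s s₂ :=
      hf₁.trans (hf₂.mono fun x => by unfold LocateRegs; tauto)
    refine RamProg.LoopFree.runs (by simp) s₂ ?_
    have hs₂ := hs.of_mem_eq hf₂'.1
    have hpre := hpre₀.of_mem_eq hf₂'.1
    have hpl : p < (T.tup r).length := by omega
    have e1 := eval_srtE hs₂ r.2.le (hst.list_root.of_mem_eq hf₂'.1) (e := .reg 2) h2 hpl
    set s₃ := s₂.setReg (r + 100) (T.tup r)[p] with hs₃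
    have h2₃ : s₃.reg 2 = p := by simp [hs₃, h2]
    have e2 := eval_preE (s := s₃) hs₂ r.2.le hpre (e := .reg 2) h2₃ hpl.le
    set s₄ := s₃.setReg 8 (((T.tup r).take p).map w).sum with hs₄
    have h2₄ : s₄.reg 2 = p := by simp [hs₄, h2₃]
    have e3 := eval_preE (s := s₄) hs₂ r.2.le hpre (e := .reg 2) h2₄ hpl.le
    have e4 := eval_preE (s := s₄) hs₂ r.2.le hpre (e := .add (.reg 2) (.lit 1)) (t := p + 1)
      (by simp [h2₄]) hpl
    have e5 : RamExpr.eval s₄ (.sub (preE m k r (.add (.reg 2) (.lit 1))) (preE m k r (.reg 2))) =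
        w (T.tup r)[p] := by
      rw [RamExpr.eval, e3, e4, List.sum_map_take_succ _ hpl]
      simp
    simp only [RamProg.den_seq, RamProg.den_assign, e1, ← hs₃, e2, ← hs₄, e5]
    have hwt : ∀ g, TupleLists.weight w r [] (Function.update (fun _ => 0) r g) = w g := fun g => by
      simp [TupleLists.weight, nodes]
    refine ⟨((hf₂'.setReg (by simp [LocateRegs]) _).setReg (by simp [LocateRegs]) _).setReg
      (by simp [LocateRegs]) _, Function.update (fun _ => 0) r (T.tup r)[p], ?_, ?_, ?_⟩
    · have h5 := Located.of_position (l := T.tup r) (w := w) (lo := 0) (hi := D.sz r) (p := p)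
        (t := s.reg 6) (Nat.zero_le _) hp hlen.ge (by simpa [hs₁] using hle)
        (by simpa [hs₁] using hlt')
      have h6 := h5.map (F := fun g => Function.update (fun _ : Fin k => 0) r g)
        (w' := TupleLists.weight w r []) one_pos fun g _ => by rw [hwt, mul_one]
      rw [List.take_of_length_le hlen.le] at h6
      simpa [TupleLists.results, hs₄] using h6
    · rw [hwt]; simp
    · simp [nodes, hs₃, hs₄]
  | (c, q) :: es, hes => by
    obtain ⟨K, hK⟩ := runs_locate Q r es hes.2.2.2
    obtain ⟨K₂, hK₂⟩ := runs_findRange (Q.keyAttrs_le c q) c c.2 (q + 100)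
      (by unfold FindRegs; omega)
    set c₁ := RamProg.seq (.assign 23 (.sub (preE m k c (.reg 21)) (preE m k c (.reg 20))))
      (.seq (.assign 22 (.add (preE m k c (.reg 20))
        (.div (.mul (.sub (.reg 6) (.reg 8)) (.reg 23)) (.reg 9))))
      (.seq (.assign 2 (.reg 20)) (.assign 3 (.reg 21)))) with hc₁
    set c₂ := RamProg.seq (.assign (c + 100) (srtE m k c (.reg 2)))
      (.seq (.assign 8 (.add (.reg 8)
        (.mul (.sub (preE m k c (.reg 2)) (preE m k c (.reg 20))) (.div (.reg 9) (.reg 23)))))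
        (.assign 9 (.mul (.sub (preE m k c (.add (.reg 2) (.lit 1))) (preE m k c (.reg 2)))
          (.div (.reg 9) (.reg 23))))) with hc₂
    refine ⟨K + (K₂ + (c₁.scost + ((RamTest.lt (.reg 22)
      (preE m k c (.add (.reg 4) (.lit 1)))).cost + 20) + c₂.scost)),
      fun D T s d w hQ hval hperm hs hd hw hst h0 hlt => ?_⟩
    have hlen : (T.tup c).length = D.sz c := by simpa using (hperm c).length_eq
    have hoff := D.off_add_sz_le c.2
    have hmem : ∀ j : Fin k, ∀ g, g ∈ T.tup j ↔ D.off j ≤ g ∧ g < D.off j + D.sz j := fun j g => by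
      rw [(hperm j).mem_iff, List.mem_range'_1]
    have hdisj : ∀ i j, i ≠ j → (T.tup i).Disjoint (T.tup j) := fun i j hij g hi hj =>
      D.disjoint_ranges (fun h => hij (Fin.ext h)) ((hmem i g).1 hi) ((hmem j g).1 hj)
    have hlN : ∀ j : Fin k, ∀ g ∈ T.tup j, g < D.off k := fun j g hg => by
      have := (hmem j g).1 hg
      have := D.off_add_sz_le j.2
      omega
    have hes' : T.attrs.IsJoinOrder r ((c, q) :: es) := hQ ▸ hes
    refine Runs.mono (t := K * (d + 1) + (K₂ * (d + 1) + (c₁.scost + ((d + 1) *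
      ((RamTest.lt (.reg 22) (preE m k c (.add (.reg 4) (.lit 1)))).cost + 20) + c₂.scost)))) ?_
      (by nlinarith) fun _ h => h
    -- the relations that have been processed
    refine (hK D T s d (T.pushWeights w c q) hQ hval hperm hs hd
      (fun g => TupleLists.pushWeights_nonneg hw c q g)
      ⟨hst.list_root, hst.prefix_root, fun e he => hst.sorted e (List.mem_cons_of_mem _ he),
        fun e he => hst.list_fst e (List.mem_cons_of_mem _ he),
        fun e he => hst.prefix_fst e (List.mem_cons_of_mem _ he)⟩ h0 hlt).seq' ?_
    rintro s₁ ⟨hf₁, f, hloc, h9, hids⟩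
    -- The stored prefix sums belong to the final weights, which on `c` are still the weights `w` of
    -- this stage.
    have hfin : ∀ g ∈ T.tup c, T.finalWeights w ((c, q) :: es) g = w g := by
      intro g hg
      have hgn : ∀ j ∈ nodes r es, g ∉ T.tup j := fun j hj h =>
        hdisj c j (fun h' => hes.1 (h' ▸ hj)) hg h
      rw [TupleLists.finalWeights, TupleLists.finalWeights_of_notMem hes'.2.2.2 hgn,
        TupleLists.pushWeights, if_neg (hgn q hes.2.1)]
    have hpre : HasPrefix D c (T.tup c) w s := fun t ht => by
      rw [hst.prefix_fst (c, q) List.mem_cons_self t ht]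
      exact congrArg List.sum (List.map_congr_left fun g hg => hfin g (List.mem_of_mem_take hg))
    have hfq : f q ∈ T.tup q :=
      ((TupleLists.mem_results hes'.2.2.2).1 hloc.mem).1 q hes.2.1
    have hlist := hst.list_fst (c, q) List.mem_cons_self
    have hsort := hst.sorted (c, q) List.mem_cons_self
    rw [hQ] at hsort
    have h6₁ : s₁.reg 6 = s.reg 6 := hf₁.2.2 6 (by simp [LocateRegs])
    -- the range of the join partners
    refine (hK₂ D s₁ d (T.tup c) (f q) (hs.of_mem_eq hf₁.1) (by omega) (hlist.of_mem_eq hf₁.1) hlen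
      (hlN c) hsort (hids q hes.2.1) (hlN q _ hfq)).seq' ?_
    rintro s₂ ⟨hf₂, lo, hi, hlohi, hhi, e20, e21, hrange⟩
    have hf₂' : RegFrame LocateRegs s s₂ :=
      hf₁.trans (hf₂.mono fun x => by unfold LocateRegs FindRegs; tauto)
    have h6₂ : s₂.reg 6 = s.reg 6 := hf₂'.2.2 6 (by simp [LocateRegs])
    have h8₂ : s₂.reg 8 = s₁.reg 8 := hf₂.2.2 8 (by simp [FindRegs])
    have h9₂ : s₂.reg 9 = s₁.reg 9 := hf₂.2.2 9 (by simp [FindRegs])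
    have hid₂ : ∀ j : Fin k, s₂.reg (j + 100) = s₁.reg (j + 100) := fun j =>
      hf₂.2.2 _ (by unfold FindRegs; omega)
    have hs₂ := hs.of_mem_eq hf₂'.1
    have hpre₂ := hpre.of_mem_eq hf₂'.1
    set pre : ℕ → ℝ := fun i => (((T.tup c).take i).map w).sum with hpredef
    have hgrp : T.grp c q (f q) = ((T.tup c).take hi).drop lo := by
      unfold TupleLists.grp TupleLists.key
      refine List.filter_eq_drop_take _ _ lo hi hlohi hhi fun t ht => ?_
      rw [decide_eq_true_eq, hQ, hval]
      exact hrange t ht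
    have hS : pre hi - pre lo = ((T.grp c q (f q)).map w).sum := by
      rw [hgrp, List.map_drop, List.map_take, List.sum_drop_take hlohi]
      simp only [hpredef, List.map_take]
    have hS0 : 0 ≤ pre hi - pre lo := sub_nonneg.2 (List.sum_map_take_mono hw hlohi)
    have hW := hloc.pos
    have hWS := TupleLists.weight_pushWeights hdisj (w := w) (c := c) hes'.2.2.2 hes.2.1 hloc.mem
    rw [← hS] at hWS
    -- The interval of `f` is nonempty and its length has the total weight of the partners as a
    -- factor, so partners of positive weight exist.
    have hSpos : 0 < pre hi - pre lo :=
      lt_of_le_of_ne hS0 fun h0 => by rw [hWS, ← h0, zero_mul] at hW; exact lt_irrefl _ hW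
    -- The offset of register `6` in the interval of `f`, rescaled from the length of that interval
    -- to the total weight of the group.
    set tgt : ℝ := (s.reg 6 - s₁.reg 8) * (pre hi - pre lo) / s₁.reg 9 with htgt
    have hWpos : 0 < s₁.reg 9 := by rw [h9]; exact hW
    obtain ⟨_, _, -, -, hy1, hy2⟩ := id hloc
    rw [← h9] at hy2
    have htgt0 : 0 ≤ tgt := div_nonneg (mul_nonneg (by linarith) hS0) hWpos.le
    have htgt1 : tgt < pre hi - pre lo := by
      rw [htgt, div_lt_iff₀ hWpos, mul_comm]
      exact mul_lt_mul_of_pos_left (by linarith) hSpos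
    set s₃ := (((s₂.setReg 23 (pre hi - pre lo)).setReg 22 (pre lo + tgt)).setReg 2 lo).setReg 3 hi
      with hs₃
    have hd₃ : c₁.den s₂ = s₃ := by
      have e1 : RamExpr.eval s₂ (.sub (preE m k c (.reg 21)) (preE m k c (.reg 20))) =
          pre hi - pre lo := by
        rw [RamExpr.eval, eval_preE hs₂ c.2.le hpre₂ (e := .reg 21) e21 hhi,
          eval_preE hs₂ c.2.le hpre₂ (e := .reg 20) e20 (hlohi.trans hhi)]
      set s' := s₂.setReg 23 (pre hi - pre lo) with hs'
      have e2 : RamExpr.eval s' (.add (preE m k c (.reg 20))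
          (.div (.mul (.sub (.reg 6) (.reg 8)) (.reg 23)) (.reg 9))) = pre lo + tgt := by
        rw [RamExpr.eval, eval_preE (s := s') hs₂ c.2.le hpre₂ (e := .reg 20) (t := lo)
          (by simp [hs', e20]) (hlohi.trans hhi)]
        simp [hs', h6₂, h8₂, h9₂, htgt, hpredef]
      simp only [hc₁, RamProg.den_seq, RamProg.den_assign, e1, e2, ← hs', hs₃]
      simp [hs', e20, e21]
    refine Runs.seq' (R := fun s' => s' = s₃)
      (RamProg.LoopFree.runs (by simp) s₂ hd₃) ?_
    rintro _ rfl
    have hf₃ : RegFrame LocateRegs s s₃ :=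
      (((hf₂'.setReg (by simp [LocateRegs]) _).setReg (by simp [LocateRegs]) _).setReg
        (by simp [LocateRegs]) _).setReg (by simp [LocateRegs]) _
    refine (runs_searchPrefix (lo := lo) (hi := hi) (d := d) (t := pre lo + tgt) c.2
      (hs.of_mem_eq hf₃.1) hw (hpre.of_mem_eq hf₃.1) (by simp [hs₃]) (by simp [hs₃])
      (by simp [hs₃]) hhi (by omega) (by linarith) (by linarith)).seq' ?_
    rintro s₄ ⟨hf₄, p, hlop, hphi, h2, hle, hlt'⟩
    have hf₄' : RegFrame LocateRegs s s₄ :=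
      hf₃.trans (hf₄.mono fun x => by unfold LocateRegs; tauto)
    have hs₄ := hs.of_mem_eq hf₄'.1
    have hpre₄ := hpre.of_mem_eq hf₄'.1
    have hpl : p < (T.tup c).length := by omega
    have hreg : ∀ x, ¬ (x = 2 ∨ x = 3 ∨ x = 4) → s₄.reg x = s₃.reg x := fun x hx => hf₄.2.2 x hx
    have h8₄ : s₄.reg 8 = s₁.reg 8 := by rw [hreg 8 (by norm_num), ← h8₂]; simp [hs₃]
    have h9₄ : s₄.reg 9 = s₁.reg 9 := by rw [hreg 9 (by norm_num), ← h9₂]; simp [hs₃]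
    have h20₄ : s₄.reg 20 = lo := by rw [hreg 20 (by norm_num), ← e20]; simp [hs₃]
    have h23₄ : s₄.reg 23 = pre hi - pre lo := by rw [hreg 23 (by norm_num)]; simp [hs₃]
    have hid₄ : ∀ j : Fin k, s₄.reg (j + 100) = s₁.reg (j + 100) := fun j => by
      rw [hreg _ (by omega), ← hid₂]
      simp only [hs₃, RamState.reg_setReg]
      rw [if_neg (by omega), if_neg (by omega), if_neg (by omega), if_neg (by omega)]
    refine RamProg.LoopFree.runs (by simp) s₄ ?_
    have e1 := eval_srtE hs₄ c.2.le (hlist.of_mem_eq hf₄'.1) (e := .reg 2) h2 hpl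
    set s₅ := s₄.setReg (c + 100) (T.tup c)[p] with hs₅
    have e2 : RamExpr.eval s₅ (.add (.reg 8) (.mul (.sub (preE m k c (.reg 2))
        (preE m k c (.reg 20))) (.div (.reg 9) (.reg 23)))) =
        s₁.reg 8 + (pre p - pre lo) * (s₁.reg 9 / (pre hi - pre lo)) := by
      simp only [RamExpr.eval]
      rw [eval_preE (s := s₅) hs₄ c.2.le hpre₄ (e := .reg 2) (t := p) (by simp [hs₅, h2]) hpl.le,
        eval_preE (s := s₅) hs₄ c.2.le hpre₄ (e := .reg 20) (t := lo) (by simp [hs₅, h20₄])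
          (hlohi.trans hhi)]
      simp [hs₅, h8₄, h9₄, h23₄, hpredef]
    set s₆ := s₅.setReg 8 (s₁.reg 8 + (pre p - pre lo) * (s₁.reg 9 / (pre hi - pre lo))) with hs₆
    have e3 : RamExpr.eval s₆ (.mul (.sub (preE m k c (.add (.reg 2) (.lit 1)))
        (preE m k c (.reg 2))) (.div (.reg 9) (.reg 23))) =
        w (T.tup c)[p] * (s₁.reg 9 / (pre hi - pre lo)) := by
      simp only [RamExpr.eval]
      rw [eval_preE (s := s₆) hs₄ c.2.le hpre₄ (e := .reg 2) (t := p) (by simp [hs₆, hs₅, h2])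
          hpl.le,
        eval_preE (s := s₆) hs₄ c.2.le hpre₄ (e := .add (.reg 2) (.lit 1)) (t := p + 1)
          (by simp [hs₆, hs₅, h2]) hpl, List.sum_map_take_succ _ hpl]
      simp [hs₆, hs₅, h9₄, h23₄]
    simp only [RamProg.den_seq, RamProg.den_assign, e1, ← hs₅, e2, ← hs₆, e3]
    have h5 := Located.of_position (l := T.tup c) (w := w) (lo := lo) (hi := hi) (p := p)
      (t := tgt) hlop hphi hhi (by linarith) (by linarith)
    rw [← hgrp] at h5
    obtain ⟨h7, h8⟩ := TupleLists.located_extend hdisj hes' hS hS0 h9 hloc (g := (T.tup c)[p]) h5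
    refine ⟨((hf₄'.setReg (by simp [LocateRegs]) _).setReg (by simp [LocateRegs]) _).setReg
      (by simp [LocateRegs]) _, Function.update f c (T.tup c)[p], ?_, ?_, ?_⟩
    · simpa [hs₆, hpredef] using h7
    · simpa using h8.symm
    · intro j hj
      have h10 : (j : ℕ) + 100 ≠ 9 ∧ (j : ℕ) + 100 ≠ 8 := by omega
      simp only [hs₆, hs₅, RamState.reg_setReg, if_neg h10.1, if_neg h10.2, Nat.add_right_cancel_iff,
        Fin.val_inj]
      by_cases hjc : j = c
      · subst hjc; simp
      · rw [if_neg hjc, Function.update_of_ne hjc, hid₄]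
        exact hids j ((List.mem_cons.1 hj).resolve_left hjc)

end Layout

/-! ### Skipping over many elements at once. -/

namespace SkipSampling

theorem run_of_sum_le : ∀ {L : List ℝ} {g h : ℝ} (ρ : ℕ → ℝ), (∀ p ∈ L, 0 ≤ p) → L.sum ≤ g →
    L.sum ≤ h → run L g h ρ = (List.replicate L.length false, 0)
  | [], _, _, _, _, _, _ => rfl
  | p :: L, g, h, ρ, hL, hg, hh => by
    rw [List.sum_cons] at hg hh
    have h0 : 0 ≤ L.sum := List.sum_nonneg fun x hx => hL x (List.mem_cons_of_mem _ hx)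
    rw [run, if_pos ⟨by linarith, by linarith⟩, run_of_sum_le ρ
      (fun x hx => hL x (List.mem_cons_of_mem _ hx)) (by linarith) (by linarith)]
    simp [List.replicate_succ]

/-- The mathematical process walks through the list element by element, whereas the machine jumps
directly to the next hit. Elements passed over consume no random numbers, so both reach the same
element with the same stream. -/
theorem run_of_lt : ∀ {M : List ℝ} {p : ℝ} {L : List ℝ} {g h : ℝ} (ρ : ℕ → ℝ),
    (∀ x ∈ M, 0 ≤ x) → M.sum ≤ min g h → min g h < M.sum + p →
    run (M ++ p :: L) g h ρ = (List.replicate M.length false ++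
      decide (ρ 0 < accept p (h - M.sum)) ::
        (run L (-Real.log (ρ 1) / 2) (1 / 2) fun n => ρ (n + 2)).1,
      (run L (-Real.log (ρ 1) / 2) (1 / 2) fun n => ρ (n + 2)).2 + 1)
  | [], p, L, g, h, ρ, _, _, h2 => by
    rw [List.sum_nil, zero_add] at h2
    rw [List.nil_append, run, if_neg]
    · simp
    · rintro ⟨h3, h4⟩
      exact absurd (le_min h3 h4) (not_le.2 h2)
  | x :: M, p, L, g, h, ρ, hM, h1, h2 => by
    rw [List.sum_cons] at h1 h2
    have h0 : 0 ≤ M.sum := List.sum_nonneg fun y hy => hM y (List.mem_cons_of_mem _ hy)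
    have h3 := le_min_iff.1 h1
    rw [List.cons_append, run, if_pos ⟨by linarith, by linarith⟩,
      run_of_lt ρ (fun y hy => hM y (List.mem_cons_of_mem _ hy))
        (by rw [min_sub_sub_right]; linarith) (by rw [min_sub_sub_right]; linarith)]
    simp only [List.length_cons, List.replicate_succ, List.cons_append, List.sum_cons, sub_sub]
    congr!

/-- The elements that have been marked. -/
def select {β : Type*} : List β → List Bool → List β
  | a :: l, b :: bs => if b then a :: select l bs else select l bs
  | _, _ => []

theorem select_replicate_append {β : Type*} (l' : List β) (bs : List Bool) : ∀ l : List β,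
    select (l ++ l') (List.replicate l.length false ++ bs) = select l' bs
  | [] => by simp
  | a :: l => by simp [List.replicate_succ, select, select_replicate_append l' bs l]

theorem select_replicate {β : Type*} (l : List β) : select l (List.replicate l.length false) = [] := by
  simpa [select] using select_replicate_append (β := β) [] [] l

end SkipSampling

/-- Weights are nonnegative, so a position behind the intervals of `L₁` cannot lie in the interval
of an element of `L₁`. -/
theorem Located.exists_eq_append {β : Type*} {L₁ L₂ : List β} {w : β → ℝ} {y s : ℝ} {b : β}
    (h : Located (L₁ ++ L₂) w y b s) (hw : ∀ b, 0 ≤ w b) (hy : (L₁.map w).sum ≤ y) :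
    ∃ M₁ M₂, L₂ = M₁ ++ b :: M₂ ∧ s = (L₁.map w).sum + (M₁.map w).sum ∧ s ≤ y ∧ y < s + w b := by
  obtain ⟨l₁, l₂, h1, h2, h3, h4⟩ := h
  rcases List.append_eq_append_iff.1 h1 with ⟨M, h5, h6⟩ | ⟨M, h5, h6⟩
  · exact ⟨M, l₂, h6, by rw [h2, h5]; simp, h3, h4⟩
  · cases M with
    | nil =>
      rw [List.append_nil] at h5
      exact ⟨[], l₂, by simpa using h6.symm, by rw [h2, h5]; simp, h3, h4⟩
    | cons a M =>
      rw [List.cons_append, List.cons.injEq] at h6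
      obtain ⟨rfl, -⟩ := h6
      exfalso
      have h7 : 0 ≤ (M.map w).sum := List.sum_nonneg fun x hx => by
        obtain ⟨g, -, rfl⟩ := List.mem_map.1 hx
        exact hw g
      rw [h5, List.map_append, List.sum_append, List.map_cons, List.sum_cons, ← h2] at hy
      linarith

/-- The tuple over all attributes that is composed of the tuples of an assignment. -/
noncomputable def JoinSchema.assemble {m k : ℕ} (Q : JoinSchema m k) (val : ℕ → ℕ → ℝ)
    (f : Fin k → ℕ) : Fin m → ℝ := fun a => val (f (Q.covers a).choose) a

/-- The address of the output. -/
def JoinData.out {m k : ℕ} (D : JoinData m k) : ℕ := D.cell 0 (D.off k + k + 1)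

/-! ### The query program. -/

namespace Layout

open JoinSchema SkipSampling

variable {m k : ℕ} {D : JoinData m k} {s : RamState}

theorem _root_.JoinData.HasInput.of_lt_out {s' : RamState} (h : D.HasInput s)
    (hm : ∀ a < D.out, s'.mem a = s.mem a) : D.HasInput s' :=
  h.of_below fun a ha => hm a (ha.trans_le (D.base_le_cell _ _))

/-- The output area begins behind everything that the index uses, so the index survives any number
of queries. -/
theorem IsStored.of_lt_out {T : TupleLists m k} {r : Fin k} {es : List (Fin k × Fin k)} {w : ℕ → ℝ}
    {s' : RamState} (hperm : ∀ j : Fin k, (T.tup j).Perm (List.range' (D.off j) (D.sz j)))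
    (h : IsStored D T r es w s) (hm : ∀ a < D.out, s'.mem a = s.mem a) :
    IsStored D T r es w s' := by
  have hcell : ∀ (j : Fin k) (t α : ℕ), t ≤ (T.tup j).length → α < 4 →
      D.cell α (D.off j + j + t) < D.out ∧ D.cell α (D.off j + t) < D.out := by
    intro j t α ht hα
    have hlen : (T.tup j).length = D.sz j := by simpa using (hperm j).length_eq
    have := D.off_add_sz_le j.2
    have := j.2
    unfold JoinData.out JoinData.cell
    omega
  have h1 : ∀ j : Fin k, HasList D j (T.tup j) s → HasList D j (T.tup j) s' := fun j h t ht => by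
    rw [hm _ (hcell j t 0 ht.le (by norm_num)).2, h t ht]
  have h2 : ∀ j : Fin k, HasPrefix D j (T.tup j) w s → HasPrefix D j (T.tup j) w s' :=
    fun j h t ht => by rw [hm _ (hcell j t 2 ht (by norm_num)).1, h t ht]
  exact ⟨h1 r h.list_root, h2 r h.prefix_root, h.sorted, fun e he => h1 _ (h.list_fst e he),
    fun e he => h2 _ (h.prefix_fst e he)⟩

/-- The address of the output. -/
def outE (m k : ℕ) : RamExpr := cellE m k 0 (.add (offE k) (.lit (k + 1 : ℕ)))

theorem eval_outE (hs : D.HasInput s) : (outE m k).eval s = D.out := by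
  simp [outE, cellE, eval_offE hs le_rfl, JoinData.out, JoinData.cell, JoinData.base]
  ring

/-- Write a join result to the output. -/
noncomputable def emit (Q : JoinSchema m k) : List (Fin m) → RamProg
  | [] => .skip
  | a :: as => .seq (.store (.add (.add (.reg 0) (.mul (.reg 1) (.lit m))) (.lit (a : ℕ)))
      (recE m k (.reg ((Q.covers a).choose + 100)) a)) (emit Q as)

theorem loopFree_emit (Q : JoinSchema m k) : ∀ as : List (Fin m), (emit Q as).LoopFree
  | [] => trivial
  | _ :: as => ⟨trivial, loopFree_emit Q as⟩

theorem den_emit (Q : JoinSchema m k) {f : Fin k → ℕ} {c : ℕ} (hf : ∀ j, f j < D.off k) :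
    ∀ (as : List (Fin m)) {s : RamState}, D.HasInput s → s.reg 0 = D.out → s.reg 1 = c →
      (∀ j : Fin k, s.reg (j + 100) = f j) →
      ((emit Q as).den s).reg = s.reg ∧ ((emit Q as).den s).rnd = s.rnd ∧
      (∀ b, (∀ a ∈ as, b ≠ D.out + c * m + a) → ((emit Q as).den s).mem b = s.mem b) ∧
      ∀ a ∈ as, ((emit Q as).den s).mem (D.out + c * m + a) = Q.assemble D.val f a
  | [], s, _, _, _, _ => ⟨rfl, rfl, fun _ _ => rfl, by simp⟩
  | a :: as, s, hs, h0, h1, hid => by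
    have e1 : ⌊RamExpr.eval s (.add (.add (.reg 0) (.mul (.reg 1) (.lit m))) (.lit (a : ℕ)))⌋₊ =
        D.out + c * m + a := by
      have : RamExpr.eval s (.add (.add (.reg 0) (.mul (.reg 1) (.lit m))) (.lit (a : ℕ))) =
          ((D.out + c * m + a : ℕ) : ℝ) := by simp [h0, h1]
      rw [this, Nat.floor_natCast]
    have e2 := eval_recE hs (e := .reg ((Q.covers a).choose + 100)) (hid _) (hf _) a.2.le
    set s' := s.setMem (D.out + c * m + a) (Q.assemble D.val f a) with hs'
    have hout : D.base ≤ D.out := D.base_le_cell _ _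
    have hs'in : D.HasInput s' := hs.of_below fun b hb => by
      rw [hs', RamState.mem_setMem, if_neg (by omega)]
    obtain ⟨h2, h3, h4, h5⟩ := den_emit Q hf as hs'in h0 h1 hid
    have hden : (emit Q (a :: as)).den s = (emit Q as).den s' := by
      rw [emit, RamProg.den_seq, RamProg.den_store, e1, e2]
      rfl
    rw [hden]
    refine ⟨h2, h3, fun b hb => ?_, fun a' ha' => ?_⟩
    · rw [h4 b fun a' ha' => hb a' (List.mem_cons_of_mem _ ha'), hs', RamState.mem_setMem,
        if_neg (hb a List.mem_cons_self)]
    · by_cases h : a' ∈ as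
      · exact h5 a' h
      · obtain rfl := (List.mem_cons.1 ha').resolve_right h
        rw [h4 _ fun b hb hab => h ?_, hs', RamState.mem_setMem, if_pos rfl]
        obtain rfl : a' = b := Fin.ext (by omega)
        exact hb

/-- The next random skip: register `6` becomes the end of a skip that starts at register `5`. -/
def skipStep : RamProg :=
  .seq (.rand 7) (.seq (.assign 7 (.div (.log (.reg 7)) (.lit (-2))))
    (.ite (.lt (.reg 7) (.lit (1 / 2))) (.assign 6 (.add (.reg 5) (.reg 7)))
      (.assign 6 (.add (.reg 5) (.lit (1 / 2))))))

theorem den_skipStep (s : RamState) :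
    (skipStep.den s).mem = s.mem ∧ (skipStep.den s).rnd = (fun n => s.rnd (n + 1)) ∧
    (skipStep.den s).reg 6 = s.reg 5 + min (-Real.log (s.rnd 0) / 2) (1 / 2) ∧
    ∀ x, x ≠ 6 → x ≠ 7 → (skipStep.den s).reg x = s.reg x := by
  set g := -Real.log (s.rnd 0) / 2 with hg
  set s' := (s.dropRnd.setReg 7 (s.rnd 0)).setReg 7 g with hs'
  have e1 : RamExpr.eval (s.dropRnd.setReg 7 (s.rnd 0)) (.div (.log (.reg 7)) (.lit (-2))) = g := by
    simp [hg, div_neg, neg_div]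
  have hden : skipStep.den s = RamProg.den (.ite (.lt (.reg 7) (.lit (1 / 2)))
      (.assign 6 (.add (.reg 5) (.reg 7))) (.assign 6 (.add (.reg 5) (.lit (1 / 2))))) s' := by
    rw [skipStep, RamProg.den_seq, RamProg.den_rand, RamProg.den_seq, RamProg.den_assign, e1]
  rw [hden]
  have h7 : s'.reg 7 = g := by simp [hs']
  have h5 : s'.reg 5 = s.reg 5 := by simp [hs']
  have hx : ∀ x, x ≠ 7 → s'.reg x = s.reg x := fun x hx => by simp [hs', hx]
  by_cases h : g < 1 / 2
  · rw [RamProg.den_ite_pos (by simpa [h7] using h), RamProg.den_assign]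
    refine ⟨rfl, rfl, ?_, fun x h6 h7 => ?_⟩
    · rw [min_eq_left h.le]; simp [h7, h5]
    · rw [RamState.reg_setReg, if_neg h6, hx x h7]
  · rw [RamProg.den_ite_neg (by simpa [h7] using h), RamProg.den_assign]
    refine ⟨rfl, rfl, ?_, fun x h6 h7 => ?_⟩
    · rw [min_eq_right (not_lt.1 h)]; simp [h5]
    · rw [RamState.reg_setReg, if_neg h6, hx x h7]

/-- Decide whether the located join result is included, and proceed to the next skip. -/
noncomputable def decideStep (Q : JoinSchema m k) : RamProg :=
  .seq (.rand 7)
  (.seq (.ite (.lt (.add (.reg 5) (.lit (1 / 2))) (.add (.reg 8) (.reg 9))) (.assign 24 (.reg 9))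
    (.assign 24 (.div (.reg 9) (.sub (.lit 1) (.exp (.mul (.lit (-2)) (.reg 9)))))))
  (.seq (.ite (.lt (.reg 7) (.reg 24))
    (.seq (emit Q (List.finRange m)) (.assign 1 (.add (.reg 1) (.lit 1)))) .skip)
  (.seq (.assign 5 (.add (.reg 8) (.reg 9))) skipStep)))

/-- The output written so far. -/
def HasOutput (D : JoinData m k) (O : List (Fin m → ℝ)) (s : RamState) : Prop :=
  s.reg 0 = D.out ∧ s.reg 1 = O.length ∧
    ∀ i (h : i < O.length), ∀ a : Fin m, s.mem (D.out + i * m + a) = O[i] a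

theorem HasOutput.outputList {O : List (Fin m → ℝ)} (h : HasOutput D O s) : s.outputList m = O := by
  obtain ⟨h0, h1, h2⟩ := h
  rw [RamState.outputList, h0, h1, Nat.floor_natCast, Nat.floor_natCast]
  refine List.ext_getElem (by simp) fun i hi hi' => ?_
  rw [List.getElem_map, List.getElem_range]
  exact funext fun a => h2 i hi' a

/-- The cap lies at `s.reg 5 + 1 / 2`, at distance `s.reg 5 + 1 / 2 - s.reg 8` from the start of the
located element, so the program's test is the case distinction of `accept`. The two random numbers,
coin and next skip, are used in the same order as in `run`. -/
theorem den_decideStep (Q : JoinSchema m k) {f : Fin k → ℕ} {O : List (Fin m → ℝ)}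
    (hf : ∀ j, f j < D.off k) (hs : D.HasInput s) (hid : ∀ j : Fin k, s.reg (j + 100) = f j)
    (hO : HasOutput D O s) :
    (∀ a < D.out, ((decideStep Q).den s).mem a = s.mem a) ∧
    ((decideStep Q).den s).rnd = (fun n => s.rnd (n + 2)) ∧
    ((decideStep Q).den s).reg 5 = s.reg 8 + s.reg 9 ∧
    ((decideStep Q).den s).reg 6 =
      s.reg 8 + s.reg 9 + min (-Real.log (s.rnd 1) / 2) (1 / 2) ∧
    HasOutput D (O ++ if s.rnd 0 < accept (s.reg 9) (s.reg 5 + 1 / 2 - s.reg 8) then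
      [Q.assemble D.val f] else []) ((decideStep Q).den s) := by
  set p := accept (s.reg 9) (s.reg 5 + 1 / 2 - s.reg 8) with hp
  set s₁ := s.dropRnd.setReg 7 (s.rnd 0) with hs₁
  set s₂ := s₁.setReg 24 p with hs₂
  have h2 : RamProg.den (.ite (.lt (.add (.reg 5) (.lit (1 / 2))) (.add (.reg 8) (.reg 9)))
      (.assign 24 (.reg 9))
      (.assign 24 (.div (.reg 9) (.sub (.lit 1) (.exp (.mul (.lit (-2)) (.reg 9))))))) s₁ = s₂ := by
    by_cases h : s.reg 5 + 1 / 2 - s.reg 8 < s.reg 9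
    · rw [RamProg.den_ite_pos (by simp [hs₁]; linarith), RamProg.den_assign, hs₂, hp, accept, if_pos h]
      simp [hs₁]
    · rw [RamProg.den_ite_neg (by simp [hs₁]; linarith), RamProg.den_assign, hs₂, hp, accept, if_neg h]
      simp [hs₁]
  set O' := O ++ if s.rnd 0 < p then [Q.assemble D.val f] else [] with hO'
  obtain ⟨s₃, hs₃, hm₃, hr₃, hreg₃, hO₃⟩ : ∃ s₃, RamProg.den (.ite (.lt (.reg 7) (.reg 24))
      (.seq (emit Q (List.finRange m)) (.assign 1 (.add (.reg 1) (.lit 1)))) .skip) s₂ = s₃ ∧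
      (∀ a < D.out, s₃.mem a = s.mem a) ∧ s₃.rnd = (fun n => s.rnd (n + 1)) ∧
      (∀ x, x = 8 ∨ x = 9 → s₃.reg x = s.reg x) ∧ HasOutput D O' s₃ := by
    have hid₂ : ∀ j : Fin k, s₂.reg (j + 100) = f j := fun j => by
      rw [← hid j]
      simp only [hs₂, hs₁, RamState.reg_setReg, RamState.reg_dropRnd]
      rw [if_neg (by omega), if_neg (by omega)]
    obtain ⟨h0, h1, hOm⟩ := hO
    have h0₂ : s₂.reg 0 = D.out := by simp [hs₂, hs₁, h0]
    have h1₂ : s₂.reg 1 = O.length := by simp [hs₂, hs₁, h1]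
    by_cases h : s.rnd 0 < p
    · obtain ⟨g1, g2, g3, g4⟩ := den_emit (D := D) Q hf (List.finRange m) (s := s₂) hs h0₂ h1₂ hid₂
      refine ⟨_, RamProg.den_ite_pos (by simp [hs₂, hs₁, h]), fun a ha => ?_, ?_, ?_, ?_⟩
      · rw [RamProg.den_seq, RamProg.den_assign, RamState.mem_setReg, g3 a fun b _ => by omega]
        rfl
      · rw [RamProg.den_seq, RamProg.den_assign, RamState.rnd_setReg, g2]
        rfl
      · rintro x hx
        rw [RamProg.den_seq, RamProg.den_assign, RamState.reg_setReg, g1, if_neg (by omega)]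
        rcases hx with rfl | rfl <;> simp [hs₂, hs₁]
      · rw [hO', if_pos h]
        refine ⟨by simp [g1, h0₂], by simp [g1, h1₂], fun i hi a => ?_⟩
        rw [RamProg.den_seq, RamProg.den_assign, RamState.mem_setReg]
        rw [List.length_append, List.length_singleton] at hi
        by_cases hiO : i < O.length
        · rw [g3, List.getElem_append_left hiO]
          · exact hOm i hiO a
          · intro b _
            have := Nat.mul_le_mul_right m (Nat.succ_le_of_lt hiO)
            rw [Nat.succ_mul] at this
            have := a.2
            omega
        · obtain rfl : i = O.length := by omega
          rw [g4 a (List.mem_finRange a)]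
          simp
    · refine ⟨_, RamProg.den_ite_neg (by simpa [hs₂, hs₁] using h), fun a _ => rfl, rfl, ?_, ?_⟩
      · rintro x (rfl | rfl) <;> simp [RamProg.den, hs₂, hs₁]
      · rw [hO', if_neg h, List.append_nil]
        exact ⟨h0₂, h1₂, hOm⟩
  set s₄ := s₃.setReg 5 (s.reg 8 + s.reg 9) with hs₄
  have hden : (decideStep Q).den s = skipStep.den s₄ := by
    have e : RamExpr.eval s₃ (.add (.reg 8) (.reg 9)) = s.reg 8 + s.reg 9 := by
      simp [hreg₃ 8, hreg₃ 9]
    simp only [decideStep, RamProg.den_seq, RamProg.den_rand, ← hs₁, h2, hs₃, RamProg.den_assign, e,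
      ← hs₄]
  obtain ⟨q1, q2, q3, q4⟩ := den_skipStep s₄
  rw [hden]
  refine ⟨fun a ha => ?_, ?_, ?_, ?_, ?_, ?_, fun i hi a => ?_⟩
  · rw [q1]; exact hm₃ a ha
  · rw [q2]; simp [hs₄, hr₃]
  · rw [q4 5 (by norm_num) (by norm_num)]; simp [hs₄]
  · rw [q3]; simp [hs₄, hr₃]
  · rw [q4 0 (by norm_num) (by norm_num)]; simp [hs₄, hO₃.1]
  · rw [q4 1 (by norm_num) (by norm_num)]; simp [hs₄, hO₃.2.1]
  · rw [q1]; exact hO₃.2.2 i hi a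

/-- The query algorithm. -/
noncomputable def query (Q : JoinSchema m k) (r : Fin k) (es : List (Fin k × Fin k)) : RamProg :=
  .seq (.seq (.assign 0 (outE m k)) (.seq (.assign 1 (.lit 0)) (.seq (.assign 5 (.lit 0)) skipStep)))
    (.loop (.lt (.reg 6) (preE m k r (szE r))) (.seq (locate Q r es) (decideStep Q)))

theorem loopFree_skipStep : skipStep.LoopFree := by simp [skipStep]

theorem loopFree_decideStep (Q : JoinSchema m k) : (decideStep Q).LoopFree := by
  simp [decideStep, loopFree_emit, loopFree_skipStep]

theorem neg_log_half_nonneg {x : ℝ} (hx : x ∈ Set.Icc (0 : ℝ) 1) : 0 ≤ -Real.log x / 2 := by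
  have := Real.log_nonpos hx.1 hx.2
  linarith

/-- Loop invariant: the results split as `L₁ ++ L₂` with `L₁` decided, register `5` is the end of
the intervals of `L₁`, and `run` on `L₂` with the unused random numbers yields what is missing from
the output. The number of hits still to come is the number of iterations still to come. -/
theorem runs_query (Q : JoinSchema m k) (r : Fin k) (es : List (Fin k × Fin k))
    (hes : Q.IsJoinOrder r es) (hall : ∀ j, j ∈ nodes r es) :
    ∃ K, ∀ (D : JoinData m k) (T : TupleLists m k) (s : RamState) (d : ℕ) (w : ℕ → ℝ),
      T.attrs = Q → T.val = D.val →
      (∀ j : Fin k, (T.tup j).Perm (List.range' (D.off j) (D.sz j))) → D.HasInput s →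
      D.off k < 2 ^ d → (∀ g, 0 ≤ w g) → IsStored D T r es (T.finalWeights w es) s →
      (∀ n, s.rnd n ∈ Set.Icc (0 : ℝ) 1) → ∀ R, R = run ((T.results r es).map
        (TupleLists.weight w r es)) (-Real.log (s.rnd 0) / 2) (1 / 2) (fun n => s.rnd (n + 1)) →
      Runs (query Q r es) s (K * (1 + (d + 1) * R.2)) fun s' => (∀ a < D.out, s'.mem a = s.mem a) ∧
        s'.outputList m = (select (T.results r es) R.1).map (Q.assemble D.val) := by
  obtain ⟨K, hK⟩ := runs_locate Q r es hes
  set c₁ : RamProg := .seq (.assign 0 (outE m k))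
    (.seq (.assign 1 (.lit 0)) (.seq (.assign 5 (.lit 0)) skipStep)) with hc₁
  have hc₁f : c₁.LoopFree := by simp [hc₁, loopFree_skipStep]
  set B : RamTest := .lt (.reg 6) (preE m k r (szE r)) with hB
  refine ⟨c₁.scost + 2 * B.cost + 2 + K + (decideStep Q).scost,
    fun D T s d w hQ hval hperm hs hd hw hst hrnd R hR => ?_⟩
  have hes' : T.attrs.IsJoinOrder r es := hQ ▸ hes
  have hlen : (T.tup r).length = D.sz r := by simpa using (hperm r).length_eq
  have hmem : ∀ j : Fin k, ∀ g, g ∈ T.tup j ↔ D.off j ≤ g ∧ g < D.off j + D.sz j := fun j g => by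
    rw [(hperm j).mem_iff, List.mem_range'_1]
  have hdisj : ∀ i j, i ≠ j → (T.tup i).Disjoint (T.tup j) := fun i j hij g hi hj =>
    D.disjoint_ranges (fun h => hij (Fin.ext h)) ((hmem i g).1 hi) ((hmem j g).1 hj)
  have hlN : ∀ j : Fin k, ∀ g ∈ T.tup j, g < D.off k := fun j g hg => by
    have := (hmem j g).1 hg
    have := D.off_add_sz_le j.2
    omega
  set L := T.results r es with hL
  set W := TupleLists.weight (k := k) w r es with hW
  have hW0 : ∀ f, 0 ≤ W f := fun f => List.prod_nonneg fun x hx => by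
    obtain ⟨j, -, rfl⟩ := List.mem_map.1 hx
    exact hw _
  have hWL : ∀ L : List (Fin k → ℕ), ∀ x ∈ L.map W, 0 ≤ x := fun L x hx => by
    obtain ⟨j, -, rfl⟩ := List.mem_map.1 hx
    exact hW0 _
  have hsum := TupleLists.sum_weight hdisj w hes'
  set final := (select L R.1).map (Q.assemble D.val) with hfinal
  set Inv : ℕ → RamState → Prop := fun n s' => (∀ a < D.out, s'.mem a = s.mem a) ∧
    (∀ n, s'.rnd n ∈ Set.Icc (0 : ℝ) 1) ∧ ∃ L₁ L₂ O g, L = L₁ ++ L₂ ∧ 0 ≤ g ∧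
      s'.reg 5 = (L₁.map W).sum ∧ s'.reg 6 = s'.reg 5 + min g (1 / 2) ∧ HasOutput D O s' ∧
      n = (run (L₂.map W) g (1 / 2) s'.rnd).2 ∧
      final = O ++ (select L₂ (run (L₂.map W) g (1 / 2) s'.rnd).1).map (Q.assemble D.val) with hInv
  have hloop := Runs.loop (b := B) (c := .seq (locate Q r es) (decideStep Q))
    (t := K * (d + 1) + (decideStep Q).scost) (Inv := Inv)
    (R := fun s' => (∀ a < D.out, s'.mem a = s.mem a) ∧ s'.outputList m = final) (by
      rintro n s' ⟨hm, hrnd', L₁, L₂, O, g, hL12, hg, h5, h6, hO, hn, hfin⟩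
      have hs' := hs.of_lt_out hm
      have hst' := hst.of_lt_out hperm hm
      have eB := eval_preE hs' r.2.le hst'.prefix_root (e := szE r) (eval_szE hs' r.2) hlen.ge
      rw [← hlen, List.take_length, ← hsum, ← hL, ← hW, hL12, List.map_append, List.sum_append] at eB
      have hmin0 : 0 ≤ min g (1 / 2) := le_min hg (by norm_num)
      -- The truncated skip ends below the total weight exactly when another element is hit; the
      -- machine reads the total weight from the last prefix sum of the root.
      by_cases hlt : min g (1 / 2) < (L₂.map W).sum
      · right
        refine ⟨?_, ?_⟩
        · rw [hB, RamTest.holds, eB, RamExpr.eval, h6, h5]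
          linarith
        have h50 : 0 ≤ (L₁.map W).sum := List.sum_nonneg (hWL L₁)
        refine (hK D T s' d w hQ hval hperm hs' hd hw hst' (by rw [h6, h5]; linarith) (by
          rw [← hsum, ← hL, ← hW, hL12, List.map_append, List.sum_append, h6, h5]
          linarith)).seq' ?_
        rintro s₁ ⟨hf₁, f, hloc, h9, hids⟩
        rw [← hL, hL12, ← hW] at hloc
        obtain ⟨M₁, M₂, rfl, h8, h8le, h8lt⟩ :=
          hloc.exists_eq_append hW0 (by rw [h6, h5]; linarith)
        have hs₁ := hs'.of_mem_eq hf₁.1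
        have hfN : ∀ j, f j < D.off k := fun j => by
          have hfL : f ∈ T.results r es := by rw [← hL, hL12]; simp
          exact hlN j _ (((TupleLists.mem_results hes').1 hfL).1 j (hall j))
        have hO₁ : HasOutput D O s₁ := by
          refine ⟨?_, ?_, fun i hi a => ?_⟩
          · rw [hf₁.2.2 0 (by simp [LocateRegs]), hO.1]
          · rw [hf₁.2.2 1 (by simp [LocateRegs]), hO.2.1]
          · rw [hf₁.1, hO.2.2 i hi a]
        obtain ⟨q1, q2, q3, q4, q5⟩ := den_decideStep Q hfN hs₁ (fun j => hids j (hall j)) hO₁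
        have h5₁ : s₁.reg 5 = (L₁.map W).sum := by rw [hf₁.2.2 5 (by simp [LocateRegs]), h5]
        rw [h6, h5] at h8le h8lt
        have hrun := run_of_lt (M := M₁.map W) (p := W f) (L := M₂.map W) (g := g) (h := 1 / 2)
          s'.rnd (hWL M₁) (by linarith) (by linarith)
        rw [List.map_append, List.map_cons, hrun] at hn hfin
        rw [hf₁.2.1] at q2 q4 q5
        rw [h9, h8, h5₁, ← hW] at q5
        rw [h9, h8, ← hW] at q3 q4
        rw [show (L₁.map W).sum + 1 / 2 - ((L₁.map W).sum + (M₁.map W).sum) =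
          1 / 2 - (M₁.map W).sum by ring] at q5
        refine RamProg.LoopFree.runs (loopFree_decideStep Q) s₁ ⟨n - 1, by omega,
          fun a ha => by rw [q1 a ha, hf₁.1, hm a ha], fun n => by rw [q2]; exact hrnd' _,
          L₁ ++ (M₁ ++ [f]), M₂, _, -Real.log (s'.rnd 1) / 2, by rw [hL12]; simp,
          neg_log_half_nonneg (hrnd' 1), by rw [q3]; simp [add_assoc], by rw [q4, q3], q5, ?_, ?_⟩
        · rw [q2, hn]; simp
        · rw [hfin, q2, List.length_map, select_replicate_append, select]
          by_cases hacc : s'.rnd 0 < accept (W f) (1 / 2 - (M₁.map W).sum)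
          · rw [if_pos hacc, if_pos (decide_eq_true hacc)]; simp
          · rw [if_neg hacc, if_neg (by rw [decide_eq_true_eq]; exact hacc)]; simp
      · left
        have hle := not_lt.1 hlt
        refine ⟨?_, hm, ?_⟩
        · rw [hB, RamTest.holds, eB, RamExpr.eval, h6, h5]
          linarith
        -- Both the skip and the cap pass the end of the list, so the remaining elements are all
        -- rejected.
        · rw [run_of_sum_le _ (hWL L₂) (hle.trans (min_le_left _ _))
            (hle.trans (min_le_right _ _)), List.length_map, select_replicate] at hfin
          rw [hO.outputList, hfin]
          simp)
  have h1 : Runs c₁ s c₁.scost fun s' => Inv R.2 s' := by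
    refine RamProg.LoopFree.runs hc₁f s ?_
    set s₁ := ((s.setReg 0 D.out).setReg 1 0).setReg 5 0 with hs₁
    have hden : c₁.den s = skipStep.den s₁ := by
      simp only [hc₁, RamProg.den_seq, RamProg.den_assign, eval_outE hs, hs₁]
      simp
    obtain ⟨q1, q2, q3, q4⟩ := den_skipStep s₁
    rw [hden]
    have hr₁ : s₁.rnd = s.rnd := rfl
    have h5 : s₁.reg 5 = 0 := by simp [hs₁]
    refine ⟨fun a _ => by rw [q1]; rfl, fun n => by rw [q2]; exact hrnd _, [], L, [],
      -Real.log (s.rnd 0) / 2, rfl, neg_log_half_nonneg (hrnd 0), ?_, ?_, ⟨?_, ?_, by simp⟩, ?_, ?_⟩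
    · rw [q4 5 (by norm_num) (by norm_num), h5]; simp
    · rw [q3, q4 5 (by norm_num) (by norm_num), hr₁]
    · rw [q4 0 (by norm_num) (by norm_num)]; simp [hs₁]
    · rw [q4 1 (by norm_num) (by norm_num)]; simp [hs₁]
    · rw [q2, hR]; rfl
    · rw [q2, hfinal, hR]; rfl
  refine (h1.seq' fun s' h => hloop _ s' h).mono ?_ fun _ h => h
  set X := R.2
  set G := (decideStep Q).scost
  set b := B.cost
  have h3 : (b + 1 + (K * (d + 1) + G)) ≤ (b + 1 + K + G) * (d + 1) := by
    have := Nat.le_mul_of_pos_right (b + 1 + G) (show 0 < d + 1 by omega)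
    nlinarith
  have h4 := Nat.mul_le_mul_left X h3
  nlinarith [Nat.zero_le (X * (d + 1)), Nat.zero_le (c₁.scost * ((d + 1) * X)),
    Nat.zero_le (b * ((d + 1) * X))]

end Layout

/-! ### Decoding the input words. -/

theorem List.getElem?_flatten_add {α : Type*} {l : List α} {t : ℕ} (ht : t < l.length) :
    ∀ {L : List (List α)} {j : ℕ}, L[j]? = some l →
      L.flatten[((L.take j).map List.length).sum + t]? = l[t]?
  | [], j, h => by simp at h
  | l' :: L, 0, h => by
    obtain rfl : l' = l := by simpa using h
    simp [List.getElem?_append_left ht]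
  | l' :: L, j + 1, h => by
    rw [List.flatten_cons, List.take_succ_cons, List.map_cons, List.sum_cons, add_assoc,
      List.getElem?_append_right (by omega), Nat.add_sub_cancel_left]
    exact getElem?_flatten_add ht (by simpa using h)

theorem JoinData.exists_off_le {m k : ℕ} (D : JoinData m k) {g : ℕ} : ∀ {n : ℕ}, g < D.off n →
    ∃ j < n, D.off j ≤ g ∧ g < D.off j + D.sz j
  | 0, h => by simp [off] at h
  | n + 1, h => by
    rw [D.off_succ] at h
    by_cases hg : g < D.off n
    · obtain ⟨j, hj, h'⟩ := exists_off_le D hg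
      exact ⟨j, by omega, h'⟩
    · exact ⟨n, by omega, not_lt.1 hg, h⟩

namespace JoinInstance

variable {m k : ℕ} {Q : JoinSchema m k} (I : JoinInstance Q) (ord : I.Listing)

theorem Listing.length_tuples (j : Fin k) : (ord.tuples j).length = (I.rel j).card := by
  classical
  rw [← List.toFinset_card_of_nodup (ord.nodup j)]
  congr 1
  ext t
  rw [List.mem_toFinset, ord.mem_iff]

/-- The records of all tuples. -/
noncomputable def records : List (List ℝ) :=
  (List.ofFn fun j => (ord.tuples j).map (I.record j)).flatten

theorem inputWords_eq : I.inputWords ord =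
    (List.ofFn fun j : Fin k => ((I.rel j).card : ℝ)) ++ (I.records ord).flatten := by
  rw [inputWords, records, List.flatten_flatten, List.map_ofFn]
  rfl

theorem length_of_mem_records {l : List ℝ} (h : l ∈ I.records ord) : l.length = m + 1 := by
  simp only [records, List.mem_flatten, List.mem_ofFn] at h
  obtain ⟨_, ⟨j, rfl⟩, h⟩ := h
  obtain ⟨t, -, rfl⟩ := List.mem_map.1 h
  simp [record]

/-- The contents of the input. -/
noncomputable def data : JoinData m k where
  sz j := if h : j < k then (I.rel ⟨j, h⟩).card else 0
  val g a := (I.inputWords ord).getD (k + (m + 1) * g + a) 0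

theorem data_sz (j : Fin k) : (I.data ord).sz j = (I.rel j).card := by simp [data]

theorem data_off {j : ℕ} (hj : j ≤ k) : (I.data ord).off j =
    (((List.ofFn fun j => (ord.tuples j).map (I.record j)).take j).map List.length).sum := by
  induction j with
  | zero => simp [JoinData.off]
  | succ j ih =>
    rw [JoinData.off_succ, ih (by omega), List.map_take, List.map_take,
      List.sum_take_succ _ _ (by simpa using hj)]
    simp [I.data_sz ord ⟨j, hj⟩, ord.length_tuples]

theorem data_off_self : (I.data ord).off k = I.size := by
  rw [JoinData.off, size, Finset.sum_range]
  exact Finset.sum_congr rfl fun j _ => I.data_sz ord j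

theorem length_records : (I.records ord).length = (I.data ord).off k := by
  rw [data_off _ _ le_rfl, records, List.length_flatten, List.take_of_length_le (by simp)]

theorem length_inputWords : (I.inputWords ord).length = (I.data ord).base := by
  have h : ∀ L : List (List ℝ), (∀ l ∈ L, l.length = m + 1) →
      (L.map List.length).sum = (m + 1) * L.length := fun L hL => by
    rw [List.map_congr_left hL]
    simp [mul_comm]
  rw [inputWords_eq, List.length_append, List.length_ofFn, List.length_flatten,
    h _ fun l hl => I.length_of_mem_records ord hl, length_records, JoinData.base]

/-- The words of the tuple with number `off j + t`. -/
theorem data_val {j : Fin k} {t a : ℕ} (ht : t < (ord.tuples j).length) (ha : a < m + 1) :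
    (I.data ord).val ((I.data ord).off j + t) a = (I.record j (ord.tuples j)[t]).getD a 0 := by
  set r := I.record j (ord.tuples j)[t] with hr
  -- The input is flattened twice: relations into records, then records into words. The first level
  -- is undone here, the second by `h2` and `h3`, where all records have `m + 1` words.
  have h1 : (I.records ord)[(I.data ord).off j + t]? = some r := by
    rw [data_off _ _ j.2.le, records,
      List.getElem?_flatten_add (l := (ord.tuples j).map (I.record j)) (by simpa using ht)]
    · simp [ht, hr]
    · simp
  have hmem : r ∈ I.records ord := List.mem_of_getElem? h1
  have hlen := I.length_of_mem_records ord hmem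
  have h2 := List.getElem?_flatten_add (t := a) (by omega) h1
  have h3 : (((I.records ord).take ((I.data ord).off j + t)).map List.length).sum =
      (m + 1) * ((I.data ord).off j + t) := by
    have h4 : ∀ l ∈ (I.records ord).take ((I.data ord).off j + t), l.length = m + 1 :=
      fun l hl => I.length_of_mem_records ord (List.mem_of_mem_take hl)
    have h5 := (List.getElem?_eq_some_iff.1 h1).1
    rw [List.map_congr_left h4]
    simp [h5.le, mul_comm]
  rw [h3] at h2
  change (I.inputWords ord).getD _ 0 = _
  rw [List.getD_eq_getElem?_getD, List.getD_eq_getElem?_getD, inputWords_eq,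
    List.getElem?_append_right (by simp; omega), List.length_ofFn, ← h2]
  congr 2
  omega

theorem hasInput_inputState : (I.data ord).HasInput (I.inputState ord) := by
  refine ⟨fun j hj => ?_, fun g _ a _ => rfl⟩
  change (I.inputWords ord).getD j 0 = _
  rw [List.getD_eq_getElem?_getD, inputWords_eq, List.getElem?_append_left (by simpa using hj)]
  simp [hj, I.data_sz ord ⟨j, hj⟩]

theorem inputState_mem_of_base_le {a : ℕ} (ha : (I.data ord).base ≤ a) :
    (I.inputState ord).mem a = 0 := by
  change (I.inputWords ord).getD a 0 = 0
  exact List.getD_eq_default _ _ (by rw [length_inputWords]; exact ha)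

/-- The tuple with a given number. -/
noncomputable def tupleOf (j : Fin k) (g : ℕ) : TupleOver (Q.attrs j) :=
  fun a => (I.data ord).val g (a : Fin m)

theorem tupleOf_off_add {j : Fin k} {t : ℕ} (ht : t < (ord.tuples j).length) :
    I.tupleOf ord j ((I.data ord).off j + t) = (ord.tuples j)[t] := by
  funext a
  rw [tupleOf, data_val _ _ ht (by omega), record, List.getD_eq_getElem?_getD,
    List.getElem?_append_left (by simp)]
  simp

theorem val_weight_off_add {j : Fin k} {t : ℕ} (ht : t < (ord.tuples j).length) :
    (I.data ord).val ((I.data ord).off j + t) m = I.wt j (ord.tuples j)[t] := by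
  rw [data_val _ _ ht (by omega), record, List.getD_eq_getElem?_getD,
    List.getElem?_append_right (by simp)]
  simp

/-- The number `g` belongs to a tuple of the `j`-th relation. -/
def InRange (j : Fin k) (g : ℕ) : Prop :=
  (I.data ord).off j ≤ g ∧ g < (I.data ord).off j + (I.data ord).sz j

variable {I ord}

theorem InRange.exists_eq {j : Fin k} {g : ℕ} (h : I.InRange ord j g) :
    ∃ t, t < (ord.tuples j).length ∧ g = (I.data ord).off j + t := by
  have := h.1
  have := h.2
  rw [data_sz] at this
  exact ⟨g - (I.data ord).off j, by rw [ord.length_tuples]; omega, by omega⟩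

theorem InRange.tupleOf_mem {j : Fin k} {g : ℕ} (h : I.InRange ord j g) :
    I.tupleOf ord j g ∈ I.rel j := by
  obtain ⟨t, ht, rfl⟩ := h.exists_eq
  rw [tupleOf_off_add _ _ ht, ← ord.mem_iff]
  exact List.getElem_mem ht

theorem InRange.val_weight {j : Fin k} {g : ℕ} (h : I.InRange ord j g) :
    (I.data ord).val g m = I.wt j (I.tupleOf ord j g) := by
  obtain ⟨t, ht, rfl⟩ := h.exists_eq
  rw [val_weight_off_add _ _ ht, tupleOf_off_add _ _ ht]

theorem InRange.eq_of_tupleOf_eq {j : Fin k} {g g' : ℕ} (h : I.InRange ord j g)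
    (h' : I.InRange ord j g') (heq : I.tupleOf ord j g = I.tupleOf ord j g') : g = g' := by
  obtain ⟨t, ht, rfl⟩ := h.exists_eq
  obtain ⟨t', ht', rfl⟩ := h'.exists_eq
  rw [tupleOf_off_add _ _ ht, tupleOf_off_add _ _ ht'] at heq
  rw [(ord.nodup j).getElem_inj_iff.1 heq]

theorem exists_inRange {j : Fin k} {t : TupleOver (Q.attrs j)} (h : t ∈ I.rel j) :
    ∃ g, I.InRange ord j g ∧ I.tupleOf ord j g = t := by
  obtain ⟨i, hi, rfl⟩ := List.mem_iff_getElem.1 ((ord.mem_iff j t).2 h)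
  refine ⟨(I.data ord).off j + i, ⟨by omega, ?_⟩, tupleOf_off_add _ _ hi⟩
  rw [data_sz, ← ord.length_tuples]
  omega

variable (I ord) in
theorem val_weight_nonneg (g : ℕ) : 0 ≤ (I.data ord).val g m := by
  by_cases hg : g < (I.data ord).off k
  · obtain ⟨j, hj, h⟩ := (I.data ord).exists_off_le hg
    have h : I.InRange ord ⟨j, hj⟩ g := h
    rw [h.val_weight]
    exact (I.wt_mem _ _ h.tupleOf_mem).1
  · refine le_of_eq (List.getD_eq_default _ _ ?_).symm
    rw [length_inputWords, JoinData.base]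
    have := Nat.mul_le_mul_left (m + 1) (not_lt.1 hg)
    omega

/-! ## The join results -/

section Results

open JoinSchema

variable {T : TupleLists m k} {r : Fin k} {es : List (Fin k × Fin k)} {f : Fin k → ℕ}

/-- Assembling reads each attribute from an arbitrarily chosen relation; the constituents of a join
result agree on shared attributes, so the choice does not matter. -/
theorem projTuple_assemble (hQ : T.attrs = Q) (hval : T.val = (I.data ord).val)
    (hes : Q.IsJoinOrder r es) (hall : ∀ j, j ∈ nodes r es) (hf : f ∈ T.results r es) (j : Fin k) :
    projTuple (Q.assemble (I.data ord).val f) (Q.attrs j) = I.tupleOf ord j (f j) := by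
  subst hQ
  funext a
  have h := ((TupleLists.mem_results hes).1 hf).2.2
  rw [projTuple, assemble, tupleOf, ← hval]
  exact h _ (hall _) j (hall j) a (T.attrs.covers a).choose_spec a.2

/-- Assembling is a bijection from assignments to join results. Every relation occurs exactly once
in the join order, so the product over the order is the product defining `prob`. -/
theorem map_assemble_results (hQ : T.attrs = Q) (hval : T.val = (I.data ord).val)
    (hperm : ∀ j : Fin k, (T.tup j).Perm (List.range' ((I.data ord).off j) ((I.data ord).sz j)))
    (hes : Q.IsJoinOrder r es) (hall : ∀ j, j ∈ nodes r es) :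
    ((T.results r es).map (Q.assemble (I.data ord).val)).Nodup ∧
    (∀ u, u ∈ (T.results r es).map (Q.assemble (I.data ord).val) ↔ u ∈ I.join) ∧
    (T.results r es).map (TupleLists.weight (fun g => (I.data ord).val g m) r es) =
      ((T.results r es).map (Q.assemble (I.data ord).val)).map I.prob := by
  have hproj : ∀ f ∈ T.results r es, ∀ j,
      projTuple (Q.assemble (I.data ord).val f) (Q.attrs j) = I.tupleOf ord j (f j) :=
    fun f hf j => projTuple_assemble hQ hval hes hall hf j
  have hes' : T.attrs.IsJoinOrder r es := hQ ▸ hes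
  have hmem : ∀ j g, g ∈ T.tup j ↔ I.InRange ord j g := fun j g => by
    rw [(hperm j).mem_iff, List.mem_range'_1, InRange]
  have hrange : ∀ f ∈ T.results r es, ∀ j, I.InRange ord j (f j) := fun f hf j =>
    (hmem j _).1 (((TupleLists.mem_results hes').1 hf).1 j (hall j))
  refine ⟨?_, fun u => ⟨fun hu => ?_, fun hu => ?_⟩, ?_⟩
  · refine (TupleLists.nodup_results (fun j => (hperm j).nodup_iff.2 List.nodup_range')
      hes').map_on fun f hf f' hf' h => funext fun j => ?_
    refine (hrange f hf j).eq_of_tupleOf_eq (hrange f' hf' j) ?_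
    rw [← hproj f hf, ← hproj f' hf', h]
  · obtain ⟨f, hf, rfl⟩ := List.mem_map.1 hu
    rw [I.mem_join]
    intro j
    rw [hproj f hf]
    exact (hrange f hf j).tupleOf_mem
  · rw [I.mem_join] at hu
    choose f h1 h2 using fun j => exists_inRange (ord := ord) (hu j)
    have h3 : ∀ (j : Fin k) (a : Fin m), a ∈ Q.attrs j → (I.data ord).val (f j) a = u a :=
      fun j a ha => congrFun (h2 j) ⟨a, ha⟩
    refine List.mem_map.2 ⟨f, (TupleLists.mem_results hes').2 ⟨fun j _ => (hmem j _).2 (h1 j),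
      fun j hj => absurd (hall j) hj, fun j _ j' _ a ha ha' => ?_⟩, funext fun a => ?_⟩
    · rw [hQ] at ha ha'
      rw [hval, h3 j a ha, h3 j' a ha']
    · exact h3 _ a (Q.covers a).choose_spec
  · rw [List.map_map]
    refine List.map_congr_left fun f hf => ?_
    have huniv : (nodes r es).toFinset = Finset.univ :=
      Finset.eq_univ_of_forall fun j => List.mem_toFinset.2 (hall j)
    rw [TupleLists.weight, ← List.prod_toFinset _ hes.nodup, huniv, Function.comp_apply, prob]
    exact Finset.prod_congr rfl fun j _ => by rw [hproj f hf, (hrange f hf j).val_weight]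

end Results

end JoinInstance

/-! ### The law of the sampled set. -/

namespace SkipSampling

/-- The sampling process, driven by a stream of uniform random numbers. -/
noncomputable def sample (L : List ℝ) (ρ : ℕ → ℝ) : List Bool × ℕ :=
  run L (-Real.log (ρ 0) / 2) (1 / 2) fun n => ρ (n + 1)

theorem measurable_sample (L : List ℝ) (φ : List Bool × ℕ → ENNReal) :
    Measurable fun ρ => φ (sample L ρ) := by
  have h : Measurable fun ρ : ℕ → ℝ => (ρ 0, fun n => ρ (n + 1)) :=
    (measurable_pi_apply 0).prodMk (measurable_pi_lambda _ fun n => measurable_pi_apply (n + 1))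
  exact (measurable_run_log L (1 / 2) φ).comp h

theorem lintegral_sample (L : List ℝ) (φ : List Bool × ℕ → ENNReal) :
    ∫⁻ ρ, φ (sample L ρ) ∂streamMeasure = mean L (1 / 2) φ :=
  lintegral_run L (1 / 2) φ

open Classical in
theorem measurableSet_sample (L : List ℝ) (P : List Bool × ℕ → Prop) :
    MeasurableSet {ρ | P (sample L ρ)} := by
  have h := measurable_sample L (fun r => if P r then 1 else 0) (measurableSet_singleton 1)
  refine (congrArg MeasurableSet (Set.ext fun ρ => ?_)).mp h
  simp

open Classical in
theorem measure_sample_fst {L : List ℝ} (hL : ∀ p ∈ L, 0 ≤ p ∧ p ≤ 1) (bs : List Bool) :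
    streamMeasure {ρ | (sample L ρ).1 = bs} = ENNReal.ofReal (tossProb L bs) := by
  rw [← mean_bits hL le_rfl, ← lintegral_sample,
    ← lintegral_indicator_one (measurableSet_sample L fun r => r.1 = bs)]
  refine lintegral_congr fun ρ => ?_
  simp [Set.indicator_apply]

theorem lintegral_sample_snd {L : List ℝ} (hL : ∀ p ∈ L, 0 ≤ p ∧ p ≤ 1) :
    ∫⁻ ρ, ((sample L ρ).2 : ENNReal) ∂streamMeasure ≤ ENNReal.ofReal (4 * L.sum) := by
  rw [lintegral_sample L fun r => (r.2 : ENNReal)]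
  simpa using mean_hits hL (h := 1 / 2) le_rfl

theorem length_run : ∀ (L : List ℝ) (g h : ℝ) (ρ : ℕ → ℝ), (run L g h ρ).1.length = L.length
  | [], _, _, _ => rfl
  | p :: L, g, h, ρ => by
    rw [run]
    split_ifs <;> simp [length_run L]

theorem select_map {β γ : Type*} (F : β → γ) : ∀ (l : List β) (bs : List Bool),
    select (l.map F) bs = (select l bs).map F
  | [], _ => by simp [select]
  | _ :: _, [] => by simp [select]
  | a :: l, b :: bs => by
    simp only [List.map_cons, select, select_map F l bs]
    split_ifs <;> simp

theorem select_sublist {β : Type*} : ∀ (l : List β) (bs : List Bool), (select l bs).Sublist l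
  | [], _ => by simp [select]
  | _ :: _, [] => by simp [select]
  | a :: l, b :: bs => by
    rw [select]
    split_ifs
    · exact (select_sublist l bs).cons_cons a
    · exact (select_sublist l bs).cons a

-- In a list without repetitions the selected set determines the bits, so the event that the sample
-- equals `Y` is a single pattern of coin tosses.
open Classical in
theorem toFinset_select {β : Type*} {Y : Finset β} : ∀ {l : List β} {bs : List Bool}, l.Nodup →
    bs.length = l.length →
    ((∀ a, a ∈ select l bs ↔ a ∈ l ∧ a ∈ Y) ↔ bs = l.map fun a => decide (a ∈ Y))
  | [], bs, _, h => by simp [select, List.length_eq_zero_iff.1 h]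
  | a :: l, [], _, h => by simp at h
  | a :: l, b :: bs, hl, h => by
    obtain ⟨ha, hl⟩ := List.nodup_cons.1 hl
    have ih := toFinset_select (Y := Y) hl (bs := bs) (by simpa using h)
    have has : a ∉ select l bs := fun h => ha ((select_sublist l bs).subset h)
    rw [List.map_cons, List.cons.injEq, ← ih]
    have key : (∀ x, x ∈ select (a :: l) (b :: bs) ↔ x ∈ a :: l ∧ x ∈ Y) ↔
        (b = true ↔ a ∈ Y) ∧ ∀ x, x ∈ select l bs ↔ x ∈ l ∧ x ∈ Y := by
      have hsel : ∀ x, x ∈ select (a :: l) (b :: bs) ↔ (x = a ∧ b = true) ∨ x ∈ select l bs := by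
        intro x
        rw [select]
        split_ifs with hb <;> simp [hb]
      constructor
      · intro h
        refine ⟨?_, fun x => ?_⟩
        · have := h a
          rw [hsel] at this
          simpa [has] using this
        · by_cases hx : x = a
          · subst hx; simp [has, ha]
          · have := h x
            rw [hsel] at this
            simpa [hx] using this
      · rintro ⟨h1, h2⟩ x
        rw [hsel, h2]
        by_cases hx : x = a
        · subst hx; simp [ha, h1]
        · simp [hx]
    rw [key]
    refine and_congr_left fun _ => ?_
    by_cases hY : a ∈ Y <;> cases b <;> simp [hY]

open Classical in
theorem tossProb_map {β : Type*} (p : β → ℝ) {Y : Finset β} : ∀ {l : List β}, l.Nodup →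
    tossProb (l.map p) (l.map fun a => decide (a ∈ Y)) =
      ∏ a ∈ l.toFinset, if a ∈ Y then p a else 1 - p a
  | [], _ => rfl
  | a :: l, hl => by
    obtain ⟨ha, hl⟩ := List.nodup_cons.1 hl
    rw [List.map_cons, List.map_cons, tossProb, tossProb_map p hl, List.toFinset_cons,
      Finset.prod_insert (by simpa using ha)]
    simp

open Classical in
theorem measure_select {β : Type*} {p : β → ℝ} {S Y : Finset β} {l : List β} (hl : l.Nodup)
    (hlS : ∀ a, a ∈ l ↔ a ∈ S) (hp : ∀ a ∈ S, 0 ≤ p a ∧ p a ≤ 1) (hY : Y ⊆ S) :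
    streamMeasure.real {ρ | (select l (sample (l.map p) ρ).1).toFinset = Y} =
      (∏ a ∈ Y, p a) * ∏ a ∈ S \ Y, (1 - p a) := by
  have h1 : {ρ | (select l (sample (l.map p) ρ).1).toFinset = Y} =
      {ρ | (sample (l.map p) ρ).1 = l.map fun a => decide (a ∈ Y)} := by
    ext ρ
    rw [Set.mem_ofPred_eq, Set.mem_ofPred_eq, ← toFinset_select hl (by simp [sample, length_run])]
    rw [Finset.ext_iff]
    refine forall_congr' fun a => ?_
    rw [List.mem_toFinset, and_iff_right_of_imp fun h => (hlS a).2 (hY h)]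
  have hS : l.toFinset = S := Finset.ext fun a => by rw [List.mem_toFinset, hlS]
  have h2 : (∏ a ∈ S, if a ∈ Y then p a else 1 - p a) =
      (∏ a ∈ Y, p a) * ∏ a ∈ S \ Y, (1 - p a) := by
    rw [← Finset.prod_sdiff hY, mul_comm]
    congr 1
    · exact Finset.prod_congr rfl fun a ha => if_pos ha
    · exact Finset.prod_congr rfl fun a ha => if_neg (Finset.mem_sdiff.1 ha).2
  rw [measureReal_def, h1, measure_sample_fst, tossProb_map p hl, hS, h2, ENNReal.toReal_ofReal]
  · refine mul_nonneg (Finset.prod_nonneg fun a ha => (hp a (hY ha)).1)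
      (Finset.prod_nonneg fun a ha => ?_)
    have := (hp a (Finset.mem_sdiff.1 ha).1).2
    linarith
  · intro x hx
    obtain ⟨a, ha, rfl⟩ := List.mem_map.1 hx
    exact hp a ((hlS a).1 ha)

end SkipSampling

/-! ## Sequences of queries -/

theorem ae_mem_Icc : ∀ᵐ ω ∂randMeasure, ∀ i n, ω i n ∈ Set.Icc (0 : ℝ) 1 := by
  rw [ae_all_iff]
  intro i
  rw [ae_all_iff]
  intro n
  have h0 : ∀ᵐ x ∂unifMeasure, x ∈ Set.Icc (0 : ℝ) 1 := ae_restrict_mem measurableSet_Icc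
  have h1 : ∀ᵐ ρ ∂streamMeasure, ρ n ∈ Set.Icc (0 : ℝ) 1 :=
    (measurePreserving_eval_infinitePi (fun _ : ℕ => unifMeasure) n).quasiMeasurePreserving.ae h0
  exact (measurePreserving_eval_infinitePi
    (fun _ : ℕ => streamMeasure) i).quasiMeasurePreserving.ae h1

theorem measurePreserving_query (i : ℕ) :
    MeasurePreserving (fun ω : ℕ → ℕ → ℝ => ω i) randMeasure streamMeasure :=
  measurePreserving_eval_infinitePi (fun _ : ℕ => streamMeasure) i

namespace RamProg.MeasSem

variable {c : RamProg} (M : c.MeasSem)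

/-- The states between successive executions. -/
noncomputable def states (D : RamState) : ℕ → (ℕ → ℕ → ℝ) → RamState
  | 0, _ => D
  | i + 1, ω => M.fin ((states D i ω).withRnd (ω i))

theorem measurable_states (D : RamState) : ∀ i, Measurable (M.states D i) ∧
    Measurable fun ω => (M.states D i ω).withRnd (ω i) := by
  have h : ∀ i, Measurable (M.states D i) →
      Measurable fun ω => (M.states D i ω).withRnd (ω i) := fun i hi =>
    RamState.measurable_mk (fun x => show Measurable fun ω => (M.states D i ω).reg x from
        (RamState.measurable_reg x).comp hi)
      (fun x => show Measurable fun ω => (M.states D i ω).mem x from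
        (RamState.measurable_mem x).comp hi)
      fun x => (measurable_pi_apply x).comp (measurable_pi_apply i)
  intro i
  induction i with
  | zero => exact ⟨measurable_const, h 0 measurable_const⟩
  | succ i ih =>
    have := M.measurable_fin.comp ih.2
    exact ⟨this, h _ this⟩

end RamProg.MeasSem

open SkipSampling in
/-- A program that draws a sample of `S` and never changes the memory below `b` generates a sequence
of independent subset samples. -/
theorem exists_querySequence {m : ℕ} {query : RamProg} {D : RamState} {b K : ℕ}
    {S : Finset (Fin m → ℝ)} {p : (Fin m → ℝ) → ℝ} {l : List (Fin m → ℝ)} (hl : l.Nodup)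
    (hlS : ∀ u, u ∈ l ↔ u ∈ S) (hp : ∀ u ∈ S, 0 ≤ p u ∧ p u ≤ 1) {e : ℕ}
    (h : ∀ s, (∀ a < b, s.mem a = D.mem a) → (∀ n, s.rnd n ∈ Set.Icc (0 : ℝ) 1) →
      Runs query s (K * (1 + e * (sample (l.map p) s.rnd).2)) fun s' =>
        (∀ a < b, s'.mem a = s.mem a) ∧ s'.outputList m = select l (sample (l.map p) s.rnd).1) :
    ∃ (St : ℕ → (ℕ → ℕ → ℝ) → RamState) (T : ℕ → (ℕ → ℕ → ℝ) → ℕ),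
      IsQuerySequence query D St T ∧
      (∀ i, ∀ᵐ ω ∂randMeasure, ((St (i + 1) ω).outputList m).Nodup) ∧
      (∀ i, IsSubsetSample randMeasure S p (fun ω => (St (i + 1) ω).outputSet m)) ∧
      iIndepFun (m := fun _ => ⊤) (fun i ω => (St (i + 1) ω).outputSet m) randMeasure ∧
      (∀ i, AEMeasurable (T i) randMeasure) ∧
      ∀ i, ∫⁻ ω, (T i ω : ENNReal) ∂randMeasure ≤
        ENNReal.ofReal (K * (1 + e * (4 * ∑ u ∈ S, p u))) := by
  classical
  obtain ⟨M⟩ := query.nonempty_measSem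
  -- By induction no query changes the memory below `b`, so the list that the `i`-th query returns
  -- is a function of `ω i` alone.
  have key : ∀ᵐ ω ∂randMeasure, ∀ i, (∀ a < b, (M.states D i ω).mem a = D.mem a) ∧
      RamExec query ((M.states D i ω).withRnd (ω i)) (M.time ((M.states D i ω).withRnd (ω i)))
        (M.states D (i + 1) ω) ∧
      M.time ((M.states D i ω).withRnd (ω i)) ≤ K * (1 + e * (sample (l.map p) (ω i)).2) ∧
      (M.states D (i + 1) ω).outputList m = select l (sample (l.map p) (ω i)).1 := by
    filter_upwards [ae_mem_Icc] with ω hω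
    have step : ∀ i, (∀ a < b, (M.states D i ω).mem a = D.mem a) →
        (∀ a < b, (M.states D (i + 1) ω).mem a = D.mem a) ∧
        RamExec query ((M.states D i ω).withRnd (ω i)) (M.time ((M.states D i ω).withRnd (ω i)))
          (M.states D (i + 1) ω) ∧
        M.time ((M.states D i ω).withRnd (ω i)) ≤ K * (1 + e * (sample (l.map p) (ω i)).2) ∧
        (M.states D (i + 1) ω).outputList m = select l (sample (l.map p) (ω i)).1 := by
      intro i hi
      obtain ⟨t, s', h1, h2, h3, h4⟩ := h ((M.states D i ω).withRnd (ω i)) hi (hω i)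
      have h5 := M.exec _ (M.mem_dom h1)
      obtain ⟨rfl, rfl⟩ := h1.deterministic h5
      exact ⟨fun a ha => (h3 a ha).trans (hi a ha), h5, h2, h4⟩
    have hmem : ∀ i, ∀ a < b, (M.states D i ω).mem a = D.mem a := by
      intro i
      induction i with
      | zero => exact fun a _ => rfl
      | succ i ih => exact (step i ih).1
    exact fun i => ⟨hmem i, (step i (hmem i)).2⟩
  have hset : ∀ i, (fun ω : ℕ → ℕ → ℝ => (select l (sample (l.map p) (ω i)).1).toFinset)
      =ᵐ[randMeasure] fun ω => (M.states D (i + 1) ω).outputSet m := fun i => by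
    filter_upwards [key] with ω hω
    rw [RamState.outputSet, (hω i).2.2.2]
  refine ⟨M.states D, fun i ω => M.time ((M.states D i ω).withRnd (ω i)), ⟨fun _ => rfl, ?_⟩,
    fun i => ?_, fun i Y hY => ?_, ?_, fun i => ?_, fun i => ?_⟩
  · filter_upwards [key] with ω hω i using (hω i).2.1
  · filter_upwards [key] with ω hω
    rw [(hω i).2.2.2]
    exact hl.sublist (select_sublist _ _)
  · have hA : MeasurableSet {ρ | (select l (sample (l.map p) ρ).1).toFinset = Y} :=
      measurableSet_sample _ fun r => (select l r.1).toFinset = Y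
    have hmp := measurePreserving_query i
    have hae : ((fun ω => (M.states D (i + 1) ω).outputSet m) ⁻¹' {Y} : Set (ℕ → ℕ → ℝ))
        =ᵐ[randMeasure] (fun ω : ℕ → ℕ → ℝ => ω i) ⁻¹'
          {ρ | (select l (sample (l.map p) ρ).1).toFinset = Y} := by
      filter_upwards [hset i] with ω hω
      exact propext (by
        change (M.states D (i + 1) ω).outputSet m = Y ↔
          (select l (sample (l.map p) (ω i)).1).toFinset = Y
        rw [hω])
    refine ⟨(hmp.measurable hA).nullMeasurableSet.congr hae.symm, ?_⟩
    rw [measureReal_congr hae, measureReal_def, hmp.measure_preimage hA.nullMeasurableSet,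
      ← measureReal_def]
    convert measure_select hl hlS hp hY
  -- Up to null sets the samples are functions of the separate coordinates of a product measure.
  · refine iIndepFun.congr hset ?_
    let _ : MeasurableSpace (List Bool) := ⊤
    let _ : MeasurableSpace (Finset (Fin m → ℝ)) := ⊤
    -- Sets of tuples form an uncountable type with the discrete σ-algebra; measurability is
    -- obtained by factoring through the bit patterns, of which there are only countably many.
    have h1 : Measurable fun ρ : ℕ → ℝ => (sample (l.map p) ρ).1 :=
      measurable_to_countable' fun bs => measurableSet_sample _ fun r => r.1 = bs
    have h2 : Measurable fun ρ : ℕ → ℝ => (select l (sample (l.map p) ρ).1).toFinset :=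
      (measurable_from_top (f := fun bs => (select l bs).toFinset)).comp h1
    exact iIndepFun_infinitePi (P := fun _ : ℕ => streamMeasure)
      (X := fun _ ρ => (select l (sample (l.map p) ρ).1).toFinset) fun _ => h2
  · exact (M.measurable_time.comp (M.measurable_states D i).2).aemeasurable
  · have hmeas := measurable_sample (l.map p) fun r => (r.2 : ENNReal)
    have hbound : ∀ x ∈ l.map p, 0 ≤ x ∧ x ≤ 1 := fun x hx => by
      obtain ⟨u, hu, rfl⟩ := List.mem_map.1 hx
      exact hp u ((hlS u).1 hu)
    have hsum : (l.map p).sum = ∑ u ∈ S, p u := by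
      rw [← List.sum_toFinset _ hl]
      exact Finset.sum_congr (Finset.ext fun u => by rw [List.mem_toFinset, hlS]) fun _ _ => rfl
    have h0 : 0 ≤ ∑ u ∈ S, p u := Finset.sum_nonneg fun u hu => (hp u hu).1
    calc ∫⁻ ω, (M.time ((M.states D i ω).withRnd (ω i)) : ENNReal) ∂randMeasure
        ≤ ∫⁻ ω : ℕ → ℕ → ℝ, (K * (1 + e * ((sample (l.map p) (ω i)).2 : ENNReal)) : ENNReal)
          ∂randMeasure := lintegral_mono_ae (by
            filter_upwards [key] with ω hω
            exact_mod_cast (hω i).2.2.1)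
      _ = ∫⁻ ρ, (K * (1 + e * ((sample (l.map p) ρ).2 : ENNReal)) : ENNReal) ∂streamMeasure :=
          (measurePreserving_query i).lintegral_comp
            (f := fun ρ => (K * (1 + e * ((sample (l.map p) ρ).2 : ENNReal)) : ENNReal))
            ((hmeas.const_mul _).const_add 1 |>.const_mul _)
      _ = K * (1 + e * ∫⁻ ρ, ((sample (l.map p) ρ).2 : ENNReal) ∂streamMeasure) := by
          rw [lintegral_const_mul _ ((hmeas.const_mul _).const_add 1),
            lintegral_add_right _ (hmeas.const_mul _), lintegral_const_mul _ hmeas]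
          simp
      _ ≤ K * (1 + e * ENNReal.ofReal (4 * ∑ u ∈ S, p u)) := by
          rw [← hsum]
          gcongr
          exact lintegral_sample_snd hbound
      _ = _ := by
          rw [ENNReal.ofReal_mul (p := (K : ℝ)) (by positivity),
            ENNReal.ofReal_add zero_le_one (by positivity),
            ENNReal.ofReal_mul (p := (e : ℝ)) (by positivity)]
          simp

/-! ### Assembling the two programs and the constants. -/

instance (m k : ℕ) : Finite (JoinSchema m k) :=
  Finite.of_injective JoinSchema.attrs fun Q Q' h => by
    obtain ⟨a, ha⟩ := Q
    obtain ⟨a', ha'⟩ := Q'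
    obtain rfl : a = a' := h
    rfl

theorem JoinInstance.prob_mem {m k : ℕ} {Q : JoinSchema m k} (I : JoinInstance Q) :
    ∀ u ∈ I.join, 0 ≤ I.prob u ∧ I.prob u ≤ 1 := by
  intro u hu
  have h := fun j => I.wt_mem j _ ((I.mem_join u).1 hu j)
  exact ⟨Finset.prod_nonneg fun j _ => (h j).1, Finset.prod_le_one (fun j _ => (h j).1)
    fun j _ => (h j).2⟩

open Layout SkipSampling in
theorem exists_programs {m k : ℕ} (Q : JoinSchema m k) (hQ : Q.IsAcyclic) :
    ∃ (K : ℕ) (build query : RamProg), ∀ (I : JoinInstance Q) (ord : I.Listing) (d : ℕ),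
      I.size < 2 ^ d → ∃ (D : RamState) (tBuild : ℕ), RamExec build (I.inputState ord) tBuild D ∧
        tBuild ≤ K * ((I.size + 1) * (d + 1)) ∧
        (∀ a, k + (m + 1) * I.size + 4 * (I.size + k + 1) ≤ a → D.mem a = 0) ∧
        ∃ (S : ℕ → (ℕ → ℕ → ℝ) → RamState) (T : ℕ → (ℕ → ℕ → ℝ) → ℕ),
          IsQuerySequence query D S T ∧
          (∀ i, ∀ᵐ ω ∂randMeasure, ((S (i + 1) ω).outputList m).Nodup) ∧
          (∀ i, IsSubsetSample randMeasure I.join I.prob (fun ω => (S (i + 1) ω).outputSet m)) ∧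
          iIndepFun (m := fun _ => ⊤) (fun i ω => (S (i + 1) ω).outputSet m) randMeasure ∧
          (∀ i, AEMeasurable (T i) randMeasure) ∧
          ∀ i, ∫⁻ ω, (T i ω : ENNReal) ∂randMeasure ≤
            ENNReal.ofReal (K * (1 + (d + 1 : ℕ) * (4 * I.mu))) := by
  obtain ⟨r, es, hes, hall⟩ := hQ.exists_joinOrder
  obtain ⟨K₁, h₁⟩ := runs_build hes
  obtain ⟨K₂, h₂⟩ := runs_query Q r es hes hall
  refine ⟨K₁ + K₂, build Q r es, query Q r es, fun I ord d hd => ?_⟩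
  have hoff := I.data_off_self ord
  obtain ⟨t, D, hexec, ht, hin, hindex, hzero⟩ := h₁ (I.data ord) (I.inputState ord) d
    (I.hasInput_inputState ord) (by rw [hoff]; exact hd)
    fun a ha => I.inputState_mem_of_base_le ord ha
  rw [hoff] at ht hzero
  refine ⟨D, t, hexec, ht.trans (Nat.mul_le_mul_right _ (by omega)), fun a ha => hzero a ?_, ?_⟩
  · rwa [JoinData.base, hoff]
  obtain ⟨T, hTQ, hTval, hperm, hst⟩ := hindex.exists_isStored hes
  -- The index was described with the input order of the tuples; from here on the sorted lists of
  -- `T` are used.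
  rw [← TupleLists.finalWeights_congr (T := T) hTQ hTval hperm] at hst
  obtain ⟨hnd, hmem, hmap⟩ := I.map_assemble_results hTQ hTval hperm hes hall
  obtain ⟨S, U, g1, g2, g3, g4, g5, g6⟩ := exists_querySequence (query := query Q r es) (D := D)
    (b := (I.data ord).out) (K := K₂) hnd hmem I.prob_mem (e := d + 1) fun s hs hrnd => by
      rw [← hmap, select_map]
      exact h₂ (I.data ord) T s d _ hTQ hTval hperm (hin.of_lt_out hs) (by rw [hoff]; exact hd)
        (I.val_weight_nonneg ord) (hst.of_lt_out hperm hs) hrnd _ rfl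
  have hmu : 0 ≤ I.mu := Finset.sum_nonneg fun u hu => (I.prob_mem u hu).1
  refine ⟨S, U, g1, g2, g3, g4, g5, fun i => (g6 i).trans (ENNReal.ofReal_le_ofReal ?_)⟩
  refine mul_le_mul_of_nonneg_right ?_ ?_
  · push_cast
    have : (0 : ℝ) ≤ K₁ := Nat.cast_nonneg _
    linarith
  · change 0 ≤ 1 + ((d + 1 : ℕ) : ℝ) * (4 * I.mu)
    positivity

theorem one_le_logb_two {n : ℕ} (hn : 3 ≤ n) : 1 ≤ Real.logb 2 n := by
  have h : (3 : ℝ) ≤ n := by exact_mod_cast hn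
  rw [Real.le_logb_iff_rpow_le one_lt_two (by linarith), Real.rpow_one]
  linarith

/-- `3 ^ 2 ≥ 2 ^ 3` gives `logb 2 3 ≥ 3 / 2`, and `(3 / 2) ^ 2 ≥ 2`. This permits the factor `log
log N` to be inserted into a bound of order `N log N`. -/
theorem half_le_logb_logb_two {n : ℕ} (hn : 3 ≤ n) : 1 / 2 ≤ Real.logb 2 (Real.logb 2 n) := by
  have h : (3 : ℝ) ≤ n := by exact_mod_cast hn
  have h1 : 3 / 2 ≤ Real.logb 2 n := by
    have h2 : (3 : ℝ) ≤ Real.logb 2 ((n : ℝ) ^ 2) := by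
      rw [Real.le_logb_iff_rpow_le one_lt_two (by positivity)]
      norm_num
      nlinarith
    rw [Real.logb_pow] at h2
    push_cast at h2
    linarith
  have h3 : (1 : ℝ) ≤ Real.logb 2 (Real.logb 2 n ^ 2) := by
    rw [Real.le_logb_iff_rpow_le one_lt_two (by positivity), Real.rpow_one]
    nlinarith
  rw [Real.logb_pow] at h3
  push_cast at h3
  linarith

theorem theorem3p2 (m k : ℕ) :
    ∃ C : ℝ, ∀ Q : JoinSchema m k, Q.IsAcyclic →
      ∃ build query : RamProg, ∀ (I : JoinInstance Q) (ord : I.Listing),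
        ∃ (D : RamState) (tBuild : ℕ), RamExec build (I.inputState ord) tBuild D ∧
          -- size of the index and preprocessing time
          (3 ≤ I.size →
            (∀ a : ℕ, C * (I.size * Real.logb 2 I.size) ≤ a → D.mem a = 0) ∧
            (tBuild : ℝ) ≤
              C * (I.size * Real.logb 2 I.size * Real.logb 2 (Real.logb 2 I.size))) ∧
          ∃ (S : ℕ → (ℕ → ℕ → ℝ) → RamState) (T : ℕ → (ℕ → ℕ → ℝ) → ℕ),
            IsQuerySequence query D S T ∧
            -- each query lists a subset sample of the join result without repetitions
            (∀ i, ∀ᵐ ω ∂randMeasure, ((S (i + 1) ω).outputList m).Nodup) ∧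
            (∀ i, IsSubsetSample randMeasure I.join I.prob
              (fun ω => (S (i + 1) ω).outputSet m)) ∧
            -- distinct queries return independent samples
            iIndepFun (m := fun _ => ⊤) (fun i ω => (S (i + 1) ω).outputSet m) randMeasure ∧
            -- expected query time
            (∀ i, AEMeasurable (T i) randMeasure) ∧
            (3 ≤ I.size → ∀ i, ∫⁻ ω, (T i ω : ENNReal) ∂randMeasure ≤
              ENNReal.ofReal (C * (1 + I.mu * Real.logb 2 I.size))) := by
  choose K build query h using fun Q : {Q : JoinSchema m k // Q.IsAcyclic} =>
    exists_programs Q.1 Q.2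
  -- There are finitely many schemas for given `m` and `k`, so one constant serves all of them.
  obtain ⟨L, hL⟩ := Finite.exists_le K
  -- With `N + 1 ≤ 2 * N` and `d + 1 ≤ 3 * log N`, building takes at most `6 * L * N * log N`, and
  -- the lower bound `1 / 2` for `log log N` doubles the factor; for the query, `3 * 4 = 12`. The
  -- other summand bounds the index, because `5 * k + 4 + (m + 5) * N ≤ (m + 5 * k + 9) * N`.
  refine ⟨12 * L + (m + 5 * k + 9), fun Q hQ => ⟨build ⟨Q, hQ⟩, query ⟨Q, hQ⟩, fun I ord => ?_⟩⟩
  have hKL : (K ⟨Q, hQ⟩ : ℝ) ≤ L := by exact_mod_cast hL ⟨Q, hQ⟩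
  -- The number of binary digits of `N`, so that `N < 2 ^ d`.
  set d := Nat.log 2 I.size + 1 with hd
  obtain ⟨D, t, hexec, ht, hzero, S, T, g1, g2, g3, g4, g5, g6⟩ :=
    h ⟨Q, hQ⟩ I ord d (Nat.lt_pow_succ_log_self one_lt_two _)
  have hlog : 3 ≤ I.size → ((d + 1 : ℕ) : ℝ) ≤ 3 * Real.logb 2 I.size := fun hN => by
    have h1 : (Nat.log 2 I.size : ℝ) ≤ Real.logb 2 I.size := by
      have := Real.natLog_le_logb I.size 2
      exact_mod_cast this
    have h2 := one_le_logb_two hN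
    rw [hd]
    push_cast
    linarith
  refine ⟨D, t, hexec, fun hN => ⟨fun a ha => hzero a ?_, ?_⟩, S, T, g1, g2, g3, g4, g5,
    fun hN i => (g6 i).trans (ENNReal.ofReal_le_ofReal ?_)⟩
  · have h1 := one_le_logb_two hN
    have h3 : (3 : ℝ) ≤ I.size := by exact_mod_cast hN
    have h2 : (I.size : ℝ) ≤ I.size * Real.logb 2 I.size := le_mul_of_one_le_right (by linarith) h1
    have h4 : (12 * (L : ℝ) + (m + 5 * k + 9)) * I.size ≤ a :=
      (mul_le_mul_of_nonneg_left h2 (by positivity)).trans ha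
    have h5 : ((k + (m + 1) * I.size + 4 * (I.size + k + 1) : ℕ) : ℝ) ≤ a := by
      refine le_trans ?_ h4
      push_cast
      have h6 : (0 : ℝ) ≤ L * I.size := by positivity
      have h7 : (k : ℝ) * 1 ≤ k * I.size := by gcongr; linarith
      nlinarith
    exact_mod_cast h5
  · have h1 := one_le_logb_two hN
    have h2 := half_le_logb_logb_two hN
    have h3 : (3 : ℝ) ≤ I.size := by exact_mod_cast hN
    set l := Real.logb 2 I.size
    set ll := Real.logb 2 l
    have h4 : (t : ℝ) ≤ K ⟨Q, hQ⟩ * ((I.size + 1) * ((d + 1 : ℕ) : ℝ)) := by exact_mod_cast ht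
    have h5 : ((I.size : ℝ) + 1) * ((d + 1 : ℕ) : ℝ) ≤ (2 * I.size) * (3 * l) := by
      gcongr
      · linarith
      · exact hlog hN
    have h6 : (0 : ℝ) ≤ I.size * l := by positivity
    calc (t : ℝ) ≤ K ⟨Q, hQ⟩ * ((I.size + 1) * ((d + 1 : ℕ) : ℝ)) := h4
      _ ≤ L * ((2 * I.size) * (3 * l)) := by gcongr
      _ = (12 * L) * (I.size * l * (1 / 2)) := by ring
      _ ≤ (12 * L + (m + 5 * k + 9)) * (I.size * l * ll) := by
        gcongr
        have : (0 : ℝ) ≤ m + 5 * k + 9 := by positivity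
        linarith
  · have h1 := one_le_logb_two hN
    have h0 : 0 ≤ I.mu := Finset.sum_nonneg fun u hu => (I.prob_mem u hu).1
    set l := Real.logb 2 I.size
    have h2 : 1 + ((d + 1 : ℕ) : ℝ) * (4 * I.mu) ≤ 12 * (1 + I.mu * l) := by
      have := mul_le_mul_of_nonneg_right (hlog hN) h0
      nlinarith
    have h3 : 0 ≤ 1 + I.mu * l := by positivity
    calc (K ⟨Q, hQ⟩ : ℝ) * (1 + ((d + 1 : ℕ) : ℝ) * (4 * I.mu))
        ≤ L * (12 * (1 + I.mu * l)) := by gcongr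
      _ = (12 * L) * (1 + I.mu * l) := by ring
      _ ≤ _ := by
        gcongr
        have : (0 : ℝ) ≤ m + 5 * k + 9 := by positivity
        linarith
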